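/- Let $d \ge 3$ be an integer and $\lambda \in \mathbb{R}$. For a positive integer $n$ such that $dn$ is even and $n > d$, and for $p \in [0,1]$, let $G(n,d,p)$ be the random graph obtained by drawing a simple $d$-regular graph on $n$ labelled vertices uniformly at random and then retaining each of its edges independently with probability $p$ and deleting it with probability $1-p$. Let $|\mathcal{C}_1|$ be the number of vertices of a largest connected component of $G(n,d,p)$. Consider $p = \frac{1+\lambda n^{-1/3}}{d-1}$. There exist constants $c = c(\lambda,d) > 0$ and $C = C(\lambda,d) < \infty$ such that for every $A > 0$ and all $n$ (with $n > d$, $dn$ even, and $\frac{1+\lambda n^{-1/3}}{d-1} \in [0,1]$), $$\mathbf{P}\left(|\mathcal{C}_1| \ge A n^{2/3}\right) \le \frac{C e^{-cA^3}}{A}.$$ Furthermore, there exist constants $D = D(\lambda,d) < \infty$ and $\delta_0 = \delta_0(\lambda,d) > 0$ such that for every $\delta \in (0,\delta_0)$ and all such $n$, $$\mathbf{P}\left(|\mathcal{C}_1| < \lceil \delta n^{2/3} \rceil\right) \le D\,\delta^{1/2}.$$ -/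

import Mathlib

open MeasureTheory ProbabilityTheory

/-- The set of simple `d`-regular graphs on the vertex set `Fin n`. -/
def regularGraphs (n d : ℕ) : Set (SimpleGraph (Fin n)) :=
  open scoped Classical in {G | G.IsRegularOfDegree d}

/-- The law of `p`-bond percolation on `G`: each edge of `G` is retained independently with
probability `p` and deleted with probability `1 - p`; all vertices are kept. -/
noncomputable def bondPercolation {V : Type*} (G : SimpleGraph V) (p : unitInterval) :
    Measure (SimpleGraph V) :=
  (setBernoulli G.edgeSet p).map SimpleGraph.fromEdgeSet

/-- Singletons are measurable in the space of graphs on a countable vertex set. -/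
instance SimpleGraph.instMeasurableSingletonClass' {V : Type*} [Countable V] :
    MeasurableSingletonClass (SimpleGraph V) :=
  ⟨fun G => by
    have h : ({G} : Set (SimpleGraph V)) = SimpleGraph.edgeSet ⁻¹' {G.edgeSet} := by
      ext H; simp
    rw [h]
    exact SimpleGraph.measurableEmbedding_edgeSet.measurable (measurableSet_singleton _)⟩

/-- `p`-bond percolation as a Markov kernel, from a graph to the random graph that the percolation
leaves of it. -/
noncomputable def percolationKernel (n : ℕ) (p : unitInterval) :
    Kernel (SimpleGraph (Fin n)) (SimpleGraph (Fin n)) :=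
  Kernel.ofFunOfCountable fun G => bondPercolation G p

/-- The law of `G(n, d, p)`: draw a simple `d`-regular graph on `n` labelled vertices uniformly at
random, then perform independent `p`-bond percolation on it. -/
noncomputable def randomRegularPercolation (n d : ℕ) (p : unitInterval) :
    Measure (SimpleGraph (Fin n)) :=
  (uniformOn (regularGraphs n d)).bind (percolationKernel n p)

/-- The number of vertices of a largest connected component of a graph on `Fin n`. -/
noncomputable def largestComponent {n : ℕ} (G : SimpleGraph (Fin n)) : ℕ :=
  ⨆ c : G.ConnectedComponent, c.supp.ncard

/-!
The percolated random regular graph is studied through the configuration model. A half-edge is a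
pair of a vertex and one of its `d` slots; a uniform perfect matching of the `d n` half-edges that
gives a simple graph gives a uniform `d`-regular graph, since every such graph comes from `(d!) ^ n`
matchings (`card_fiber`). A perfect matching is simple with probability bounded below
(`card_simple_ge`): on average there are boundedly many half-edges on loops or multiple edges, and a
switching with a generic edge removes some of them and creates none, so that the numbers of
matchings with `b` and with fewer than `b` of them are comparable. Percolation keeps a binomial
number of edges, and given that number `k` the remaining configuration is a uniform matching of the
half-edges with `k` pairs. So, up to a constant factor, it is enough to treat uniform matchings with
`k` pairs (`randomRegularPercolation_le`), for `k` within a Chernoff window about its mean.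

In a uniform matching with `k` pairs the component of a vertex is explored by revealing the partner
of one active half-edge at a time. What remains is again a uniform matching (`sum_next_le`), and the
number of active half-edges is a random walk with steps `-1`, `-2` and `d - 2`; at criticality its
drift is of order `n ^ (-1 / 3)` on the time scale `n ^ (2 / 3)`.

*Upper tail.* The explored vertices are no longer available, so at time `t` the drift is at most
`O(A n ^ (-1 / 3)) - c t / n`. With `θ` of order `A n ^ (-1 / 3)`, an exponential supermartingale in
`exp (θ s)` bounds the probability of surviving `T`, of order `A n ^ (2 / 3)`, steps. To gain the
additional factor `θ`, the initial supermartingale is replaced, up to a time `t₀` of order `θ⁻²`, by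
one that is nearly linear in `s` near `0` (`earlyPotential`). Thus a vertex lies in a component with
at least `A n ^ (2 / 3)` vertices with probability at most a constant times
`A n ^ (-1 / 3) exp (-c A ^ 3)`; as such a component contains `A n ^ (2 / 3)` vertices, the Markov
inequality bounds the probability that one exists by a constant times `exp (-c A ^ 3)`
(`card_large_component_le`), and a smaller `c` absorbs the factor `1 / A`.

*Lower tail.* Run the exploration for `n ^ (2 / 3)` steps, with a fresh vertex whenever the active
half-edges run out. The square of their number grows by at least a constant per step, so that it
reaches `h₀ = δ ^ (1 / 4) n ^ (1 / 3)` except with probability `O(h₀ ^ 2 / n ^ (2 / 3))`. From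
height `h₀`, a second moment bound shows that they survive a further `d δ n ^ (2 / 3)` steps except
with probability `O(δ n ^ (2 / 3) / h₀ ^ 2)` (`not_survives_le`, `fails_le`); every step uses up a
half-edge of the current component, so that component is large. Both errors are `O(δ ^ (1 / 2))`
(`card_small_component_le`).
-/

namespace RegularPercolation

/-! ### Uniform partial matchings -/

section Matchings

variable {α : Type*} [DecidableEq α]

lemma swap_mul_invol {m : Equiv.Perm α} (hm : ∀ x, m (m x) = x) {e f : α} (hmef : m e = f) (x : α) :
    (Equiv.swap e f * m) ((Equiv.swap e f * m) x) = x := by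
  have hf : m f = e := by rw [← hmef, hm]
  simp only [Equiv.Perm.mul_apply]
  rcases eq_or_ne x e with rfl | hxe
  · simp [hmef]
  rcases eq_or_ne x f with rfl | hxf
  · simp [hf]
  have h1 : m x ≠ e := fun h => hxf (by rw [← hm x, h, hmef])
  have h2 : m x ≠ f := fun h => hxe (by rw [← hm x, h, hf])
  rw [Equiv.swap_apply_of_ne_of_ne h1 h2, hm, Equiv.swap_apply_of_ne_of_ne hxe hxf]

variable [Fintype α]

/-- The partial matchings of the points of `X` with exactly `k` pairs. A partial matching is encoded
as an involution of the ambient type: the points it moves are the matched ones, and it exchanges the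
two points of every pair. -/
def matchings (X : Finset α) (k : ℕ) : Finset (Equiv.Perm α) :=
  Finset.univ.filter fun m => (∀ x, m (m x) = x) ∧ m.support ⊆ X ∧ m.support.card = 2 * k

/-- The number of matchings with `k` pairs of a set of `h` points. -/
def numMatchings (h k : ℕ) : ℕ := h.choose (2 * k) * Nat.doubleFactorial (2 * k - 1)

lemma mem_matchings {X : Finset α} {k : ℕ} {m : Equiv.Perm α} :
    m ∈ matchings X k ↔ (∀ x, m (m x) = x) ∧ m.support ⊆ X ∧ m.support.card = 2 * k := by
  simp [matchings]

lemma matchings_zero (X : Finset α) : matchings X 0 = {1} := by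
  ext m
  simp only [mem_matchings, Finset.mem_singleton, mul_zero, Finset.card_eq_zero,
    Equiv.Perm.support_eq_empty_iff]
  constructor
  · rintro ⟨-, -, h⟩; exact h
  · rintro rfl; simp

lemma filter_fixed {X : Finset α} {k : ℕ} {e : α} :
    (matchings X k).filter (fun m => m e = e) = matchings (X.erase e) k := by
  ext m
  simp only [Finset.mem_filter, mem_matchings, Finset.subset_erase, Equiv.Perm.mem_support, not_not]
  tauto

/-- Multiplication by the transposition of `e` and `f` removes the pair `{e, f}` from an involution
that exchanges `e` and `f`. -/
lemma support_swap_mul {m : Equiv.Perm α} (hm : ∀ x, m (m x) = x) {e f : α} (hmef : m e = f) :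
    (Equiv.swap e f * m).support = (m.support.erase e).erase f := by
  have hf : m f = e := by rw [← hmef, hm]
  ext x
  simp only [Equiv.Perm.mem_support, Finset.mem_erase, Equiv.Perm.mul_apply]
  rcases eq_or_ne x e with rfl | hxe
  · simp [hmef]
  rcases eq_or_ne x f with rfl | hxf
  · simp [hf]
  have h1 : m x ≠ e := fun h => hxf (by rw [← hm x, h, hmef])
  have h2 : m x ≠ f := fun h => hxe (by rw [← hm x, h, hf])
  simp [Equiv.swap_apply_of_ne_of_ne h1 h2, hxe, hxf]

lemma swap_mul_mem_matchings {X : Finset α} {k : ℕ} {e f : α} {m : Equiv.Perm α} (hef : e ≠ f)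
    (hm : m ∈ matchings X (k + 1)) (hmef : m e = f) :
    Equiv.swap e f * m ∈ matchings ((X.erase e).erase f) k := by
  obtain ⟨h1, h2, h3⟩ := mem_matchings.1 hm
  have hf : m f = e := by rw [← hmef, h1]
  refine mem_matchings.2 ⟨swap_mul_invol h1 hmef, ?_, ?_⟩
  · rw [support_swap_mul h1 hmef]
    exact Finset.erase_subset_erase _ (Finset.erase_subset_erase _ h2)
  · rw [support_swap_mul h1 hmef, Finset.card_erase_of_mem, Finset.card_erase_of_mem, h3]
    · omega
    · simp [hmef, hef.symm]
    · simp [hef.symm, hf, hef]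

lemma swap_mul_mem_matchings' {X : Finset α} {k : ℕ} {e f : α} {m : Equiv.Perm α} (hef : e ≠ f)
    (he : e ∈ X) (hfX : f ∈ X) (hm : m ∈ matchings ((X.erase e).erase f) k) :
    Equiv.swap e f * m ∈ matchings X (k + 1) ∧ (Equiv.swap e f * m) e = f := by
  obtain ⟨h1, h2, h3⟩ := mem_matchings.1 hm
  have hme : m e = e := by
    by_contra h
    simpa using h2 (Equiv.Perm.mem_support.2 h)
  have hmf : m f = f := by
    by_contra h
    simpa using h2 (Equiv.Perm.mem_support.2 h)
  have hne : ∀ x, x ≠ e → x ≠ f → m x ≠ e ∧ m x ≠ f := fun x hx hx' =>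
    ⟨fun h => hx (by rw [← h1 x, h, hme]), fun h => hx' (by rw [← h1 x, h, hmf])⟩
  have hsupp : (Equiv.swap e f * m).support = insert e (insert f m.support) := by
    ext x
    simp only [Equiv.Perm.mem_support, Finset.mem_insert, Equiv.Perm.mul_apply]
    rcases eq_or_ne x e with rfl | hxe
    · simp [hme, hef.symm]
    rcases eq_or_ne x f with rfl | hxf
    · simp [hmf, hef]
    obtain ⟨h4, h5⟩ := hne x hxe hxf
    simp [Equiv.swap_apply_of_ne_of_ne h4 h5, hxe, hxf]
  refine ⟨mem_matchings.2 ⟨?_, ?_, ?_⟩, by simp [hme]⟩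
  · intro x
    simp only [Equiv.Perm.mul_apply]
    rcases eq_or_ne x e with rfl | hxe
    · simp [hme, hmf]
    rcases eq_or_ne x f with rfl | hxf
    · simp [hme, hmf]
    obtain ⟨h4, h5⟩ := hne x hxe hxf
    rw [Equiv.swap_apply_of_ne_of_ne h4 h5, h1, Equiv.swap_apply_of_ne_of_ne hxe hxf]
  · rw [hsupp]
    intro x hx
    simp only [Finset.mem_insert] at hx
    rcases hx with rfl | rfl | hx
    · exact he
    · exact hfX
    · have := h2 hx
      simp only [Finset.mem_erase] at this
      exact this.2.2
  · rw [hsupp, Finset.card_insert_of_notMem, Finset.card_insert_of_notMem, h3]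
    · ring
    · simp [hmf]
    · simp [hme, hef]

/-- Revealing the partner `f` of a point `e` leaves a uniform matching of the other points. -/
lemma sum_filter_pair {X : Finset α} {k : ℕ} {e f : α} (hef : e ≠ f) (he : e ∈ X) (hf : f ∈ X)
    (F : Equiv.Perm α → ℝ) :
    ∑ m ∈ (matchings X (k + 1)).filter (fun m => m e = f), F m
      = ∑ m ∈ matchings ((X.erase e).erase f) k, F (Equiv.swap e f * m) := by
  refine Finset.sum_nbij' (fun m => Equiv.swap e f * m) (fun m => Equiv.swap e f * m) ?_ ?_ ?_ ?_ ?_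
  · intro m hm
    rw [Finset.mem_filter] at hm
    exact swap_mul_mem_matchings hef hm.1 hm.2
  · intro m hm
    rw [Finset.mem_filter]
    exact swap_mul_mem_matchings' hef he hf hm
  · intro m _
    simp
  · intro m _
    simp
  · intro m _
    simp

/-- Summing over the matchings of `X` by cases on what they do to a point `e` of `X`. -/
lemma sum_matchings_succ {X : Finset α} {k : ℕ} {e : α} (he : e ∈ X) (F : Equiv.Perm α → ℝ) :
    ∑ m ∈ matchings X (k + 1), F m = ∑ m ∈ matchings (X.erase e) (k + 1), F m
      + ∑ f ∈ X.erase e, ∑ m ∈ matchings ((X.erase e).erase f) k, F (Equiv.swap e f * m) := by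
  rw [← Finset.sum_filter_add_sum_filter_not _ (fun m => m e = e), filter_fixed]
  congr 1
  rw [← Finset.sum_fiberwise_of_maps_to (s := (matchings X (k + 1)).filter (fun m => ¬ m e = e))
    (t := X.erase e) (g := fun m => m e)]
  · refine Finset.sum_congr rfl fun f hf => ?_
    rw [Finset.mem_erase] at hf
    rw [← sum_filter_pair hf.1.symm he hf.2, Finset.filter_filter]
    refine Finset.sum_congr ?_ fun _ _ => rfl
    ext m
    simp only [Finset.mem_filter, and_congr_right_iff, and_iff_right_iff_imp]
    rintro - rfl
    exact hf.1
  · intro m hm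
    rw [Finset.mem_filter] at hm
    obtain ⟨h1, h2, h3⟩ := mem_matchings.1 hm.1
    refine Finset.mem_erase.2 ⟨hm.2, h2 ?_⟩
    rw [Equiv.Perm.mem_support, h1]
    exact fun h => hm.2 h.symm

lemma numMatchings_zero (h : ℕ) : numMatchings h 0 = 1 := by simp [numMatchings]

lemma numMatchings_zero_succ (k : ℕ) : numMatchings 0 (k + 1) = 0 := by
  simp [numMatchings, Nat.mul_add]

lemma numMatchings_eq_zero {h k : ℕ} (hk : h < 2 * k) : numMatchings h k = 0 := by
  simp [numMatchings, Nat.choose_eq_zero_of_lt hk]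

lemma numMatchings_pos {h k : ℕ} (hk : 2 * k ≤ h) : 0 < numMatchings h k :=
  Nat.mul_pos (Nat.choose_pos hk) (Nat.doubleFactorial_pos _)

/-- A given point is unmatched in a fraction `1 - 2k / (h + 1)` of the matchings with `k` pairs of
`h + 1` points. -/
lemma mul_numMatchings_pred (h k : ℕ) :
    ((h : ℝ) + 1) * numMatchings h k = (h + 1 - 2 * k) * numMatchings (h + 1) k := by
  rcases lt_or_ge h (2 * k) with hk | hk
  · rw [numMatchings_eq_zero hk]
    rcases Nat.lt_or_ge (h + 1) (2 * k) with hk' | hk'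
    · simp [numMatchings_eq_zero hk']
    · have : (h : ℝ) + 1 = 2 * k := by exact_mod_cast (by omega : h + 1 = 2 * k)
      simp [this]
  · have h1 := Nat.add_one_mul_choose_eq h (2 * k)
    have h2 := Nat.choose_succ_right_eq (h + 1) (2 * k)
    have h3 : ((h : ℝ) + 1) * h.choose (2 * k) = (h + 1 - 2 * k) * (h + 1).choose (2 * k) := by
      have h4 : ((h + 1 - 2 * k : ℕ) : ℝ) = (h : ℝ) + 1 - 2 * k := by
        rw [Nat.cast_sub (by omega)]; push_cast; ring
      rw [← h4]
      have : (h + 1) * h.choose (2 * k) = (h + 1 - 2 * k) * (h + 1).choose (2 * k) := by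
        rw [h1, h2]; ring
      exact_mod_cast this
    rw [numMatchings, numMatchings]
    push_cast
    rw [← mul_assoc, h3, mul_assoc]

/-- A given point is matched in a fraction `2 (k + 1) / (h + 2)` of the matchings with `k + 1` pairs
of `h + 2` points, and all other points are equally likely to be its partner. -/
lemma mul_numMatchings_pred_pred (h k : ℕ) :
    ((h : ℝ) + 1) * ((h + 2) * numMatchings h k) = 2 * (k + 1) * numMatchings (h + 2) (k + 1) := by
  have h1 := Nat.add_one_mul_choose_eq h (2 * k)
  have h2 := Nat.add_one_mul_choose_eq (h + 1) (2 * k + 1)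
  have h3 : Nat.doubleFactorial (2 * (k + 1) - 1)
      = (2 * k + 1) * Nat.doubleFactorial (2 * k - 1) := by
    rcases k with _ | k
    · simp
    · rw [show 2 * (k + 1 + 1) - 1 = (2 * k + 1) + 2 by omega, Nat.doubleFactorial_add_two,
        show 2 * (k + 1) - 1 = 2 * k + 1 by omega]
      ring
  have : (h + 1) * ((h + 2) * numMatchings h k) = 2 * (k + 1) * numMatchings (h + 2) (k + 1) := by
    rw [numMatchings, numMatchings, h3]
    calc _ = (h + 2) * ((h + 1) * h.choose (2 * k)) * Nat.doubleFactorial (2 * k - 1) := by ring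
      _ = ((h + 1 + 1) * (h + 1).choose (2 * k + 1)) * (2 * k + 1)
          * Nat.doubleFactorial (2 * k - 1) := by rw [h1]; ring
      _ = _ := by rw [h2, show 2 * (k + 1) = 2 * k + 1 + 1 by ring]; ring
  exact_mod_cast this

lemma numMatchings_rec (h k : ℕ) : numMatchings (h + 1) (k + 1)
    = numMatchings h (k + 1) + h * numMatchings (h - 1) k := by
  rcases h with _ | h
  · have : numMatchings 1 (k + 1) = 0 := numMatchings_eq_zero (by omega)
    simp [this, numMatchings_zero_succ]
  have h1 := mul_numMatchings_pred (h + 1) (k + 1)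
  have h2 := mul_numMatchings_pred_pred h k
  push_cast at h1
  have h3 : (0 : ℝ) < (h : ℝ) + 2 := by positivity
  have : ((h : ℝ) + 2) * numMatchings (h + 2) (k + 1)
      = ((h : ℝ) + 2) * (numMatchings (h + 1) (k + 1) + (h + 1) * numMatchings h k) := by
    linear_combination -h1 - h2
  have := mul_left_cancel₀ h3.ne' this
  exact_mod_cast this

lemma card_matchings (X : Finset α) (k : ℕ) :
    (matchings X k).card = numMatchings X.card k := by
  induction hn : X.card using Nat.strong_induction_on generalizing X k with
  | _ n ih =>
  rcases k with _ | k
  · simp [matchings_zero, numMatchings_zero]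
  rcases n with _ | n
  · rw [numMatchings_zero_succ, Finset.card_eq_zero, Finset.eq_empty_iff_forall_notMem]
    intro m hm
    obtain ⟨-, h2, h3⟩ := mem_matchings.1 hm
    have := Finset.card_le_card h2
    omega
  · obtain ⟨e, he⟩ : X.Nonempty := Finset.card_pos.1 (by omega)
    have hc : (X.erase e).card = n := by rw [Finset.card_erase_of_mem he]; omega
    have h := sum_matchings_succ (k := k) he (fun _ => (1 : ℝ))
    simp only [Finset.sum_const, nsmul_eq_mul, mul_one] at h
    have h2 : ∀ f ∈ X.erase e, ((matchings ((X.erase e).erase f) k).card : ℝ)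
        = numMatchings (n - 1) k := fun f hf => by
      have hc' : ((X.erase e).erase f).card = n - 1 := by rw [Finset.card_erase_of_mem hf, hc]
      rw [ih (n - 1) (by omega) _ _ hc']
    rw [Finset.sum_congr rfl h2, ih n (by omega) _ _ hc] at h
    simp only [Finset.sum_const, nsmul_eq_mul, hc] at h
    rw [numMatchings_rec]
    exact_mod_cast h

end Matchings

/-! ### One step of the exploration -/

section Exploration

variable {V : Type*} [Fintype V] [DecidableEq V] {d : ℕ}

/-- The half-edges at the vertices of `U`. A half-edge is a pair of a vertex and one of its `d`
slots. -/
def halfEdges (d : ℕ) (U : Finset V) : Finset (V × Fin d) :=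
  Finset.univ.filter fun x => x.1 ∈ U

@[simp] lemma mem_halfEdges {U : Finset V} {x : V × Fin d} : x ∈ halfEdges d U ↔ x.1 ∈ U := by
  simp [halfEdges]

lemma card_halfEdges (U : Finset V) : (halfEdges d U).card = d * U.card := by
  have : halfEdges d U = U ×ˢ (Finset.univ : Finset (Fin d)) := by ext; simp
  rw [this, Finset.card_product]; simp [mul_comm]

/-- The active half-edges after the partner of the active half-edge `e` is revealed: `e` and its
partner are used up, and if the partner belongs to an unexplored vertex, then the other half-edges
of that vertex become active. -/
def nextActive (m : Equiv.Perm (V × Fin d)) (A : Finset (V × Fin d)) (U : Finset V)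
    (e : V × Fin d) : Finset (V × Fin d) :=
  ((A ∪ if (m e).1 ∈ U then halfEdges d {(m e).1} else ∅).erase e).erase (m e)

/-- The unexplored vertices after the partner of `e` is revealed. -/
def nextUnexplored (m : Equiv.Perm (V × Fin d)) (U : Finset V) (e : V × Fin d) : Finset V :=
  U.erase (m e).1

lemma next_disjoint {m : Equiv.Perm (V × Fin d)} {A : Finset (V × Fin d)} {U : Finset V}
    {e : V × Fin d} (h : ∀ x ∈ A, x.1 ∉ U) :
    ∀ x ∈ nextActive m A U e, x.1 ∉ nextUnexplored m U e := by
  intro x hx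
  simp only [nextActive, Finset.mem_erase, Finset.mem_union] at hx
  simp only [nextUnexplored, Finset.mem_erase, not_and]
  intro h1 h2
  rcases hx.2.2 with h3 | h3
  · exact h x h3 h2
  · split_ifs at h3
    · simp at h3; exact h1 h3
    · simp at h3

lemma next_subset (m : Equiv.Perm (V × Fin d)) (A : Finset (V × Fin d)) (U : Finset V)
    (e : V × Fin d) :
    nextActive m A U e ∪ halfEdges d (nextUnexplored m U e) ⊆ A ∪ halfEdges d U := by
  intro x hx
  simp only [nextActive, nextUnexplored, Finset.mem_union, Finset.mem_erase, mem_halfEdges] at hx ⊢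
  rcases hx with ⟨-, -, h | h⟩ | ⟨-, h⟩
  · exact Or.inl h
  · split_ifs at h with h'
    · simp at h; rw [h]; exact Or.inr h'
    · simp at h
  · exact Or.inr h

/-- The one-step estimate of the exploration. Let `F` be a quantity that depends only on the part of
the matching among the half-edges not used so far. If its averages over the uniform matchings of
the remaining half-edges are at most `g₁`, `g₂`, `g₃` when the half-edge `e` turns out to be
unmatched, matched to an active half-edge, and matched to an unexplored vertex respectively, then
the average of `F` after one step is at most the corresponding convex combination. -/
lemma sum_next_le {A : Finset (V × Fin d)} {U : Finset V} (hAU : ∀ x ∈ A, x.1 ∉ U)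
    {e : V × Fin d} (he : e ∈ A)
    (F : Equiv.Perm (V × Fin d) → Finset (V × Fin d) → Finset V → ℝ)
    (hF : ∀ m m' A U, (∀ x ∈ A ∪ halfEdges d U, m x = m' x) → F m A U = F m' A U)
    (k : ℕ) (g₁ g₂ g₃ : ℝ)
    (H₁ : ∀ A' : Finset (V × Fin d), ∀ U' : Finset V, (∀ x ∈ A', x.1 ∉ U') → U'.card = U.card →
      A'.card + 1 = A.card → ∑ m ∈ matchings (A' ∪ halfEdges d U') k, F m A' U'
        ≤ (matchings (A' ∪ halfEdges d U') k).card * g₁)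
    (H₂ : ∀ A' : Finset (V × Fin d), ∀ U' : Finset V, ∀ k', (∀ x ∈ A', x.1 ∉ U') → k' + 1 = k →
      U'.card = U.card →
      A'.card + 2 = A.card → ∑ m ∈ matchings (A' ∪ halfEdges d U') k', F m A' U'
        ≤ (matchings (A' ∪ halfEdges d U') k').card * g₂)
    (H₃ : ∀ A' : Finset (V × Fin d), ∀ U' : Finset V, ∀ k', (∀ x ∈ A', x.1 ∉ U') → k' + 1 = k →
      U'.card + 1 = U.card →
      A'.card + 2 = A.card + d → ∑ m ∈ matchings (A' ∪ halfEdges d U') k', F m A' U'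
        ≤ (matchings (A' ∪ halfEdges d U') k').card * g₃) :
    ∑ m ∈ matchings (A ∪ halfEdges d U) k, F m (nextActive m A U e) (nextUnexplored m U e)
      ≤ (matchings (A ∪ halfEdges d U) k).card *
        ((1 - 2 * k / (A ∪ halfEdges d U).card) * g₁ + 2 * k / (A ∪ halfEdges d U).card *
          ((A.card - 1) / ((A ∪ halfEdges d U).card - 1) * g₂
            + d * U.card / ((A ∪ halfEdges d U).card - 1) * g₃)) := by
  set X := A ∪ halfEdges d U with hX
  have heX : e ∈ X := Finset.mem_union_left _ he
  have heU : e.1 ∉ U := hAU e he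
  have hdisj : Disjoint A (halfEdges d U) := by
    rw [Finset.disjoint_left]; intro x hx; simpa using hAU x hx
  have hcardX : X.card = A.card + d * U.card := by
    rw [hX, Finset.card_union_of_disjoint hdisj, card_halfEdges]
  have hs : 1 ≤ A.card := Finset.card_pos.2 ⟨e, he⟩
  have hXe : A.erase e ∪ halfEdges d U = X.erase e := by
    ext x
    simp only [hX, Finset.mem_union, Finset.mem_erase, mem_halfEdges]
    constructor
    · rintro (h | h)
      · exact ⟨h.1, Or.inl h.2⟩
      · exact ⟨fun h' => heU (h' ▸ h), Or.inr h⟩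
    · tauto
  -- the contribution of the matchings in which `e` is unmatched
  have hfix : ∀ k', k' = k → ∑ m ∈ matchings (X.erase e) k',
      F m (nextActive m A U e) (nextUnexplored m U e) ≤ (matchings (X.erase e) k').card * g₁ := by
    rintro k' rfl
    have h := H₁ (A.erase e) U (fun x hx => hAU x (Finset.mem_of_mem_erase hx)) rfl
      (by rw [Finset.card_erase_of_mem he]; omega)
    rw [hXe] at h
    refine le_trans (le_of_eq (Finset.sum_congr rfl fun m hm => ?_)) h
    rw [← filter_fixed, Finset.mem_filter] at hm
    simp [nextActive, nextUnexplored, hm.2, heU]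
  obtain ⟨n, hn⟩ : ∃ n, X.card = n + 1 := ⟨X.card - 1, by omega⟩
  have hnR : (X.card : ℝ) = n + 1 := by rw [hn]; push_cast; ring
  have hcard1 : ((matchings (X.erase e) k).card : ℝ)
      = (1 - 2 * k / X.card) * (matchings X k).card := by
    rw [card_matchings, card_matchings, Finset.card_erase_of_mem heX, hnR, hn, Nat.add_sub_cancel]
    have := mul_numMatchings_pred n k
    have h0 : (n : ℝ) + 1 ≠ 0 := by positivity
    field_simp
    linear_combination this
  rcases k with _ | k
  · have h := hfix 0 rfl
    rw [hcard1] at h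
    simpa [matchings_zero] using h
  rw [sum_matchings_succ heX]
  have hpair : ∀ f ∈ X.erase e, ∑ m ∈ matchings ((X.erase e).erase f) k,
      F (Equiv.swap e f * m) (nextActive (Equiv.swap e f * m) A U e)
        (nextUnexplored (Equiv.swap e f * m) U e)
      ≤ numMatchings (n - 1) k * if f ∈ A then g₂ else g₃ := by
    intro f hf
    have hfe : f ≠ e := (Finset.mem_erase.1 hf).1
    have hfX : f ∈ X := (Finset.mem_erase.1 hf).2
    have hc : ((X.erase e).erase f).card = n - 1 := by
      rw [Finset.card_erase_of_mem hf, Finset.card_erase_of_mem heX]; omega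
    have key : ∀ m ∈ matchings ((X.erase e).erase f) k, ∀ A' U',
        A' ∪ halfEdges d U' = (X.erase e).erase f →
        F (Equiv.swap e f * m) A' U' = F m A' U' := by
      intro m hm A' U' hX'
      refine hF _ _ _ _ fun x hx => ?_
      rw [hX'] at hx
      obtain ⟨h1, h2, -⟩ := mem_matchings.1 hm
      have hmx : m x ∈ (X.erase e).erase f := by
        by_cases h : m x = x
        · rwa [h]
        · exact h2 (Equiv.Perm.mem_support.2 fun h' => h (m.injective h'))
      simp only [Finset.mem_erase] at hmx
      exact Equiv.swap_apply_of_ne_of_ne hmx.2.1 hmx.1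
    have hme : ∀ m ∈ matchings ((X.erase e).erase f) k, (Equiv.swap e f * m) e = f := fun m hm =>
      (swap_mul_mem_matchings' hfe.symm heX hfX hm).2
    by_cases hfA : f ∈ A
    · have hfU : f.1 ∉ U := hAU f hfA
      have hX' : (A.erase e).erase f ∪ halfEdges d U = (X.erase e).erase f := by
        rw [← hXe]
        ext x
        simp only [Finset.mem_union, Finset.mem_erase, mem_halfEdges]
        constructor
        · rintro (h | h)
          · exact ⟨h.1, Or.inl h.2⟩
          · exact ⟨fun h' => hfU (h' ▸ h), Or.inr h⟩
        · tauto
      have h := H₂ ((A.erase e).erase f) U k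
        (fun x hx => hAU x (Finset.mem_of_mem_erase (Finset.mem_of_mem_erase hx))) rfl rfl
        (by
          have h2 : 1 ≤ (A.erase e).card := Finset.card_pos.2 ⟨f, Finset.mem_erase.2 ⟨hfe, hfA⟩⟩
          rw [Finset.card_erase_of_mem (Finset.mem_erase.2 ⟨hfe, hfA⟩)]
          rw [Finset.card_erase_of_mem he] at h2 ⊢; omega)
      rw [hX', card_matchings, hc] at h
      rw [if_pos hfA]
      refine le_trans (le_of_eq (Finset.sum_congr rfl fun m hm => ?_)) h
      have h3 : nextActive (Equiv.swap e f * m) A U e = (A.erase e).erase f := by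
        rw [nextActive, hme m hm]; simp [hfU]
      have h4 : nextUnexplored (Equiv.swap e f * m) U e = U := by
        rw [nextUnexplored, hme m hm]; exact Finset.erase_eq_of_notMem hfU
      rw [h3, h4]
      exact key m hm _ _ hX'
    · have hfU : f.1 ∈ U := by
        rw [hX, Finset.mem_union, mem_halfEdges] at hfX
        tauto
      set A' := ((A ∪ halfEdges d {f.1}).erase e).erase f with hA'
      have hX' : A' ∪ halfEdges d (U.erase f.1) = (X.erase e).erase f := by
        ext x
        simp only [hA', hX, Finset.mem_union, Finset.mem_erase, mem_halfEdges,
          Finset.mem_singleton]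
        constructor
        · rintro (⟨h1, h2, h3 | h3⟩ | ⟨h1, h2⟩)
          · exact ⟨h1, h2, Or.inl h3⟩
          · exact ⟨h1, h2, Or.inr (h3 ▸ hfU)⟩
          · exact ⟨fun h' => h1 (h' ▸ rfl), fun h' => heU (h' ▸ h2), Or.inr h2⟩
        · rintro ⟨h1, h2, h3 | h3⟩
          · exact Or.inl ⟨h1, h2, Or.inl h3⟩
          · by_cases h4 : x.1 = f.1
            · exact Or.inl ⟨h1, h2, Or.inr h4⟩
            · exact Or.inr ⟨h4, h3⟩
      have hdis : ∀ x ∈ A', x.1 ∉ U.erase f.1 := by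
        intro x hx
        simp only [hA', Finset.mem_union, Finset.mem_erase, mem_halfEdges,
          Finset.mem_singleton] at hx
        simp only [Finset.mem_erase, not_and]
        intro h1
        rcases hx.2.2 with h | h
        · exact hAU x h
        · exact absurd h h1
      have hcA : A'.card + 2 = A.card + d := by
        have h1 : (A ∪ halfEdges d {f.1}).card = A.card + d := by
          rw [Finset.card_union_of_disjoint, card_halfEdges]
          · simp
          · rw [Finset.disjoint_left]
            intro x hx hx'
            simp only [mem_halfEdges, Finset.mem_singleton] at hx'
            exact hAU x hx (hx' ▸ hfU)
        have h2 : f ∈ (A ∪ halfEdges d {f.1}).erase e :=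
          Finset.mem_erase.2 ⟨hfe, Finset.mem_union_right _ (by simp)⟩
        have h3 : e ∈ A ∪ halfEdges d {f.1} := Finset.mem_union_left _ he
        have h4 := Finset.card_pos.2 ⟨f, h2⟩
        rw [hA', Finset.card_erase_of_mem h2]
        rw [Finset.card_erase_of_mem h3, h1] at h4 ⊢
        omega
      have h := H₃ A' (U.erase f.1) k hdis rfl
        (by
          have := Finset.card_pos.2 ⟨_, hfU⟩
          rw [Finset.card_erase_of_mem hfU]; omega) hcA
      rw [hX', card_matchings, hc] at h
      rw [if_neg hfA]
      refine le_trans (le_of_eq (Finset.sum_congr rfl fun m hm => ?_)) h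
      have h3 : nextActive (Equiv.swap e f * m) A U e = A' := by
        rw [nextActive, hme m hm, if_pos hfU]
      have h4 : nextUnexplored (Equiv.swap e f * m) U e = U.erase f.1 := by
        rw [nextUnexplored, hme m hm]
      rw [h3, h4]
      exact key m hm _ _ hX'
  have hsplit : X.erase e = A.erase e ∪ halfEdges d U := hXe.symm
  have hsum : ∑ f ∈ X.erase e, (numMatchings (n - 1) k * if f ∈ A then g₂ else g₃ : ℝ)
      = numMatchings (n - 1) k * ((A.card - 1) * g₂ + d * U.card * g₃) := by
    rw [hsplit, Finset.sum_union (Finset.disjoint_of_subset_left (Finset.erase_subset _ _) hdisj)]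
    rw [Finset.sum_congr rfl (g := fun _ => (numMatchings (n - 1) k * g₂ : ℝ))
      (fun f hf => by rw [if_pos (Finset.mem_of_mem_erase hf)])]
    rw [Finset.sum_congr (s₁ := halfEdges d U) rfl
      (g := fun _ => (numMatchings (n - 1) k * g₃ : ℝ))
      (fun f hf => by
        rw [if_neg]; exact fun h => hAU f h (by simpa using hf))]
    rw [Finset.sum_const, Finset.sum_const, card_halfEdges, Finset.card_erase_of_mem he]
    simp only [nsmul_eq_mul]
    rw [Nat.cast_sub hs]
    push_cast
    ring
  refine le_trans (add_le_add (hfix (k + 1) rfl) (Finset.sum_le_sum hpair)) ?_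
  rw [hsum, hcard1]
  have hfin : (numMatchings (n - 1) k : ℝ) * ((A.card - 1) * g₂ + d * U.card * g₃)
      = (matchings X (k + 1)).card * (2 * ((k + 1 : ℕ) : ℝ) / X.card *
          ((A.card - 1) / (X.card - 1) * g₂ + d * U.card / (X.card - 1) * g₃)) := by
    rcases n with _ | n
    · have h1 : A.card = 1 := by omega
      have h2 : (d : ℝ) * U.card = 0 := by
        have : d * U.card = 0 := by omega
        exact_mod_cast this
      simp [h1, h2]
    · have h1 := mul_numMatchings_pred_pred n k
      have h2 : (n : ℝ) + 1 ≠ 0 := by positivity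
      have h3 : (n : ℝ) + 2 ≠ 0 := by positivity
      rw [card_matchings, hnR, hn, Nat.add_sub_cancel]
      push_cast
      rw [show (n : ℝ) + 1 + 1 - 1 = n + 1 by ring, show (n : ℝ) + 1 + 1 = n + 2 by ring,
        show n + 1 + 1 = n + 2 by ring]
      field_simp
      linear_combination ((A.card - 1) * g₂ + d * U.card * g₃) * h1
  rw [hfin]
  apply le_of_eq
  ring

end Exploration

/-! ### Components and the survival of the exploration -/

section Processes

variable {V : Type*} {d : ℕ}

/-- The graph on the vertices spanned by the pairs of a matching of the half-edges. -/
def matchingGraph (m : Equiv.Perm (V × Fin d)) : SimpleGraph V :=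
  SimpleGraph.fromRel fun v w => ∃ x, x.1 = v ∧ (m x).1 = w

lemma matchingGraph_adj {m : Equiv.Perm (V × Fin d)} (hm : ∀ x, m (m x) = x) {v w : V} :
    (matchingGraph m).Adj v w ↔ v ≠ w ∧ ∃ x, x.1 = v ∧ (m x).1 = w := by
  simp only [matchingGraph, SimpleGraph.fromRel_adj, and_congr_right_iff, or_iff_left_iff_imp]
  rintro - ⟨x, h1, h2⟩
  exact ⟨m x, h2, by rw [hm, h1]⟩

lemma component_eq_of_pair {m : Equiv.Perm (V × Fin d)} (hm : ∀ x, m (m x) = x) (x : V × Fin d) :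
    (matchingGraph m).connectedComponentMk (m x).1
      = (matchingGraph m).connectedComponentMk x.1 := by
  by_cases h : (m x).1 = x.1
  · rw [h]
  · exact (SimpleGraph.ConnectedComponent.connectedComponentMk_eq_of_adj
      ((matchingGraph_adj hm).2 ⟨Ne.symm h, x, rfl, rfl⟩)).symm

variable [Fintype V] [DecidableEq V]

/-- The exploration with active half-edges `A` and unexplored vertices `U` does not run out of
active half-edges in its first `T` steps. Each step reveals the partner of one active half-edge,
which is picked by a fixed choice function. -/
def Survives (m : Equiv.Perm (V × Fin d)) : ℕ → Finset (V × Fin d) → Finset V → Prop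
  | 0, _, _ => True
  | T + 1, A, U => ∃ h : A.Nonempty,
      Survives m T (nextActive m A U h.choose) (nextUnexplored m U h.choose)

/-- The exploration that starts afresh at an unexplored vertex whenever it runs out of active
half-edges does not succeed within `T` steps: either it never has `h₀` active half-edges, or the
active half-edges run out within `T₂` steps after the first time it has that many. -/
def Fails (m : Equiv.Perm (V × Fin d)) (T₂ h₀ : ℕ) : ℕ → Finset (V × Fin d) → Finset V → Prop
  | 0, A, U => h₀ ≤ A.card → ¬ Survives m T₂ A U
  | T + 1, A, U => (h₀ ≤ A.card → ¬ Survives m T₂ A U) ∧ (A.card < h₀ →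
      (∀ h : A.Nonempty, Fails m T₂ h₀ T (nextActive m A U h.choose)
        (nextUnexplored m U h.choose)) ∧
      (¬ A.Nonempty → ∀ h : U.Nonempty, Fails m T₂ h₀ T (halfEdges d {h.choose})
        (U.erase h.choose)))

lemma next_congr {m m' : Equiv.Perm (V × Fin d)} {A : Finset (V × Fin d)} {U : Finset V}
    {e : V × Fin d} (he : e ∈ A) (h : ∀ x ∈ A ∪ halfEdges d U, m x = m' x) :
    nextActive m A U e = nextActive m' A U e ∧ nextUnexplored m U e = nextUnexplored m' U e := by
  have := h e (Finset.mem_union_left _ he)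
  simp [nextActive, nextUnexplored, this]

lemma survives_congr {T : ℕ} : ∀ (m m' : Equiv.Perm (V × Fin d)) (A : Finset (V × Fin d))
    (U : Finset V), (∀ x ∈ A ∪ halfEdges d U, m x = m' x) →
    (Survives m T A U ↔ Survives m' T A U) := by
  induction T with
  | zero => intro m m' A U _; simp [Survives]
  | succ T ih =>
    intro m m' A U h
    simp only [Survives]
    refine exists_congr fun hA => ?_
    obtain ⟨h1, h2⟩ := next_congr hA.choose_spec h
    rw [← h1, ← h2]
    exact ih _ _ _ _ fun x hx => h x (next_subset _ _ _ _ hx)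

lemma fails_congr {T₂ h₀ T : ℕ} : ∀ (m m' : Equiv.Perm (V × Fin d)) (A : Finset (V × Fin d))
    (U : Finset V), (∀ x ∈ A ∪ halfEdges d U, m x = m' x) →
    (Fails m T₂ h₀ T A U ↔ Fails m' T₂ h₀ T A U) := by
  induction T with
  | zero => intro m m' A U h; simp only [Fails]; rw [survives_congr m m' A U h]
  | succ T ih =>
    intro m m' A U h
    simp only [Fails]
    rw [survives_congr m m' A U h]
    refine and_congr Iff.rfl (imp_congr Iff.rfl (and_congr (forall_congr' fun hA => ?_)
      (imp_congr Iff.rfl (forall_congr' fun hU => ?_))))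
    · obtain ⟨h1, h2⟩ := next_congr hA.choose_spec h
      rw [← h1, ← h2]
      exact ih _ _ _ _ fun x hx => h x (next_subset _ _ _ _ hx)
    · refine ih _ _ _ _ fun x hx => h x ?_
      simp only [Finset.mem_union, mem_halfEdges, Finset.mem_singleton, Finset.mem_erase] at hx ⊢
      rcases hx with hx | hx
      · exact Or.inr (hx ▸ hU.choose_spec)
      · exact Or.inr hx.2

/-- If the exploration stops within `T` steps, then at most `T` further vertices are explored
before the explored set is closed under the matching. -/
lemma exists_closed_of_not_survives {m : Equiv.Perm (V × Fin d)} (hm : ∀ x, m (m x) = x) {T : ℕ} :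
    ∀ (A : Finset (V × Fin d)) (U : Finset V), (∀ x ∈ A, x.1 ∉ U) →
      (∀ x : V × Fin d, x.1 ∉ U → x ∉ A → (m x).1 ∉ U) → ¬ Survives m T A U →
      ∃ D : Finset V, Uᶜ ⊆ D ∧ (∀ x : V × Fin d, x.1 ∈ D → (m x).1 ∈ D) ∧
        D.card ≤ Uᶜ.card + T := by
  induction T with
  | zero => intro A U _ _ h; simp [Survives] at h
  | succ T ih =>
    intro A U hAU hcl hs
    by_cases hA : A.Nonempty
    · have he := hA.choose_spec
      set e := hA.choose with he'
      have hs' : ¬ Survives m T (nextActive m A U e) (nextUnexplored m U e) :=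
        fun h => hs ⟨hA, h⟩
      obtain ⟨D, h1, h2, h3⟩ := ih _ _ (next_disjoint hAU) (by
        intro x hx hxA
        simp only [nextActive, nextUnexplored, Finset.mem_erase, Finset.mem_union] at hx hxA ⊢
        rcases eq_or_ne x (m e) with rfl | hxe
        · rw [hm]; exact fun h => hAU e he h.2
        rcases eq_or_ne x e with rfl | hxe'
        · tauto
        have hxA' : x ∉ A := by tauto
        by_cases hxU : x.1 ∈ U
        · have h4 : x.1 = (m e).1 := by tauto
          rw [← h4, if_pos hxU] at hxA
          simp at hxA
          tauto
        · exact fun h => hcl x hxU hxA' h.2) hs'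
      refine ⟨D, ?_, h2, ?_⟩
      · refine subset_trans ?_ h1
        intro x hx
        simp only [nextUnexplored, Finset.mem_compl, Finset.mem_erase] at hx ⊢
        tauto
      · have : (nextUnexplored m U e)ᶜ.card ≤ Uᶜ.card + 1 := by
          rw [nextUnexplored, Finset.compl_erase]
          exact Finset.card_insert_le _ _
        omega
    · rw [Finset.not_nonempty_iff_eq_empty] at hA
      subst hA
      exact ⟨Uᶜ, subset_rfl, fun x hx => by simpa using hcl x (by simpa using hx) (by simp),
        by omega⟩

/-- A vertex whose component has more than `T + 1` vertices survives `T` steps of exploration. -/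
lemma survives_of_lt_component {m : Equiv.Perm (V × Fin d)} (hm : ∀ x, m (m x) = x) {T : ℕ} {v : V}
    (h : T + 1 < ((matchingGraph m).connectedComponentMk v).supp.ncard) :
    Survives m T (halfEdges d {v}) {v}ᶜ := by
  by_contra hs
  obtain ⟨D, h1, h2, h3⟩ := exists_closed_of_not_survives hm _ _ (by simp)
    (fun x hx hx' => by simp at hx hx'; exact absurd hx hx') hs
  simp only [compl_compl, Finset.card_singleton, Finset.singleton_subset_iff] at h1 h3
  have hsub : ((matchingGraph m).connectedComponentMk v).supp ⊆ (D : Set V) := by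
    intro w hw
    rw [SimpleGraph.ConnectedComponent.mem_supp_iff, SimpleGraph.ConnectedComponent.eq] at hw
    obtain ⟨p⟩ := hw.symm
    clear h hs h3 hw
    induction p with
    | nil => exact h1
    | cons hadj p ih =>
      apply ih
      obtain ⟨-, x, hx, hx'⟩ := (matchingGraph_adj hm).1 hadj
      rw [← hx']
      exact h2 x (hx ▸ h1)
  have := Set.ncard_le_ncard hsub (Finset.finite_toSet D)
  rw [Set.ncard_coe_finset] at this
  omega

/-- Every step of the exploration of a component uses up a half-edge of that component. -/
lemma le_of_survives {m : Equiv.Perm (V × Fin d)} (hm : ∀ x, m (m x) = x)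
    (c : (matchingGraph m).ConnectedComponent) {T : ℕ} :
    ∀ (A B : Finset (V × Fin d)) (U : Finset V), (∀ x ∈ A, x.1 ∉ U) →
      (∀ x ∈ A, (matchingGraph m).connectedComponentMk x.1 = c) →
      (∀ x ∈ B, x.1 ∉ U ∧ x ∉ A ∧ (matchingGraph m).connectedComponentMk x.1 = c) →
      Survives m T A U → B.card + T ≤ d * c.supp.ncard := by
  classical
  induction T with
  | zero =>
    intro A B U _ _ hB _
    have hsub : B ⊆ halfEdges d (c.supp.toFinite.toFinset) := by
      intro x hx
      simpa using (hB x hx).2.2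
    have := Finset.card_le_card hsub
    rwa [card_halfEdges, ← Set.ncard_eq_toFinset_card] at this
  | succ T ih =>
    rintro A B U hAU hA hB ⟨hne, hs⟩
    have he := hne.choose_spec
    set e := hne.choose with he'
    have hmem : ∀ x ∈ nextActive m A U e, x ≠ e ∧ (x ∈ A ∨ (x.1 ∈ U ∧ x.1 = (m e).1)) := by
      intro x hx
      simp only [nextActive, Finset.mem_erase, Finset.mem_union] at hx
      refine ⟨hx.2.1, ?_⟩
      rcases hx.2.2 with h | h
      · exact Or.inl h
      · split_ifs at h with h'
        · simp at h; rw [h]; exact Or.inr ⟨h', rfl⟩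
        · simp at h
    have := ih (nextActive m A U e) (insert e B) _ (next_disjoint hAU) (by
        intro x hx
        rcases (hmem x hx).2 with h | ⟨-, h⟩
        · exact hA x h
        · rw [h, component_eq_of_pair hm, hA e he]) (by
        intro x hx
        simp only [nextUnexplored, Finset.mem_erase, not_and]
        rcases Finset.mem_insert.1 hx with rfl | hx
        · exact ⟨fun _ => hAU _ he, fun h => (hmem _ h).1 rfl, hA _ he⟩
        · obtain ⟨h1, h2, h3⟩ := hB x hx
          refine ⟨fun _ => h1, fun h => ?_, h3⟩
          rcases (hmem x h).2 with h | h
          · exact h2 h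
          · exact h1 h.1) hs
    rw [Finset.card_insert_of_notMem (fun h => (hB e h).2.1 he)] at this
    omega

/-- If all components are small, then the exploration with restarts fails. -/
lemma fails_of_small {m : Equiv.Perm (V × Fin d)} (hm : ∀ x, m (m x) = x) {T₂ h₀ : ℕ}
    (hsmall : ∀ c : (matchingGraph m).ConnectedComponent, d * c.supp.ncard < T₂) {T : ℕ} :
    ∀ (A : Finset (V × Fin d)) (U : Finset V) (c : (matchingGraph m).ConnectedComponent),
      (∀ x ∈ A, x.1 ∉ U) →
      (∀ x ∈ A, (matchingGraph m).connectedComponentMk x.1 = c) → Fails m T₂ h₀ T A U := by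
  have key : ∀ (A : Finset (V × Fin d)) (U : Finset V) (c : (matchingGraph m).ConnectedComponent),
      (∀ x ∈ A, x.1 ∉ U) →
      (∀ x ∈ A, (matchingGraph m).connectedComponentMk x.1 = c) → ¬ Survives m T₂ A U := by
    intro A U c h1 h2 hs
    have := le_of_survives hm c A ∅ U h1 h2 (by simp) hs
    have := hsmall c
    simp at *
    omega
  induction T with
  | zero => intro A U c h1 h2 _; exact key A U c h1 h2
  | succ T ih =>
    intro A U c h1 h2
    refine ⟨fun _ => key A U c h1 h2, fun _ => ⟨fun hA => ?_, fun _ hU => ?_⟩⟩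
    · refine ih _ _ c (next_disjoint h1) fun x hx => ?_
      simp only [nextActive, Finset.mem_erase, Finset.mem_union] at hx
      rcases hx.2.2 with h | h
      · exact h2 x h
      · split_ifs at h
        · simp only [mem_halfEdges, Finset.mem_singleton] at h
          rw [h, component_eq_of_pair hm, h2 _ hA.choose_spec]
        · simp at h
    · refine ih _ _ ((matchingGraph m).connectedComponentMk hU.choose) (fun x hx => ?_)
        fun x hx => ?_
      · simp at hx; simp [hx]
      · simp at hx; rw [hx]

end Processes

/-! ### Potential functions for the exploration -/

section Averages

variable {V : Type*} [Fintype V] [DecidableEq V] {d : ℕ}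

/-- The one-step estimate, with the transition probabilities of the exploration: an active half-edge
is matched with probability `p = 2k / h`, and its partner is then active with probability
`q = (s - 1) / (h - 1)`. -/
lemma sum_next_le' {A : Finset (V × Fin d)} {U : Finset V} (hAU : ∀ x ∈ A, x.1 ∉ U)
    {e : V × Fin d} (he : e ∈ A)
    (F : Equiv.Perm (V × Fin d) → Finset (V × Fin d) → Finset V → ℝ)
    (hF : ∀ m m' A U, (∀ x ∈ A ∪ halfEdges d U, m x = m' x) → F m A U = F m' A U)
    (k : ℕ) (g₁ g₂ g₃ W : ℝ)
    (H₁ : ∀ A' : Finset (V × Fin d), ∀ U' : Finset V, (∀ x ∈ A', x.1 ∉ U') → U'.card = U.card →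
      A'.card + 1 = A.card → ∑ m ∈ matchings (A' ∪ halfEdges d U') k, F m A' U'
        ≤ (matchings (A' ∪ halfEdges d U') k).card * g₁)
    (H₂ : ∀ A' : Finset (V × Fin d), ∀ U' : Finset V, ∀ k', (∀ x ∈ A', x.1 ∉ U') → k' + 1 = k →
      U'.card = U.card →
      A'.card + 2 = A.card → ∑ m ∈ matchings (A' ∪ halfEdges d U') k', F m A' U'
        ≤ (matchings (A' ∪ halfEdges d U') k').card * g₂)
    (H₃ : ∀ A' : Finset (V × Fin d), ∀ U' : Finset V, ∀ k', (∀ x ∈ A', x.1 ∉ U') → k' + 1 = k →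
      U'.card + 1 = U.card →
      A'.card + 2 = A.card + d → ∑ m ∈ matchings (A' ∪ halfEdges d U') k', F m A' U'
        ≤ (matchings (A' ∪ halfEdges d U') k').card * g₃)
    (hW : 2 * k ≤ A.card + d * U.card → ∀ p q : ℝ, p = 2 * k / ((A.card + d * U.card : ℕ) : ℝ) →
      q * (((A.card + d * U.card : ℕ) : ℝ) - 1) = A.card - 1 →
      0 ≤ p → p ≤ 1 → 0 ≤ q → q ≤ 1 → (1 - p) * g₁ + p * (q * g₂ + (1 - q) * g₃) ≤ W) :
    ∑ m ∈ matchings (A ∪ halfEdges d U) k, F m (nextActive m A U e) (nextUnexplored m U e)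
      ≤ (matchings (A ∪ halfEdges d U) k).card * W := by
  have hdisj : Disjoint A (halfEdges d U) := by
    rw [Finset.disjoint_left]; intro x hx; simpa using hAU x hx
  have hcardX : (A ∪ halfEdges d U).card = A.card + d * U.card := by
    rw [Finset.card_union_of_disjoint hdisj, card_halfEdges]
  have hs : 1 ≤ A.card := Finset.card_pos.2 ⟨e, he⟩
  rcases lt_or_ge (A.card + d * U.card) (2 * k) with hlt | hle
  · have : matchings (A ∪ halfEdges d U) k = ∅ := by
      rw [← Finset.card_eq_zero, card_matchings, hcardX, numMatchings_eq_zero hlt]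
    simp [this]
  refine le_trans (sum_next_le hAU he F hF k g₁ g₂ g₃ H₁ H₂ H₃) ?_
  refine mul_le_mul_of_nonneg_left ?_ (Nat.cast_nonneg _)
  rw [hcardX]
  have hsR : (1 : ℝ) ≤ A.card := by exact_mod_cast hs
  have hu : (0 : ℝ) ≤ d * U.card := by positivity
  have hhR : ((A.card + d * U.card : ℕ) : ℝ) = A.card + d * U.card := by push_cast; ring
  have hp1 : 2 * (k : ℝ) / ((A.card + d * U.card : ℕ) : ℝ) ≤ 1 := by
    rw [div_le_one (by rw [hhR]; linarith)]
    exact_mod_cast hle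
  rcases eq_or_lt_of_le (show 1 ≤ A.card + d * U.card by omega) with h1 | h1
  · have hk : k = 0 := by omega
    have hA1 : A.card = 1 := by omega
    have h2 := hW hle 0 0 (by simp [hk]) (by simp [hA1]) le_rfl zero_le_one le_rfl zero_le_one
    simpa [hk] using h2
  · have h1R : (1 : ℝ) < ((A.card + d * U.card : ℕ) : ℝ) := by exact_mod_cast h1
    have h0 : ((A.card + d * U.card : ℕ) : ℝ) - 1 ≠ 0 := by linarith
    have h2 := hW hle (2 * k / ((A.card + d * U.card : ℕ) : ℝ))
      ((A.card - 1) / (((A.card + d * U.card : ℕ) : ℝ) - 1)) rfl (by field_simp) (by positivity)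
      hp1 (div_nonneg (by linarith) (by linarith))
      ((div_le_one (by linarith)).2 (by rw [hhR]; linarith))
    refine le_trans (le_of_eq ?_) h2
    have h3 : (1 : ℝ) - (A.card - 1) / (((A.card + d * U.card : ℕ) : ℝ) - 1)
        = d * U.card / (((A.card + d * U.card : ℕ) : ℝ) - 1) := by
      field_simp
      rw [hhR]; ring
    rw [h3]

open scoped Classical in
/-- Upper bound for the probability of survival by a supermartingale `W`. The bound `β` on the
conditional drift is required only for the states with at least one active half-edge; in these,
many vertices are already explored. -/
lemma survives_le {M K T : ℕ} (hd : 2 ≤ d) (W : ℕ → ℕ → ℝ) (β : ℕ → ℝ) (hWT : ∀ s, 1 ≤ W T s)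
    (hW0 : ∀ t s, 0 ≤ W t s) (hmono : ∀ t, Monotone (W t))
    (hstep : ∀ t < T, ∀ s, ∀ p : ℝ, 0 ≤ p → p ≤ 1 → p * (d - 1) ≤ 1 + β t →
      (1 - p) * W (t + 1) s + p * W (t + 1) (s + d - 1) ≤ W t (s + 1))
    (hp : ∀ t < T, ∀ h k s : ℕ, 1 ≤ s → k ≤ K → h + t + K = M + k →
      s + t + (d - 1) * k ≤ d + (d - 1) * K → 2 * (k : ℝ) * (d - 1) ≤ (1 + β t) * h) :
    ∀ r t, t + r = T → ∀ (A : Finset (V × Fin d)) (U : Finset V) (k : ℕ), (∀ x ∈ A, x.1 ∉ U) →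
      k ≤ K → A.card + d * U.card + t + K = M + k →
      A.card + t + (d - 1) * k ≤ d + (d - 1) * K →
      ∑ m ∈ matchings (A ∪ halfEdges d U) k, (if Survives m r A U then (1 : ℝ) else 0)
        ≤ (matchings (A ∪ halfEdges d U) k).card * W t A.card := by
  intro r
  induction r with
  | zero =>
    intro t ht A U k _ _ _ _
    have h0 : ∀ m : Equiv.Perm (V × Fin d), Survives m 0 A U := fun _ => trivial
    simp only [if_pos (h0 _), Finset.sum_const, nsmul_eq_mul, mul_one]
    have : t = T := by omega
    subst this
    exact le_mul_of_one_le_right (Nat.cast_nonneg _) (hWT _)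
  | succ r ih =>
    intro t ht A U k hAU hkK hM hA
    by_cases hne : A.Nonempty
    · have he := hne.choose_spec
      have hs : 1 ≤ A.card := Finset.card_pos.2 hne
      have hiff : ∀ m : Equiv.Perm (V × Fin d), Survives m (r + 1) A U ↔
          Survives m r (nextActive m A U hne.choose) (nextUnexplored m U hne.choose) := fun m =>
        ⟨fun h => h.2, fun h => ⟨hne, h⟩⟩
      simp only [hiff]
      obtain ⟨s, hs'⟩ : ∃ s, A.card = s + 1 := ⟨A.card - 1, by omega⟩
      have hkk : ∀ k', k' + 1 = k → (d - 1) * k = (d - 1) * k' + (d - 1) := by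
        rintro k' rfl; ring
      refine sum_next_le' hAU he (fun m A U => if Survives m r A U then (1 : ℝ) else 0)
        (fun m m' A U h => by simp only [survives_congr m m' A U h]) k
        (W (t + 1) s) (W (t + 1) (s - 1)) (W (t + 1) (s + d - 1)) _ ?_ ?_ ?_ ?_
      · intro A' U' h1 h2 h3
        have := ih (t + 1) (by omega) A' U' k h1 hkK (by rw [h2]; omega) (by omega)
        rwa [show A'.card = s by omega] at this
      · intro A' U' k' h1 h2 h3 h4
        have := hkk k' h2
        have := ih (t + 1) (by omega) A' U' k' h1 (by omega) (by rw [h3]; omega) (by omega)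
        rwa [show A'.card = s - 1 by omega] at this
      · intro A' U' k' h1 h2 h3 h4
        have h5 := hkk k' h2
        have h6 : d * U.card = d * U'.card + d := by rw [← h3]; ring
        have := ih (t + 1) (by omega) A' U' k' h1 (by omega) (by omega) (by omega)
        rwa [show A'.card = s + d - 1 by omega] at this
      · intro h2k p q hp' hq hp0 hp1 hq0 hq1
        have hW1 : W (t + 1) (s - 1) ≤ W (t + 1) (s + d - 1) := hmono _ (by omega)
        have hβ := hp t (by omega) (A.card + d * U.card) k A.card hs hkK hM hA
        have hh : (0 : ℝ) < ((A.card + d * U.card : ℕ) : ℝ) := by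
          exact_mod_cast (by omega : 0 < A.card + d * U.card)
        have h3 := hstep t (by omega) s p hp0 hp1 (by
          rw [hp', div_mul_eq_mul_div, div_le_iff₀ hh]; exact hβ)
        rw [hs']
        refine le_trans ?_ h3
        nlinarith [mul_nonneg hp0 (mul_nonneg hq0 (sub_nonneg.2 hW1))]
    · have : ∀ m : Equiv.Perm (V × Fin d), ¬ Survives m (r + 1) A U := fun m h => hne h.1
      simp only [this, if_false, Finset.sum_const_zero]
      exact mul_nonneg (Nat.cast_nonneg _) (hW0 _ _)

/-- The drift of the number of active half-edges is at least `-γ` as long as at most `J` steps have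
been made. Here `M` is the initial number of half-edges and `K` the initial number of pairs; after
`j` steps there are `h` half-edges, `s` of them active, and `k` pairs left. -/
def DriftBound (d M K J : ℕ) (γ : ℝ) : Prop :=
  ∀ j h k s : ℕ, j < J → h ≤ M → M ≤ h + 2 * j → K ≤ k + j → 1 ≤ s → s ≤ h → s ≤ d * (j + 1) →
    2 * k ≤ h → ∀ p q : ℝ, p = 2 * k / h → q * (h - 1) = s - 1 → 0 ≤ p → p ≤ 1 → 0 ≤ q → q ≤ 1 →
      -γ ≤ p * (d - 1) - 1 - p * q * d

open scoped Classical in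
/-- The probability that the active half-edges run out within `r` steps. The quadratic function
`max (L - s) 0 ^ 2` of the number `s` of active half-edges is controlled by the drift and the second
moment of the steps. -/
lemma not_survives_le {M K J : ℕ} (hd : 3 ≤ d) {γ L : ℝ} (hγ : 0 ≤ γ) (hL : 0 < L)
    (hdr : DriftBound d M K J γ) :
    ∀ r j, j + r ≤ J → ∀ (A : Finset (V × Fin d)) (U : Finset V) (k : ℕ), (∀ x ∈ A, x.1 ∉ U) →
      A.card + d * U.card ≤ M → M ≤ A.card + d * U.card + 2 * j → K ≤ k + j →
      A.card ≤ d * (j + 1) →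
      ∑ m ∈ matchings (A ∪ halfEdges d U) k, (if ¬ Survives m r A U then (1 : ℝ) else 0)
        ≤ (matchings (A ∪ halfEdges d U) k).card *
          (((max (L - A.card) 0) ^ 2 + (2 * L * γ + d ^ 2) * r) / L ^ 2) := by
  intro r
  induction r with
  | zero =>
    intro j hj A U k _ _ _ _ _
    simp only [Survives, not_true_eq_false, if_false, Finset.sum_const_zero]
    positivity
  | succ r ih =>
    intro j hj A U k hAU hM1 hM2 hK hA
    by_cases hne : A.Nonempty
    · have he := hne.choose_spec
      have hs : 1 ≤ A.card := Finset.card_pos.2 hne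
      have hiff : ∀ m : Equiv.Perm (V × Fin d), Survives m (r + 1) A U ↔
          Survives m r (nextActive m A U hne.choose) (nextUnexplored m U hne.choose) := fun m =>
        ⟨fun h => h.2, fun h => ⟨hne, h⟩⟩
      simp only [hiff]
      set g : ℝ → ℝ := fun x => ((max (L - x) 0) ^ 2 + (2 * L * γ + d ^ 2) * r) / L ^ 2 with hg
      have hgdef : ∀ a : ℝ, ((max (L - a) 0) ^ 2 + (2 * L * γ + d ^ 2) * r) / L ^ 2 = g a :=
        fun a => rfl
      have hdj : d * (j + 1 + 1) = d * (j + 1) + d := by ring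
      refine sum_next_le' hAU he (fun m A U => if ¬ Survives m r A U then (1 : ℝ) else 0)
        (fun m m' A U h => by simp only [survives_congr m m' A U h]) k
        (g (A.card - 1)) (g (A.card - 2)) (g (A.card + (d - 2))) _ ?_ ?_ ?_ ?_
      · intro A' U' h1 h2 h3
        have := ih (j + 1) (by omega) A' U' k h1 (by rw [h2]; omega) (by rw [h2]; omega) (by omega)
          (by omega)
        rwa [hgdef, show (A'.card : ℝ) = A.card - 1 by rw [← h3]; push_cast; ring] at this
      · intro A' U' k' h1 h2 h3 h4
        have := ih (j + 1) (by omega) A' U' k' h1 (by rw [h3]; omega) (by rw [h3]; omega) (by omega)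
          (by omega)
        rwa [hgdef, show (A'.card : ℝ) = A.card - 2 by rw [← h4]; push_cast; ring] at this
      · intro A' U' k' h1 h2 h3 h4
        have h6 : d * U.card = d * U'.card + d := by rw [← h3]; ring
        have := ih (j + 1) (by omega) A' U' k' h1 (by omega) (by omega) (by omega) (by omega)
        have h7 : (A'.card : ℝ) + 2 = A.card + d := by exact_mod_cast h4
        rwa [hgdef, show (A'.card : ℝ) = A.card + (d - 2) by linarith] at this
      · intro h2k p q hp hq hp0 hp1 hq0 hq1
        have hdrift := hdr j _ k A.card (by omega) hM1 hM2 hK hs (by omega) hA h2k p q hp hq hp0 hp1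
          hq0 hq1
        have hdR : (3 : ℝ) ≤ d := by exact_mod_cast hd
        set y := max (L - (A.card : ℝ)) 0 with hy
        have hy0 : 0 ≤ y := le_max_right _ _
        have hyL : y ≤ L := max_le (by linarith [Nat.cast_nonneg (α := ℝ) A.card]) hL.le
        have hsq : ∀ x : ℝ, x ^ 2 ≤ (d : ℝ) ^ 2 → (max (L - (A.card + x)) 0) ^ 2
            ≤ y ^ 2 - 2 * y * x + d ^ 2 := by
          intro x hx
          have h1 : L - (A.card : ℝ) ≤ y := le_max_left _ _
          have h2 : max (L - (A.card + x)) 0 ≤ |y - x| :=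
            max_le (le_trans (by linarith) (le_abs_self _)) (abs_nonneg _)
          have h3 := pow_le_pow_left₀ (le_max_right _ _) h2 2
          rw [sq_abs] at h3
          nlinarith
        have e1 := hsq (-1) (by nlinarith)
        have e2 := hsq (-2) (by nlinarith)
        have e3 := hsq (d - 2) (by nlinarith)
        rw [hg]
        simp only
        rw [show (A.card : ℝ) - 1 = A.card + -1 by ring,
          show (A.card : ℝ) - 2 = A.card + -2 by ring]
        have hL2 : (0 : ℝ) < L ^ 2 := by positivity
        rw [le_div_iff₀ hL2]
        have hcomb : ∀ a b c : ℝ, ((1 - p) * (a / L ^ 2) + p * (q * (b / L ^ 2)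
            + (1 - q) * (c / L ^ 2))) * L ^ 2 = (1 - p) * a + p * (q * b + (1 - q) * c) := by
          intro a b c
          field_simp
        rw [hcomb]
        have f1 := mul_le_mul_of_nonneg_left e1 (sub_nonneg.2 hp1)
        have f2 := mul_le_mul_of_nonneg_left e2 (mul_nonneg hp0 hq0)
        have f3 := mul_le_mul_of_nonneg_left e3 (mul_nonneg hp0 (sub_nonneg.2 hq1))
        have f4 := mul_le_mul_of_nonneg_left hdrift hy0
        have f5 := mul_le_mul_of_nonneg_right hyL hγ
        push_cast
        linarith only [f1, f2, f3, f4, f5]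
    · have : ∀ m : Equiv.Perm (V × Fin d), ¬ Survives m (r + 1) A U := fun m h => hne h.1
      rw [Finset.not_nonempty_iff_eq_empty] at hne
      simp only [this, not_false_eq_true, if_true, Finset.sum_const, nsmul_eq_mul, mul_one]
      refine le_mul_of_one_le_right (Nat.cast_nonneg _) ?_
      rw [one_le_div (by positivity), hne]
      simp only [Finset.card_empty, Nat.cast_zero, sub_zero, max_eq_left hL.le]
      have : 0 ≤ (2 * L * γ + (d : ℝ) ^ 2) * ((r + 1 : ℕ) : ℝ) := by positivity
      linarith

set_option maxHeartbeats 400000 in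
open scoped Classical in
/-- The probability that the exploration with restarts fails. While there are fewer than `h₀` active
half-edges, their squared number increases on average by at least `1 / 2` per step, so that a height
of `h₀` is reached after about `h₀ ^ 2` steps; from that height on, `not_survives_le` applies. -/
lemma fails_le {M K T₁ T₂ h₀ : ℕ} (hd : 3 ≤ d) {γ : ℝ} (hγ : 0 ≤ γ) (hh₀ : 1 ≤ h₀) (hT₁ : 1 ≤ T₁)
    (hdr : DriftBound d M K (T₁ + T₂) γ) (hγh : 2 * h₀ * γ ≤ 1 / 2) (hM : 2 * T₁ < M) :
    ∀ T j, j + T = T₁ → ∀ (A : Finset (V × Fin d)) (U : Finset V) (k : ℕ), (∀ x ∈ A, x.1 ∉ U) →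
      A.card + d * U.card ≤ M → M ≤ A.card + d * U.card + 2 * j → K ≤ k + j →
      A.card ≤ d * (j + 1) → A.card ≤ h₀ + d →
      ∑ m ∈ matchings (A ∪ halfEdges d U) k, (if Fails m T₂ h₀ T A U then (1 : ℝ) else 0)
        ≤ (matchings (A ∪ halfEdges d U) k).card *
          ((2 * h₀ * γ + d ^ 2) * T₂ / h₀ ^ 2
            + 2 * ((h₀ + d : ℝ) ^ 2 - A.card ^ 2 + j / 2) / T₁) := by
  have hhR : (1 : ℝ) ≤ h₀ := by exact_mod_cast hh₀
  have hTR : (1 : ℝ) ≤ T₁ := by exact_mod_cast hT₁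
  have hdR : (3 : ℝ) ≤ d := by exact_mod_cast hd
  set b : ℝ := (2 * h₀ * γ + d ^ 2) * T₂ / h₀ ^ 2 with hb
  have hb0 : 0 ≤ b := by positivity
  have hsqle : ∀ A : Finset (V × Fin d), A.card ≤ h₀ + d →
      (0 : ℝ) ≤ (h₀ + d : ℝ) ^ 2 - A.card ^ 2 := by
    intro A h
    have : (A.card : ℝ) ≤ h₀ + d := by exact_mod_cast h
    nlinarith [Nat.cast_nonneg (α := ℝ) A.card]
  -- from height `h₀` on, the exploration has to survive
  have hhigh : ∀ T j, j + T = T₁ → ∀ (A : Finset (V × Fin d)) (U : Finset V) (k : ℕ),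
      (∀ x ∈ A, x.1 ∉ U) →
      A.card + d * U.card ≤ M → M ≤ A.card + d * U.card + 2 * j → K ≤ k + j →
      A.card ≤ d * (j + 1) → A.card ≤ h₀ + d → h₀ ≤ A.card →
      ∑ m ∈ matchings (A ∪ halfEdges d U) k, (if ¬ Survives m T₂ A U then (1 : ℝ) else 0)
        ≤ (matchings (A ∪ halfEdges d U) k).card *
          (b + 2 * ((h₀ + d : ℝ) ^ 2 - A.card ^ 2 + j / 2) / T₁) := by
    intro T j hj A U k hAU hM1 hM2 hK hA hA2 hh
    have := not_survives_le (L := h₀) hd hγ (by linarith) hdr T₂ j (by omega) A U k hAU hM1 hM2 hK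
      hA
    refine le_trans this (mul_le_mul_of_nonneg_left ?_ (Nat.cast_nonneg _))
    have hh' : (h₀ : ℝ) ≤ A.card := by exact_mod_cast hh
    rw [max_eq_right (by linarith), hb]
    have h1 : 0 ≤ 2 * ((h₀ + d : ℝ) ^ 2 - A.card ^ 2 + j / 2) / T₁ := by
      have := hsqle A hA2
      positivity
    simpa using h1
  intro T
  induction T with
  | zero =>
    intro j hj A U k hAU hM1 hM2 hK hA hA2
    refine le_trans (Finset.sum_le_sum (g := fun _ => (1 : ℝ)) fun m _ => by split_ifs <;> simp) ?_
    rw [Finset.sum_const, nsmul_eq_mul, mul_one]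
    refine le_mul_of_one_le_right (Nat.cast_nonneg _) ?_
    have h1 := hsqle A hA2
    have h2 : (j : ℝ) = T₁ := by exact_mod_cast hj
    have : 1 ≤ 2 * ((h₀ + d : ℝ) ^ 2 - A.card ^ 2 + j / 2) / T₁ := by
      rw [one_le_div (by linarith), h2]; linarith
    linarith
  | succ T ih =>
    intro j hj A U k hAU hM1 hM2 hK hA hA2
    rcases le_or_gt h₀ A.card with hh | hh
    · refine le_trans (Finset.sum_le_sum fun m _ => ?_)
        (hhigh (T + 1) j hj A U k hAU hM1 hM2 hK hA hA2 hh)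
      by_cases hf : Fails m T₂ h₀ (T + 1) A U
      · rw [if_pos hf, if_pos (hf.1 hh)]
      · rw [if_neg hf]; split_ifs <;> simp
    have hdj : d * (j + 1 + 1) = d * (j + 1) + d := by ring
    by_cases hne : A.Nonempty
    · have he := hne.choose_spec
      have hs : 1 ≤ A.card := Finset.card_pos.2 hne
      have hiff : ∀ m : Equiv.Perm (V × Fin d), Fails m T₂ h₀ (T + 1) A U ↔
          Fails m T₂ h₀ T (nextActive m A U hne.choose) (nextUnexplored m U hne.choose) := fun m =>
        ⟨fun h => (h.2 hh).1 hne, fun h => ⟨fun h' => absurd h' (not_le.2 hh),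
          fun _ => ⟨fun _ => h, fun h' => absurd hne h'⟩⟩⟩
      simp only [hiff]
      set g : ℝ → ℝ := fun x => b + 2 * ((h₀ + d : ℝ) ^ 2 - x ^ 2 + ((j + 1 : ℕ) : ℝ) / 2) / T₁
        with hg
      have hgdef : ∀ x : ℝ, b + 2 * ((h₀ + d : ℝ) ^ 2 - x ^ 2 + ((j + 1 : ℕ) : ℝ) / 2) / T₁ = g x :=
        fun x => rfl
      refine sum_next_le' hAU he (fun m A U => if Fails m T₂ h₀ T A U then (1 : ℝ) else 0)
        (fun m m' A U h => by simp only [fails_congr m m' A U h]) k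
        (g (A.card - 1)) (g (A.card - 2)) (g (A.card + (d - 2))) _ ?_ ?_ ?_ ?_
      · intro A' U' h1 h2 h3
        have := ih (j + 1) (by omega) A' U' k h1 (by rw [h2]; omega) (by rw [h2]; omega) (by omega)
          (by omega) (by omega)
        rwa [hgdef, show (A'.card : ℝ) = A.card - 1 by rw [← h3]; push_cast; ring] at this
      · intro A' U' k' h1 h2 h3 h4
        have := ih (j + 1) (by omega) A' U' k' h1 (by rw [h3]; omega) (by rw [h3]; omega) (by omega)
          (by omega) (by omega)
        rwa [hgdef, show (A'.card : ℝ) = A.card - 2 by rw [← h4]; push_cast; ring] at this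
      · intro A' U' k' h1 h2 h3 h4
        have h6 : d * U.card = d * U'.card + d := by rw [← h3]; ring
        have := ih (j + 1) (by omega) A' U' k' h1 (by omega) (by omega) (by omega) (by omega)
          (by omega)
        have h7 : (A'.card : ℝ) + 2 = A.card + d := by exact_mod_cast h4
        rwa [hgdef, show (A'.card : ℝ) = A.card + (d - 2) by linarith] at this
      · intro h2k p q hp hq hp0 hp1 hq0 hq1
        have hdrift := hdr j _ k A.card (by omega) hM1 hM2 hK hs (by omega) hA h2k p q hp hq hp0 hp1
          hq0 hq1
        have hsR : (A.card : ℝ) ≤ h₀ := by exact_mod_cast hh.le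
        have hs0 : (0 : ℝ) ≤ A.card := Nat.cast_nonneg _
        have hcomb : (1 - p) * g (A.card - 1) + p * (q * g (A.card - 2)
            + (1 - q) * g (A.card + (d - 2))) = b + 2 * ((h₀ + d : ℝ) ^ 2
            - ((1 - p) * (A.card - 1 : ℝ) ^ 2 + p * (q * (A.card - 2 : ℝ) ^ 2
            + (1 - q) * (A.card + (d - 2) : ℝ) ^ 2)) + ((j + 1 : ℕ) : ℝ) / 2) / T₁ := by
          simp only [hg]
          field_simp
          ring
        rw [hcomb]
        have hT0 : (0 : ℝ) < T₁ := by linarith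
        gcongr b + 2 * ?_ / _
        have f1 : (A.card : ℝ) * -γ ≤ A.card * (p * (d - 1) - 1 - p * q * d) :=
          mul_le_mul_of_nonneg_left hdrift hs0
        have f2 : (A.card : ℝ) * γ ≤ h₀ * γ := mul_le_mul_of_nonneg_right hsR hγ
        have f3 : (0 : ℝ) ≤ p * q * 3 := by positivity
        have f4 : (0 : ℝ) ≤ p * (1 - q) * ((d - 2 : ℝ) ^ 2 - 1) :=
          mul_nonneg (mul_nonneg hp0 (by linarith)) (by nlinarith)
        push_cast
        linarith only [f1, f2, f3, f4, hγh]
    · rw [Finset.not_nonempty_iff_eq_empty] at hne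
      have hUne : U.Nonempty := by
        rw [← Finset.card_pos]
        by_contra h0
        have : U.card = 0 := by omega
        rw [this, hne] at hM2
        simp at hM2
        omega
      set v := hUne.choose with hv
      have hvU : v ∈ U := hUne.choose_spec
      have hX : A ∪ halfEdges d U = halfEdges d {v} ∪ halfEdges d (U.erase v) := by
        ext x
        simp only [hne, Finset.mem_union, Finset.notMem_empty, false_or, mem_halfEdges,
          Finset.mem_singleton, Finset.mem_erase]
        constructor
        · intro h; by_cases h' : x.1 = v <;> tauto
        · rintro (h | h)
          · rw [h]; exact hvU
          · exact h.2
      have hc1 : (halfEdges d {v}).card = d := by rw [card_halfEdges]; simp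
      have hc2 : d * U.card = d + d * (U.erase v).card := by
        have := Finset.card_erase_add_one hvU
        rw [← this]; ring
      have hiff : ∀ m : Equiv.Perm (V × Fin d), Fails m T₂ h₀ (T + 1) A U →
          Fails m T₂ h₀ T (halfEdges d {v}) (U.erase v) := fun m h =>
        (h.2 hh).2 (by simp [hne]) hUne
      have hA0 : A.card = 0 := by rw [hne]; rfl
      have := ih (j + 1) (by omega) (halfEdges d {v}) (U.erase v) k (by simp) (by omega) (by omega)
        (by omega) (by rw [hc1]; nlinarith) (by omega)
      rw [hX]
      refine le_trans (Finset.sum_le_sum fun m _ => ?_) (le_trans this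
        (mul_le_mul_of_nonneg_left ?_ (Nat.cast_nonneg _)))
      · by_cases hf : Fails m T₂ h₀ (T + 1) A U
        · rw [if_pos hf, if_pos (hiff m hf)]
        · rw [if_neg hf]; split_ifs <;> simp
      · have hT0 : (0 : ℝ) < T₁ := by linarith
        rw [hc1, hA0]
        have h1 : (h₀ + d : ℝ) ^ 2 - d ^ 2 + ((j + 1 : ℕ) : ℝ) / 2
            ≤ (h₀ + d : ℝ) ^ 2 - ((0 : ℕ) : ℝ) ^ 2 + j / 2 := by
          have h2 : (0 : ℝ) ≤ (d : ℝ) ^ 2 - 1 / 2 := by nlinarith only [hdR]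
          push_cast
          linarith only [h2]
        exact add_le_add_right (div_le_div_of_nonneg_right
          (mul_le_mul_of_nonneg_left h1 zero_le_two) hT0.le) b

end Averages

/-! ### Simple perfect matchings and switchings -/

section Simple

variable {V : Type*} [DecidableEq V] {d : ℕ}

/-- The map that switches the pair of `x'` with the pair of `b`: the pairs `{x', σ x'}` and
`{b, σ b}` are replaced by `{σ x', b}` and `{x', σ b}`. -/
def switch (σ : Equiv.Perm (V × Fin d)) (x' b : V × Fin d) : Equiv.Perm (V × Fin d) :=
  Equiv.swap x' b * σ * Equiv.swap x' b

lemma switch_switch (σ : Equiv.Perm (V × Fin d)) (x' b : V × Fin d) :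
    switch (switch σ x' b) x' b = σ := by
  simp [switch, mul_assoc]

variable [Fintype V]

/-- The half-edges that lie on a loop or on a multiple edge of the multigraph of a perfect matching
`σ`. A loop is included because its two half-edges start and end at the same vertex. -/
def badSet (σ : Equiv.Perm (V × Fin d)) : Finset (V × Fin d) :=
  Finset.univ.filter fun x => ∃ y, y ≠ x ∧ y.1 = x.1 ∧ (σ y).1 = (σ x).1

lemma mem_badSet {σ : Equiv.Perm (V × Fin d)} {x : V × Fin d} :
    x ∈ badSet σ ↔ ∃ y, y ≠ x ∧ y.1 = x.1 ∧ (σ y).1 = (σ x).1 := by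
  simp [badSet]

/-- The perfect matchings of the half-edges. -/
def perfectMatchings (V : Type*) [Fintype V] [DecidableEq V] (d : ℕ) :
    Finset (Equiv.Perm (V × Fin d)) :=
  Finset.univ.filter fun σ => (∀ x, σ (σ x) = x) ∧ ∀ x, σ x ≠ x

lemma mem_perfectMatchings {σ : Equiv.Perm (V × Fin d)} :
    σ ∈ perfectMatchings V d ↔ (∀ x, σ (σ x) = x) ∧ ∀ x, σ x ≠ x := by
  simp [perfectMatchings]

lemma perfectMatchings_eq {N : ℕ} (hN : 2 * N = Fintype.card V * d) :
    perfectMatchings V d = matchings Finset.univ N := by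
  ext σ
  rw [mem_perfectMatchings, mem_matchings]
  refine and_congr Iff.rfl ?_
  have hc : (Finset.univ : Finset (V × Fin d)).card = 2 * N := by
    rw [Finset.card_univ, Fintype.card_prod, Fintype.card_fin, hN]
  constructor
  · intro h
    have : σ.support = Finset.univ := by
      ext x; simpa using h x
    rw [this]
    exact ⟨subset_rfl, hc⟩
  · rintro ⟨-, h⟩ x
    have : σ.support = Finset.univ := by
      rw [← Finset.card_eq_iff_eq_univ, h, ← hc, Finset.card_univ]
    rw [← Equiv.Perm.mem_support, this]
    exact Finset.mem_univ _

lemma switch_mem {σ : Equiv.Perm (V × Fin d)} (hσ : σ ∈ perfectMatchings V d) (x' b : V × Fin d) :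
    switch σ x' b ∈ perfectMatchings V d := by
  rw [mem_perfectMatchings] at hσ ⊢
  refine ⟨fun z => by simp [switch, hσ.1], fun z h => ?_⟩
  refine hσ.2 (Equiv.swap x' b z) ?_
  have := congrArg (Equiv.swap x' b) h
  simpa [switch] using this

/-- The vertices that are at distance at most one from the edge of the half-edge `x`. -/
def nearby (σ : Equiv.Perm (V × Fin d)) (x : V × Fin d) : Finset V :=
  {x.1, (σ x).1} ∪ (halfEdges d {x.1, (σ x).1}).image fun y => (σ y).1

lemma card_nearby_le (σ : Equiv.Perm (V × Fin d)) (x : V × Fin d) :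
    (nearby σ x).card ≤ 2 + 2 * d := by
  have h1 : ({x.1, (σ x).1} : Finset V).card ≤ 2 := Finset.card_le_two
  have h2 : ((halfEdges d {x.1, (σ x).1}).image fun y => (σ y).1).card ≤ d * 2 := by
    refine le_trans Finset.card_image_le ?_
    rw [card_halfEdges]
    exact Nat.mul_le_mul_left _ h1
  have := Finset.card_union_le ({x.1, (σ x).1} : Finset V)
    ((halfEdges d {x.1, (σ x).1}).image fun y => (σ y).1)
  rw [nearby]
  omega

/-- The half-edges `b` whose edge is simple and far from the edge of `x`. -/
def goodSet (σ : Equiv.Perm (V × Fin d)) (x : V × Fin d) : Finset (V × Fin d) :=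
  Finset.univ.filter fun b => b.1 ∉ nearby σ x ∧ (σ b).1 ∉ nearby σ x ∧ b ∉ badSet σ

lemma card_le_goodSet (σ : Equiv.Perm (V × Fin d)) (x : V × Fin d) :
    Fintype.card V * d ≤ (goodSet σ x).card + (2 * (d * (2 + 2 * d)) + (badSet σ).card) := by
  have hsub : (Finset.univ : Finset (V × Fin d)) ⊆ goodSet σ x ∪ ((halfEdges d (nearby σ x)
      ∪ (halfEdges d (nearby σ x)).map σ.symm.toEmbedding) ∪ badSet σ) := by
    intro b _
    simp only [goodSet, Finset.mem_union, Finset.mem_filter, Finset.mem_univ, true_and,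
      mem_halfEdges, Finset.mem_map_equiv, Equiv.symm_symm]
    tauto
  have h1 := Finset.card_le_card hsub
  have h2 := Finset.card_union_le (goodSet σ x) ((halfEdges d (nearby σ x)
      ∪ (halfEdges d (nearby σ x)).map σ.symm.toEmbedding) ∪ badSet σ)
  have h3 := Finset.card_union_le (halfEdges d (nearby σ x)
      ∪ (halfEdges d (nearby σ x)).map σ.symm.toEmbedding) (badSet σ)
  have h4 := Finset.card_union_le (halfEdges d (nearby σ x))
      ((halfEdges d (nearby σ x)).map σ.symm.toEmbedding)
  rw [Finset.card_map, card_halfEdges] at h4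
  have h5 := Nat.mul_le_mul_left d (card_nearby_le σ x)
  rw [Finset.card_univ, Fintype.card_prod, Fintype.card_fin] at h1
  omega

/-- Switching a bad edge with a good one removes bad half-edges and creates none. -/
lemma badSet_switch {σ : Equiv.Perm (V × Fin d)} (hσ : σ ∈ perfectMatchings V d)
    {x b : V × Fin d} (hx : x ∈ badSet σ) (hb : b ∈ goodSet σ x) :
    (badSet (switch σ (σ x) b)).card < (badSet σ).card ∧ switch σ (σ x) b b = x ∧
      σ x ∈ halfEdges d (insert x.1 ((halfEdges d {x.1}).image
        fun y => (switch σ (σ x) b y).1)) := by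
  obtain ⟨hinv, hfix⟩ := mem_perfectMatchings.1 hσ
  have hσ' := switch_mem hσ (σ x) b
  simp only [goodSet, Finset.mem_filter, Finset.mem_univ, true_and] at hb
  obtain ⟨hb1, hb2, hbbad⟩ := hb
  set x' := σ x with hx'
  set b' := σ b with hb'
  set τ := switch σ x' b with hτ
  obtain ⟨hinvτ, -⟩ := mem_perfectMatchings.1 hσ'
  have near1 : x.1 ∈ nearby σ x := by simp [nearby]
  have near2 : x'.1 ∈ nearby σ x := by simp [nearby, ← hx']
  have near3 : ∀ y : V × Fin d, y.1 = x.1 → (σ y).1 ∈ nearby σ x := fun y hy => by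
    refine Finset.mem_union_right _ (Finset.mem_image.2 ⟨y, by simp [hy], rfl⟩)
  have near4 : ∀ y : V × Fin d, y.1 = x'.1 → (σ y).1 ∈ nearby σ x := fun y hy => by
    refine Finset.mem_union_right _ (Finset.mem_image.2 ⟨y, by simp [hy, ← hx'], rfl⟩)
  have ne1 : b.1 ≠ x.1 := fun h => hb1 (h ▸ near1)
  have ne2 : b.1 ≠ x'.1 := fun h => hb1 (h ▸ near2)
  have ne3 : b'.1 ≠ x.1 := fun h => hb2 (h ▸ near1)
  have ne4 : b'.1 ≠ x'.1 := fun h => hb2 (h ▸ near2)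
  have mne1 : b ≠ x := fun h => ne1 (h ▸ rfl)
  have mne2 : b ≠ x' := fun h => ne2 (h ▸ rfl)
  have mne3 : b' ≠ x := fun h => ne3 (h ▸ rfl)
  have mne4 : b' ≠ x' := fun h => ne4 (h ▸ rfl)
  have mne5 : x' ≠ x := hfix x
  have mne6 : b' ≠ b := hfix b
  have hσx' : σ x' = x := hinv x
  have hσb' : σ b' = b := hinv b
  have τx : τ x = b := by
    simp [hτ, switch, Equiv.swap_apply_of_ne_of_ne mne5.symm mne1.symm, ← hx']
  have τb : τ b = x := by
    simp [hτ, switch, hσx', Equiv.swap_apply_of_ne_of_ne mne5.symm mne1.symm]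
  have τx' : τ x' = b' := by
    simp [hτ, switch, ← hb', Equiv.swap_apply_of_ne_of_ne mne4 mne6]
  have τb' : τ b' = x' := by
    simp [hτ, switch, hσb', Equiv.swap_apply_of_ne_of_ne mne4 mne6]
  have τne : ∀ z, z ≠ x → z ≠ x' → z ≠ b → z ≠ b' → τ z = σ z := by
    intro z h1 h2 h3 h4
    have h5 : σ z ≠ x' := fun h => h1 (σ.injective h)
    have h6 : σ z ≠ b := fun h => h4 (by rw [hb', ← h, hinv])
    simp [hτ, switch, Equiv.swap_apply_of_ne_of_ne h2 h3, Equiv.swap_apply_of_ne_of_ne h5 h6]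
  have hbloop : b'.1 ≠ b.1 := fun h => hbbad (mem_badSet.2 ⟨b', mne6, h, by rw [hσb', ← hb', h]⟩)
  have gx : x ∉ badSet τ := by
    rw [mem_badSet]
    rintro ⟨y, h1, h2, h3⟩
    rw [τx] at h3
    by_cases hy1 : y = x'
    · rw [hy1, τx'] at h3; exact hbloop h3
    by_cases hy2 : y = b
    · rw [hy2] at h2; exact ne1 h2
    by_cases hy3 : y = b'
    · rw [hy3] at h2; exact ne3 h2
    rw [τne y h1 hy1 hy2 hy3] at h3
    exact hb1 (h3 ▸ near3 y h2)
  have gx' : x' ∉ badSet τ := by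
    rw [mem_badSet]
    rintro ⟨y, h1, h2, h3⟩
    rw [τx'] at h3
    by_cases hy1 : y = x
    · rw [hy1, τx] at h3; exact hbloop h3.symm
    by_cases hy2 : y = b
    · rw [hy2] at h2; exact ne2 h2
    by_cases hy3 : y = b'
    · rw [hy3] at h2; exact ne4 h2
    rw [τne y hy1 h1 hy2 hy3] at h3
    exact hb2 (h3 ▸ near4 y h2)
  have partner : ∀ z, z ∈ badSet τ → τ z ∈ badSet τ := by
    intro z hz
    obtain ⟨y, h1, h2, h3⟩ := mem_badSet.1 hz
    exact mem_badSet.2 ⟨τ y, fun h => h1 (τ.injective h), h3, by rw [hinvτ, hinvτ, h2]⟩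
  have gb : b ∉ badSet τ := fun h => gx (τb ▸ partner b h)
  have gb' : b' ∉ badSet τ := fun h => gx' (τb' ▸ partner b' h)
  refine ⟨Finset.card_lt_card ⟨?_, fun h => gx (h hx)⟩, τb, ?_⟩
  · intro z hz
    obtain ⟨y, h1, h2, h3⟩ := mem_badSet.1 hz
    have hy : y ∈ badSet τ := mem_badSet.2 ⟨z, h1.symm, h2.symm, h3.symm⟩
    have hne : ∀ w, w ∈ badSet τ → w ≠ x ∧ w ≠ x' ∧ w ≠ b ∧ w ≠ b' := fun w hw =>
      ⟨fun h => gx (h ▸ hw), fun h => gx' (h ▸ hw), fun h => gb (h ▸ hw), fun h => gb' (h ▸ hw)⟩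
    obtain ⟨a1, a2, a3, a4⟩ := hne z hz
    obtain ⟨c1, c2, c3, c4⟩ := hne y hy
    rw [τne z a1 a2 a3 a4, τne y c1 c2 c3 c4] at h3
    exact mem_badSet.2 ⟨y, h1, h2, h3⟩
  · obtain ⟨y, h1, h2, h3⟩ := mem_badSet.1 hx
    rw [mem_halfEdges, Finset.mem_insert]
    by_cases hyx' : y = x'
    · left; rw [← hyx', h2]
    · right
      have hyb : y ≠ b := fun h => ne1 (h ▸ h2)
      have hyb' : y ≠ b' := fun h => ne3 (h ▸ h2)
      exact Finset.mem_image.2 ⟨y, by simp [h2], by rw [τne y h1 hyx' hyb hyb', h3]⟩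

/-- The number of perfect matchings with `b` bad half-edges is at most a constant times the number
of those with fewer bad half-edges. -/
lemma card_bad_eq_le {b B : ℕ} (hb : 1 ≤ b) (hbB : b ≤ B) :
    ((perfectMatchings V d).filter fun σ => (badSet σ).card = b).card
        * (Fintype.card V * d - (2 * (d * (2 + 2 * d)) + B))
      ≤ ((perfectMatchings V d).filter fun σ => (badSet σ).card < b).card
        * (Fintype.card V * d * (d * (1 + d))) := by
  classical
  rcases isEmpty_or_nonempty (V × Fin d) with hH | hH
  · have h0 : Fintype.card V * d = 0 := by
      have := Fintype.card_eq_zero (α := V × Fin d)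
      rwa [Fintype.card_prod, Fintype.card_fin] at this
    simp [h0]
  have hex : ∀ σ : Equiv.Perm (V × Fin d), ∃ x, (badSet σ).card = b → x ∈ badSet σ := by
    intro σ
    by_cases h : (badSet σ).card = b
    · obtain ⟨x, hx⟩ : (badSet σ).Nonempty := Finset.card_pos.1 (by omega)
      exact ⟨x, fun _ => hx⟩
    · exact ⟨hH.some, fun h' => absurd h' h⟩
  choose x hx using hex
  set S := (perfectMatchings V d).filter fun σ => (badSet σ).card = b
  set S' := (perfectMatchings V d).filter fun σ => (badSet σ).card < b
  set R : Equiv.Perm (V × Fin d) → V × Fin d → Finset (V × Fin d) := fun τ b =>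
    halfEdges d (insert (τ b).1 ((halfEdges d {(τ b).1}).image fun y => (τ y).1)) with hR
  have hRcard : ∀ τ b, (R τ b).card ≤ d * (1 + d) := by
    intro τ b
    rw [hR]
    simp only
    rw [card_halfEdges]
    refine Nat.mul_le_mul_left _ (le_trans (Finset.card_insert_le _ _) ?_)
    have : ((halfEdges d {(τ b).1}).image fun y => (τ y).1).card ≤ d := by
      refine le_trans Finset.card_image_le ?_
      rw [card_halfEdges]; simp
    omega
  have hdom : S.card * (Fintype.card V * d - (2 * (d * (2 + 2 * d)) + B))
      ≤ (S.sigma fun σ => goodSet σ (x σ)).card := by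
    rw [Finset.card_sigma, ← smul_eq_mul]
    refine Finset.card_nsmul_le_sum _ _ _ fun σ hσ => ?_
    have h1 := card_le_goodSet σ (x σ)
    have h2 : (badSet σ).card = b := (Finset.mem_filter.1 hσ).2
    omega
  have hcod : (S'.sigma fun τ => (Finset.univ : Finset (V × Fin d)).sigma fun b => R τ b).card
      ≤ S'.card * (Fintype.card V * d * (d * (1 + d))) := by
    rw [Finset.card_sigma, ← smul_eq_mul]
    refine Finset.sum_le_card_nsmul _ _ _ fun τ _ => ?_
    rw [Finset.card_sigma]
    refine le_trans (Finset.sum_le_card_nsmul _ _ (d * (1 + d)) fun b _ => hRcard τ b) ?_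
    rw [Finset.card_univ, Fintype.card_prod, Fintype.card_fin, smul_eq_mul]
  refine le_trans hdom (le_trans ?_ hcod)
  refine Finset.card_le_card_of_injOn
    (fun q => ⟨switch q.1 (q.1 (x q.1)) q.2, q.2, q.1 (x q.1)⟩) ?_ ?_
  · rintro ⟨σ, c⟩ hq
    simp only [Finset.coe_sigma, Set.mem_sigma_iff, Finset.mem_coe] at hq ⊢
    obtain ⟨hσ, hc⟩ := hq
    obtain ⟨hσ1, hσ2⟩ := Finset.mem_filter.1 hσ
    obtain ⟨h1, h2, h3⟩ := badSet_switch hσ1 (hx σ hσ2) hc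
    refine ⟨Finset.mem_filter.2 ⟨switch_mem hσ1 _ _, hσ2 ▸ h1⟩, Finset.mem_univ _, ?_⟩
    rw [hR]
    simp only
    rw [h2]
    exact h3
  · rintro ⟨σ₁, c₁⟩ - ⟨σ₂, c₂⟩ - h
    simp only [Sigma.mk.injEq, heq_eq_eq] at h
    obtain ⟨h1, h2, h3⟩ := h
    subst h2
    rw [← switch_switch σ₁ (σ₁ (x σ₁)) c₁, h1, h3, switch_switch]

lemma card_filter_pair {α : Type*} [Fintype α] [DecidableEq α] {X : Finset α} {k : ℕ} {e f : α}
    (hef : e ≠ f) (he : e ∈ X) (hf : f ∈ X) :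
    ((matchings X (k + 1)).filter fun m => m e = f).card = numMatchings (X.card - 2) k := by
  have := sum_filter_pair (k := k) hef he hf (fun _ => (1 : ℝ))
  simp only [Finset.sum_const, nsmul_eq_mul, mul_one] at this
  have h2 : ((matchings X (k + 1)).filter fun m => m e = f).card
      = (matchings ((X.erase e).erase f) k).card := by exact_mod_cast this
  rw [h2, card_matchings, Finset.card_erase_of_mem (Finset.mem_erase.2 ⟨hef.symm, hf⟩),
    Finset.card_erase_of_mem he, Nat.sub_sub]

lemma card_filter_two_pairs {α : Type*} [Fintype α] [DecidableEq α] {X : Finset α} {k : ℕ}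
    {x y a b : α} (hx : x ∈ X) (hy : y ∈ X) (ha : a ∈ X) (hb : b ∈ X)
    (hxy : x ≠ y) (hxa : x ≠ a) (hxb : x ≠ b) (hya : y ≠ a) (hyb : y ≠ b) (hab : a ≠ b) :
    ((matchings X (k + 2)).filter fun m => m x = a ∧ m y = b).card
      = numMatchings (X.card - 4) k := by
  have h := sum_filter_pair (k := k + 1) hxa hx ha (fun m => if m y = b then (1 : ℝ) else 0)
  have hyX : y ∈ (X.erase x).erase a := by simp [hya, hxy.symm, hy]
  have hbX : b ∈ (X.erase x).erase a := by simp [hab.symm, hxb.symm, hb]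
  have h2 : ∀ m ∈ matchings ((X.erase x).erase a) (k + 1),
      (if (Equiv.swap x a * m) y = b then (1 : ℝ) else 0) = if m y = b then (1 : ℝ) else 0 := by
    intro m _
    have : (Equiv.swap x a * m) y = b ↔ m y = b := by
      rw [Equiv.Perm.mul_apply, Equiv.swap_apply_eq_iff,
        Equiv.swap_apply_of_ne_of_ne hxb.symm hab.symm]
    simp only [this]
  rw [Finset.sum_congr rfl h2, Finset.sum_boole, Finset.sum_boole, Finset.filter_filter,
    card_filter_pair hyb hyX hbX, Finset.card_erase_of_mem (by simp [hxa.symm, ha]),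
    Finset.card_erase_of_mem hx] at h
  rw [show X.card - 4 = X.card - 1 - 1 - 2 by omega]
  exact_mod_cast h

lemma numMatchings_perfect (N : ℕ) :
    numMatchings (2 * (N + 1)) (N + 1) = (2 * N + 1) * numMatchings (2 * N) N := by
  rw [show 2 * (N + 1) = (2 * N + 1) + 1 by ring, numMatchings_rec,
    numMatchings_eq_zero (by omega : 2 * N + 1 < 2 * (N + 1))]
  simp

/-- The average number of bad half-edges is bounded by a constant that depends only on `d`. -/
lemma sum_card_badSet_le {N : ℕ} (hN : 2 * N = Fintype.card V * d) (hN3 : 3 ≤ N) :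
    ∑ σ ∈ perfectMatchings V d, (badSet σ).card
      ≤ 6 * d ^ 2 * (perfectMatchings V d).card := by
  classical
  obtain ⟨n, rfl⟩ : ∃ n, N = n + 2 := ⟨N - 2, by omega⟩
  have hH : Fintype.card (V × Fin d) = 2 * (n + 2) := by
    rw [Fintype.card_prod, Fintype.card_fin, hN]
  have hcard : (perfectMatchings V d).card = numMatchings (2 * (n + 2)) (n + 2) := by
    rw [perfectMatchings_eq hN, card_matchings, Finset.card_univ, hH]
  -- pairs of half-edges at the same vertex
  set P : (V × Fin d) → Finset (V × Fin d) := fun x => (halfEdges d {x.1}).erase x with hP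
  have hPcard : ∀ x, (P x).card ≤ d := fun x => by
    refine le_trans (Finset.card_erase_le) ?_
    rw [card_halfEdges]; simp
  have hpair : ∀ x, ∀ y ∈ P x,
      ((perfectMatchings V d).filter fun σ => (σ y).1 = (σ x).1).card
        ≤ numMatchings (2 * (n + 1)) (n + 1) + 2 * (n + 2) * (d * numMatchings (2 * n) n) := by
    intro x y hy
    have hyx : y ≠ x := (Finset.mem_erase.1 hy).1
    have hsub : ((perfectMatchings V d).filter fun σ => (σ y).1 = (σ x).1) ⊆
        ((perfectMatchings V d).filter fun σ => σ x = y) ∪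
        (Finset.univ : Finset (V × Fin d)).biUnion fun a => (P a).biUnion fun b =>
          (perfectMatchings V d).filter fun σ => (σ x = a ∧ σ y = b) ∧
            x ≠ a ∧ x ≠ b ∧ y ≠ a ∧ y ≠ b ∧ a ≠ b := by
      intro σ hσ
      obtain ⟨hσ1, hσ2⟩ := Finset.mem_filter.1 hσ
      obtain ⟨hinv, hfix⟩ := mem_perfectMatchings.1 hσ1
      by_cases hxy : σ x = y
      · exact Finset.mem_union_left _ (Finset.mem_filter.2 ⟨hσ1, hxy⟩)
      · refine Finset.mem_union_right _ ?_
        have hne : σ y ≠ σ x := fun h => hyx (σ.injective h)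
        simp only [Finset.mem_biUnion, Finset.mem_univ, true_and, Finset.mem_filter]
        refine ⟨σ x, σ y, ?_, hσ1, ⟨rfl, rfl⟩, (hfix x).symm, ?_, Ne.symm hxy, (hfix y).symm,
          hne.symm⟩
        · rw [hP]; simp [hne, hσ2]
        · intro h; exact hxy (by rw [h, hinv])
    refine le_trans (Finset.card_le_card hsub) (le_trans (Finset.card_union_le _ _)
      (add_le_add ?_ ?_))
    · rw [perfectMatchings_eq hN, card_filter_pair hyx.symm (Finset.mem_univ _)
        (Finset.mem_univ _), Finset.card_univ, hH]
      exact le_of_eq (by congr 1)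
    · refine le_trans (Finset.card_biUnion_le_card_mul _ _ (d * numMatchings (2 * n) n)
        fun a _ => ?_) (le_of_eq (by rw [Finset.card_univ, hH]))
      refine le_trans (Finset.card_biUnion_le_card_mul _ _ (numMatchings (2 * n) n)
        fun b _ => ?_) (Nat.mul_le_mul_right _ (hPcard a))
      by_cases hcond : x ≠ a ∧ x ≠ b ∧ y ≠ a ∧ y ≠ b ∧ a ≠ b
      · obtain ⟨c1, c2, c3, c4, c5⟩ := hcond
        simp only [c1, c2, c3, c4, c5, ne_eq, not_false_eq_true, and_self, and_true]
        rw [perfectMatchings_eq hN, card_filter_two_pairs (Finset.mem_univ _) (Finset.mem_univ _)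
          (Finset.mem_univ _) (Finset.mem_univ _) hyx.symm c1 c2 c3 c4 c5, Finset.card_univ, hH]
        exact le_of_eq (by congr 1)
      · rw [Finset.filter_false_of_mem fun σ _ h => hcond h.2]
        simp
  have hmain : ∑ σ ∈ perfectMatchings V d, (badSet σ).card ≤ 2 * (n + 2) * (d *
      (numMatchings (2 * (n + 1)) (n + 1) + 2 * (n + 2) * (d * numMatchings (2 * n) n))) := by
    have h1 : ∀ σ ∈ perfectMatchings V d, (badSet σ).card ≤ ∑ x, ∑ y ∈ P x,
        if (σ y).1 = (σ x).1 then 1 else 0 := by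
      intro σ _
      rw [badSet, Finset.card_filter]
      refine Finset.sum_le_sum fun x _ => ?_
      split_ifs with h
      · obtain ⟨y, h1, h2, h3⟩ := h
        refine le_trans (le_of_eq ?_) (Finset.single_le_sum
          (f := fun y => if (σ y).1 = (σ x).1 then 1 else 0) (fun _ _ => Nat.zero_le _)
          (show y ∈ P x by rw [hP]; simp [h1, h2]))
        simp [h3]
      · exact Nat.zero_le _
    refine le_trans (Finset.sum_le_sum h1) ?_
    rw [Finset.sum_comm]
    refine le_trans (Finset.sum_le_card_nsmul _ _ (d * (numMatchings (2 * (n + 1)) (n + 1)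
      + 2 * (n + 2) * (d * numMatchings (2 * n) n))) fun x _ => ?_) (le_of_eq ?_)
    · rw [Finset.sum_comm]
      refine le_trans (Finset.sum_le_card_nsmul _ _ (numMatchings (2 * (n + 1)) (n + 1)
        + 2 * (n + 2) * (d * numMatchings (2 * n) n)) fun y hy => ?_) ?_
      · rw [← Finset.card_filter]
        exact hpair x y hy
      · rw [smul_eq_mul]
        exact Nat.mul_le_mul_right _ (hPcard x)
    · rw [Finset.card_univ, hH, smul_eq_mul]
  refine le_trans hmain ?_
  rw [hcard, show n + 2 = (n + 1) + 1 by ring, numMatchings_perfect (n + 1), numMatchings_perfect n]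
  set a := numMatchings (2 * n) n
  have hn : 1 ≤ n := by omega
  have e1 : 2 * (n + 1 + 1) ≤ 2 * (2 * (n + 1) + 1) := by omega
  have e2 : 2 * (n + 1 + 1) ≤ 2 * (2 * n + 1) := by omega
  have hd1 : d ≤ d ^ 2 := by
    rcases Nat.eq_zero_or_pos d with rfl | h
    · simp
    · nlinarith
  calc 2 * (n + 1 + 1) * (d * ((2 * n + 1) * a + 2 * (n + 1 + 1) * (d * a)))
      ≤ 2 * (2 * (n + 1) + 1) * (d * ((2 * n + 1) * a + 2 * (2 * n + 1) * (d * a))) := by gcongr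
    _ = (2 * d + 4 * d ^ 2) * ((2 * (n + 1) + 1) * ((2 * n + 1) * a)) := by ring
    _ ≤ _ := Nat.mul_le_mul_right _ (by omega)

/-- A uniform perfect matching of the half-edges gives a simple graph with probability bounded
below: it has boundedly many bad half-edges with probability at least `1 / 2`, and switchings
remove these one edge at a time. -/
lemma card_simple_ge {N : ℕ} (hN : 2 * N = Fintype.card V * d) (hN3 : 3 ≤ N)
    (hbig : 2 * (2 * (d * (2 + 2 * d)) + 12 * d ^ 2) ≤ Fintype.card V * d) :
    (perfectMatchings V d).card ≤ 2 * (1 + 2 * (d * (1 + d))) ^ (12 * d ^ 2)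
      * ((perfectMatchings V d).filter fun σ => badSet σ = ∅).card := by
  classical
  set B := 12 * d ^ 2 with hB
  set C := 1 + 2 * (d * (1 + d)) with hC
  have hd : 1 ≤ d := by
    by_contra h
    have : d = 0 := by omega
    subst this; omega
  set f : ℕ → ℕ := fun b => ((perfectMatchings V d).filter fun σ => (badSet σ).card < b).card
    with hf
  have hstep : ∀ b, 1 ≤ b → b ≤ B → f (b + 1) ≤ C * f b := by
    intro b hb hbB
    have h1 := card_bad_eq_le (V := V) (d := d) hb hbB
    have h2 : f (b + 1) = f b + ((perfectMatchings V d).filter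
        fun σ => (badSet σ).card = b).card := by
      rw [hf]
      simp only
      rw [← Finset.card_union_of_disjoint]
      · congr 1
        ext σ
        simp only [Finset.mem_filter, Finset.mem_union]
        rw [← and_or_left]
        refine and_congr Iff.rfl ?_
        omega
      · rw [Finset.disjoint_filter]; intros; omega
    have h3 : Fintype.card V * d ≤ 2 * (Fintype.card V * d - (2 * (d * (2 + 2 * d)) + B)) := by
      omega
    have hpos : 0 < Fintype.card V * d := by omega
    have h4 : ((perfectMatchings V d).filter fun σ => (badSet σ).card = b).card
        ≤ f b * (2 * (d * (1 + d))) := by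
      refine Nat.le_of_mul_le_mul_right ?_ hpos
      calc _ ≤ _ := Nat.mul_le_mul_left _ h3
        _ = 2 * (((perfectMatchings V d).filter fun σ => (badSet σ).card = b).card *
            (Fintype.card V * d - (2 * (d * (2 + 2 * d)) + B))) := by ring
        _ ≤ 2 * (f b * (Fintype.card V * d * (d * (1 + d)))) := Nat.mul_le_mul_left _ h1
        _ = _ := by ring
    rw [h2, hC]
    calc _ ≤ f b + f b * (2 * (d * (1 + d))) := Nat.add_le_add_left h4 _
      _ = _ := by ring
  have hiter : ∀ b, b ≤ B → f (b + 1) ≤ C ^ b * f 1 := by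
    intro b
    induction b with
    | zero => intro _; simp
    | succ b ih =>
      intro hb
      calc f (b + 1 + 1) ≤ C * f (b + 1) := hstep (b + 1) (by omega) hb
        _ ≤ C * (C ^ b * f 1) := Nat.mul_le_mul_left _ (ih (by omega))
        _ = _ := by ring
  have h1 : f 1 = ((perfectMatchings V d).filter fun σ => badSet σ = ∅).card := by
    rw [hf]
    simp only
    congr 1
    ext σ
    simp
  -- Markov's inequality
  have hmarkov : (perfectMatchings V d).card ≤ 2 * f (B + 1) := by
    have h2 := sum_card_badSet_le (V := V) (d := d) hN hN3
    have h3 : ((perfectMatchings V d).filter fun σ => ¬ (badSet σ).card < B + 1).card * (B + 1)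
        ≤ ∑ σ ∈ perfectMatchings V d, (badSet σ).card := by
      refine le_trans ?_ (Finset.sum_le_sum_of_subset (Finset.filter_subset
        (fun σ => ¬ (badSet σ).card < B + 1) _))
      rw [← smul_eq_mul]
      refine Finset.card_nsmul_le_sum _ _ _ fun σ hσ => ?_
      have := (Finset.mem_filter.1 hσ).2
      omega
    have h4 := Finset.card_filter_add_card_filter_not (s := perfectMatchings V d)
      (fun σ => (badSet σ).card < B + 1)
    have h5 : f (B + 1) = ((perfectMatchings V d).filter
      fun σ => (badSet σ).card < B + 1).card := rfl
    rw [← h5] at h4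
    set P := (perfectMatchings V d).card
    set Q := ((perfectMatchings V d).filter fun σ => ¬ (badSet σ).card < B + 1).card
    have h6 : Q * (2 * (6 * d ^ 2)) ≤ P * (6 * d ^ 2) := by
      have h7 : Q * B ≤ Q * (B + 1) := Nat.mul_le_mul_left _ (by omega)
      calc Q * (2 * (6 * d ^ 2)) = Q * B := by rw [hB]; ring
        _ ≤ 6 * d ^ 2 * P := h7.trans (h3.trans h2)
        _ = _ := by ring
    have h8 : Q * 2 ≤ P := by
      have hpos : 0 < 6 * d ^ 2 := Nat.mul_pos (by norm_num) (pow_pos hd 2)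
      refine Nat.le_of_mul_le_mul_right ?_ hpos
      calc Q * 2 * (6 * d ^ 2) = Q * (2 * (6 * d ^ 2)) := by ring
        _ ≤ _ := h6
    omega
  calc (perfectMatchings V d).card ≤ 2 * f (B + 1) := hmarkov
    _ ≤ 2 * (C ^ B * f 1) := Nat.mul_le_mul_left _ (hiter B le_rfl)
    _ = _ := by rw [h1]; ring

end Simple

/-! ### Simple perfect matchings and regular graphs -/

section Labellings

variable {V : Type*} {d : ℕ}

/-- The perfect matching of the half-edges of a graph given by a labelling of the neighbours of
every vertex by the slots at that vertex. -/
def ofLabelling {G : SimpleGraph V} (l : ∀ v, Fin d ≃ G.neighborSet v) :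
    Equiv.Perm (V × Fin d) :=
  Function.Involutive.toPerm
    (fun x => ((l x.1 x.2).1, (l (l x.1 x.2).1).symm ⟨x.1, (l x.1 x.2).2.symm⟩)) (by
      have aux : ∀ v v' w : V, v' = v → ∀ (h : w ∈ G.neighborSet v') (h' : w ∈ G.neighborSet v),
          (l v').symm ⟨w, h⟩ = (l v).symm ⟨w, h'⟩ := by
        rintro v v' w rfl h h'; rfl
      rintro ⟨v, i⟩
      have h1 : ((l (l v i).1) ((l (l v i).1).symm ⟨v, (l v i).2.symm⟩)).1 = v := by simp
      refine Prod.ext h1 ?_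
      exact (aux v _ _ h1 _ (l v i).2).trans (by simp))

lemma ofLabelling_fst {G : SimpleGraph V} (l : ∀ v, Fin d ≃ G.neighborSet v) (x : V × Fin d) :
    (ofLabelling l x).1 = (l x.1 x.2).1 := rfl

lemma ofLabelling_snd {G : SimpleGraph V} (l : ∀ v, Fin d ≃ G.neighborSet v) (x : V × Fin d) :
    (ofLabelling l x).2 = (l (l x.1 x.2).1).symm ⟨x.1, (l x.1 x.2).2.symm⟩ := rfl

lemma ofLabelling_invol {G : SimpleGraph V} (l : ∀ v, Fin d ≃ G.neighborSet v) (x : V × Fin d) :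
    ofLabelling l (ofLabelling l x) = x := by
  rw [ofLabelling]
  exact Function.Involutive.toPerm_involutive _ x

lemma ofLabelling_injective {G : SimpleGraph V} :
    Function.Injective (ofLabelling (d := d) (G := G)) := by
  intro l l' h
  ext v i
  have := congrArg (fun σ => (σ (v, i)).1) h
  simpa [ofLabelling_fst] using this

lemma matchingGraph_ofLabelling {G : SimpleGraph V} (l : ∀ v, Fin d ≃ G.neighborSet v) :
    matchingGraph (ofLabelling l) = G := by
  ext v w
  rw [matchingGraph_adj (ofLabelling_invol l)]
  constructor
  · rintro ⟨-, ⟨v', i⟩, rfl, rfl⟩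
    exact (l v' i).2
  · intro h
    refine ⟨h.ne, (v, (l v).symm ⟨w, h⟩), rfl, ?_⟩
    rw [ofLabelling_fst]
    simp

variable [Fintype V] [DecidableEq V]

lemma ofLabelling_mem {G : SimpleGraph V} (l : ∀ v, Fin d ≃ G.neighborSet v) :
    ofLabelling l ∈ perfectMatchings V d ∧ badSet (ofLabelling l) = ∅ := by
  refine ⟨mem_perfectMatchings.2 ⟨ofLabelling_invol l, fun x h => ?_⟩, ?_⟩
  · have := congrArg Prod.fst h
    rw [ofLabelling_fst] at this
    exact (l x.1 x.2).2.ne this.symm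
  · rw [Finset.eq_empty_iff_forall_notMem]
    rintro ⟨v, i⟩ hx
    obtain ⟨⟨v', j⟩, h1, h2, h3⟩ := mem_badSet.1 hx
    simp only at h2
    subst h2
    rw [ofLabelling_fst, ofLabelling_fst] at h3
    exact h1 (Prod.ext rfl ((l v').injective (Subtype.ext h3)))

lemma eq_of_simple {σ : Equiv.Perm (V × Fin d)} (hbad : badSet σ = ∅) {x y : V × Fin d}
    (h1 : x.1 = y.1) (h2 : (σ x).1 = (σ y).1) : x = y := by
  by_contra h
  have : y ∈ badSet σ := mem_badSet.2 ⟨x, h, h1, h2⟩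
  rw [hbad] at this
  simp at this

lemma fst_ne_of_simple {σ : Equiv.Perm (V × Fin d)} (hσ : σ ∈ perfectMatchings V d)
    (hbad : badSet σ = ∅) (x : V × Fin d) : (σ x).1 ≠ x.1 := by
  obtain ⟨hinv, hfix⟩ := mem_perfectMatchings.1 hσ
  intro h
  exact hfix x (eq_of_simple hbad h (by rw [hinv, h]))

/-- The labelling of the neighbours of the vertices that a simple perfect matching defines. -/
lemma exists_labelling {σ : Equiv.Perm (V × Fin d)} (hσ : σ ∈ perfectMatchings V d)
    (hbad : badSet σ = ∅) :
    ∃ l : ∀ v, Fin d ≃ (matchingGraph σ).neighborSet v, ofLabelling l = σ := by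
  obtain ⟨hinv, hfix⟩ := mem_perfectMatchings.1 hσ
  have hadj : ∀ v i, (σ (v, i)).1 ∈ (matchingGraph σ).neighborSet v := fun v i =>
    (matchingGraph_adj hinv).2 ⟨(fst_ne_of_simple hσ hbad (v, i)).symm, (v, i), rfl, rfl⟩
  have hbij : ∀ v, Function.Bijective
      (fun i => (⟨(σ (v, i)).1, hadj v i⟩ : (matchingGraph σ).neighborSet v)) := by
    intro v
    constructor
    · intro i j hij
      have := eq_of_simple (x := (v, i)) (y := (v, j)) hbad rfl (congrArg Subtype.val hij)
      exact congrArg Prod.snd this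
    · rintro ⟨w, hw⟩
      obtain ⟨-, ⟨v', i⟩, h1, h2⟩ := (matchingGraph_adj hinv).1 hw
      simp only at h1
      subst h1
      exact ⟨i, Subtype.ext h2⟩
  refine ⟨fun v => Equiv.ofBijective _ (hbij v), ?_⟩
  ext1 x
  refine Prod.ext rfl ?_
  rw [ofLabelling_snd, Equiv.symm_apply_eq]
  refine Subtype.ext ?_
  simp only [Equiv.ofBijective_apply]
  change x.1 = (σ (σ x)).1
  rw [hinv]

lemma matchingGraph_regular {n : ℕ} {σ : Equiv.Perm (Fin n × Fin d)}
    (hσ : σ ∈ perfectMatchings (Fin n) d) (hbad : badSet σ = ∅) :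
    matchingGraph σ ∈ regularGraphs n d := by
  classical
  obtain ⟨l, -⟩ := exists_labelling hσ hbad
  intro v
  rw [← SimpleGraph.card_neighborSet_eq_degree, ← Fintype.card_congr (l v), Fintype.card_fin]

open scoped Classical in
/-- Every regular graph comes from the same number of simple perfect matchings. -/
lemma card_fiber {n : ℕ} {G : SimpleGraph (Fin n)} (hG : G ∈ regularGraphs n d) :
    ((perfectMatchings (Fin n) d).filter fun σ => badSet σ = ∅ ∧ matchingGraph σ = G).card
      = d.factorial ^ n := by
  classical
  have hdeg : ∀ v, Fintype.card (G.neighborSet v) = d := fun v => by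
    have := hG v
    rw [← SimpleGraph.card_neighborSet_eq_degree] at this
    convert this
  have himg : (perfectMatchings (Fin n) d).filter (fun σ => badSet σ = ∅ ∧ matchingGraph σ = G)
      = (Finset.univ : Finset (∀ v, Fin d ≃ G.neighborSet v)).image ofLabelling := by
    ext σ
    simp only [Finset.mem_filter, Finset.mem_image, Finset.mem_univ, true_and]
    constructor
    · rintro ⟨h1, h2, rfl⟩
      exact exists_labelling h1 h2
    · rintro ⟨l, rfl⟩
      exact ⟨(ofLabelling_mem l).1, (ofLabelling_mem l).2, matchingGraph_ofLabelling l⟩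
  rw [himg, Finset.card_image_of_injective _ ofLabelling_injective, Finset.card_univ,
    Fintype.card_pi]
  rw [Finset.prod_congr rfl (g := fun _ => d.factorial) fun v _ => by
    rw [Fintype.card_equiv (Fintype.equivOfCardEq (by rw [Fintype.card_fin, hdeg v])),
      Fintype.card_fin]]
  simp

end Labellings

/-! ### Submatchings of perfect matchings -/

section Submatchings

variable {V : Type*} {d : ℕ}

/-- The matching `m` consists of some of the pairs of `σ`. -/
def IsSubmatching (m σ : Equiv.Perm (V × Fin d)) : Prop := ∀ x, m x = x ∨ m x = σ x

lemma exists_of_mem_edgeSet {m σ : Equiv.Perm (V × Fin d)} (hm : ∀ x, m (m x) = x)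
    (h : IsSubmatching m σ) {e : Sym2 V} (he : e ∈ (matchingGraph m).edgeSet) :
    ∃ x, e = s(x.1, (σ x).1) := by
  induction e using Sym2.ind with
  | _ v w =>
    rw [SimpleGraph.mem_edgeSet, matchingGraph_adj hm] at he
    obtain ⟨hne, x, rfl, rfl⟩ := he
    refine ⟨x, ?_⟩
    rcases h x with hx | hx
    · rw [hx] at hne; exact absurd rfl hne
    · rw [hx]

variable [Fintype V] [DecidableEq V]

instance (m : Equiv.Perm (V × Fin d)) : DecidablePred (IsSubmatching m) := fun _ =>
  inferInstanceAs (Decidable (∀ _, _))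

lemma mul_involution {m σ : Equiv.Perm (V × Fin d)} (hm : ∀ x, m (m x) = x)
    (hσ : σ ∈ perfectMatchings V d) (h : IsSubmatching m σ) (x : V × Fin d) :
    (m x ≠ x → (m * σ) x = x) ∧ (m x = x → (m * σ) x = σ x) := by
  obtain ⟨hinv, hfix⟩ := mem_perfectMatchings.1 hσ
  refine ⟨fun hx => ?_, fun hx => ?_⟩
  · rw [Equiv.Perm.mul_apply, ← (h x).resolve_left hx, hm]
  · rw [Equiv.Perm.mul_apply]
    refine (h (σ x)).resolve_right fun h' => ?_
    rw [hinv] at h'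
    have : m x = σ x := by rw [← h', hm, h']
    exact hfix x (this.symm.trans hx)

/-- The number of perfect matchings that extend a given matching with `k` pairs. -/
lemma card_extensions {N k : ℕ} (hN : 2 * N = Fintype.card V * d) {m : Equiv.Perm (V × Fin d)}
    (hm : m ∈ matchings Finset.univ k) :
    ((perfectMatchings V d).filter fun σ => IsSubmatching m σ).card
      = numMatchings (2 * (N - k)) (N - k) := by
  obtain ⟨hinv, -, hcard⟩ := mem_matchings.1 hm
  have hH : Fintype.card (V × Fin d) = 2 * N := by rw [Fintype.card_prod, Fintype.card_fin, hN]
  have hcompl : m.supportᶜ.card = 2 * (N - k) := by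
    rw [Finset.card_compl, hcard, hH]; omega
  have hmm : ∀ τ, m * (m * τ) = τ := fun τ => by ext1 x; simp [hinv]
  rw [show numMatchings (2 * (N - k)) (N - k) = (matchings m.supportᶜ (N - k)).card by
    rw [card_matchings, hcompl]]
  refine Finset.card_nbij' (fun σ => m * σ) (fun τ => m * τ) ?_ ?_ (fun σ _ => hmm σ)
    (fun τ _ => hmm τ)
  · intro σ hσ
    obtain ⟨hσ1, hσ2⟩ := Finset.mem_filter.1 hσ
    obtain ⟨hσi, hσf⟩ := mem_perfectMatchings.1 hσ1
    have key := mul_involution hinv hσ1 hσ2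
    have hsupp : (m * σ).support = m.supportᶜ := by
      ext x
      rw [Finset.mem_compl, Equiv.Perm.mem_support, Equiv.Perm.mem_support, not_not]
      by_cases hx : m x = x
      · rw [(key x).2 hx]; simp [hx, hσf x]
      · rw [(key x).1 hx]; simp [hx]
    refine mem_matchings.2 ⟨fun x => ?_, hsupp.le, by rw [hsupp, hcompl]⟩
    by_cases hx : m x = x
    · have hx' : m (σ x) = σ x := by rw [← Equiv.Perm.mul_apply]; exact (key x).2 hx
      rw [(key x).2 hx, (key (σ x)).2 hx', hσi]
    · rw [(key x).1 hx, (key x).1 hx]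
  · intro τ hτ
    obtain ⟨hτ1, hτ2, hτ3⟩ := mem_matchings.1 hτ
    have hsupp : τ.support = m.supportᶜ := Finset.eq_of_subset_of_card_le hτ2 (by rw [hcompl, hτ3])
    have hfx : ∀ x, m x ≠ x → τ x = x := fun x hx => by
      by_contra h
      have := hτ2 (Equiv.Perm.mem_support.2 h)
      simp [hx] at this
    have hmv : ∀ x, m x = x → τ x ≠ x := fun x hx => by
      rw [← Equiv.Perm.mem_support, hsupp]; simp [hx]
    have hst : ∀ x, m x = x → m (τ x) = τ x := fun x hx => by
      by_contra h
      have h1 := hfx _ h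
      rw [hτ1] at h1
      exact hmv x hx h1.symm
    refine Finset.mem_filter.2 ⟨mem_perfectMatchings.2 ⟨fun x => ?_, fun x => ?_⟩, fun x => ?_⟩
    · simp only [Equiv.Perm.mul_apply]
      by_cases hx : m x = x
      · rw [hst x hx, hτ1, hx]
      · rw [hfx x hx, hfx (m x) (fun h => hx (m.injective h)), hinv]
    · simp only [Equiv.Perm.mul_apply]
      by_cases hx : m x = x
      · rw [hst x hx]; exact hmv x hx
      · rw [hfx x hx]; exact hx
    · by_cases hx : m x = x
      · exact Or.inl hx
      · right; rw [Equiv.Perm.mul_apply, hfx x hx]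

lemma factorial_two_mul (k : ℕ) :
    (2 * k).factorial = 2 ^ k * k.factorial * Nat.doubleFactorial (2 * k - 1) := by
  rcases k with _ | k
  · simp
  · rw [show 2 * (k + 1) = (2 * k + 1) + 1 by ring, Nat.factorial_eq_mul_doubleFactorial,
      show 2 * k + 1 + 1 = 2 * (k + 1) by ring, Nat.doubleFactorial_two_mul]
    rfl

/-- Both sides count the pairs of a perfect matching of `2 (k + j)` points and a submatching of it
with `k` pairs. -/
lemma numMatchings_mul (k j : ℕ) : numMatchings (2 * (k + j)) k * numMatchings (2 * j) j
    = (k + j).choose k * numMatchings (2 * (k + j)) (k + j) := by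
  have h1 := Nat.add_choose_mul_factorial_mul_factorial (2 * k) (2 * j)
  have h2 := Nat.add_choose_mul_factorial_mul_factorial k j
  have h3 : (2 * (k + j)).choose (2 * k) = (2 * (k + j)).choose (2 * j) := by
    rw [mul_add, Nat.choose_symm_add]
  have h4 : (k + j).choose k = (k + j).choose j := Nat.choose_symm_add
  rw [← mul_add, factorial_two_mul, factorial_two_mul, factorial_two_mul] at h1
  simp only [numMatchings, Nat.choose_self, one_mul]
  have hpos : 0 < 2 ^ (k + j) * k.factorial * j.factorial := by positivity
  refine Nat.eq_of_mul_eq_mul_right hpos ?_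
  calc _ = (2 * (k + j)).choose (2 * k) * (2 ^ k * k.factorial * Nat.doubleFactorial (2 * k - 1))
        * (2 ^ j * j.factorial * Nat.doubleFactorial (2 * j - 1)) := by rw [pow_add]; ring
    _ = _ := by rw [h3, h4, h1, ← h2]; ring

end Submatchings

/-! ### Edges of the graph of a submatching -/

section Edges

variable {V : Type*} [Fintype V] [DecidableEq V] {d : ℕ}

lemma submatching_mem_edgeSet {m σ : Equiv.Perm (V × Fin d)} (hσ : σ ∈ perfectMatchings V d)
    (hbad : badSet σ = ∅) (hm : ∀ x, m (m x) = x) (h : IsSubmatching m σ) (x : V × Fin d) :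
    s(x.1, (σ x).1) ∈ (matchingGraph m).edgeSet ↔ m x ≠ x := by
  rw [SimpleGraph.mem_edgeSet, matchingGraph_adj hm]
  have hne := fst_ne_of_simple hσ hbad x
  constructor
  · rintro ⟨-, y, h1, h2⟩ hx
    rcases h y with hy | hy
    · rw [hy, h1] at h2; exact hne h2.symm
    · rw [hy] at h2
      have hyx := eq_of_simple hbad h1 h2
      subst hyx
      rw [hx] at hy
      exact (mem_perfectMatchings.1 hσ).2 y hy.symm
  · intro hx
    exact ⟨hne.symm, x, rfl, by rw [(h x).resolve_left hx]⟩

lemma two_mul_ncard_edgeSet {m σ : Equiv.Perm (V × Fin d)} (hσ : σ ∈ perfectMatchings V d)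
    (hbad : badSet σ = ∅) (hm : ∀ x, m (m x) = x) (h : IsSubmatching m σ) :
    m.support.card = 2 * (matchingGraph m).edgeSet.ncard := by
  classical
  obtain ⟨hinv, hfix⟩ := mem_perfectMatchings.1 hσ
  rw [Set.ncard_eq_toFinset_card', Finset.card_eq_sum_card_fiberwise
    (f := fun x => s(x.1, (σ x).1)) (t := (matchingGraph m).edgeSet.toFinset)]
  · rw [Finset.sum_congr rfl (g := fun _ => 2), Finset.sum_const, smul_eq_mul, mul_comm]
    intro e he
    rw [Set.mem_toFinset] at he
    obtain ⟨x, rfl⟩ := exists_of_mem_edgeSet hm h he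
    have hx : m x ≠ x := (submatching_mem_edgeSet hσ hbad hm h x).1 he
    rw [show (m.support.filter fun y => s(y.1, (σ y).1) = s(x.1, (σ x).1)) = {x, σ x} from ?_,
      Finset.card_pair (hfix x).symm]
    ext y
    simp only [Finset.mem_filter, Equiv.Perm.mem_support, Finset.mem_insert, Finset.mem_singleton,
      Sym2.eq_iff]
    constructor
    · rintro ⟨-, ⟨h1, h2⟩ | ⟨h1, h2⟩⟩
      · exact Or.inl (eq_of_simple hbad h1 h2)
      · exact Or.inr (eq_of_simple hbad h1 (by rw [h2, hinv]))
    · rintro (rfl | rfl)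
      · exact ⟨hx, Or.inl ⟨rfl, rfl⟩⟩
      · refine ⟨?_, Or.inr ⟨rfl, by rw [hinv]⟩⟩
        rw [← (h x).resolve_left hx, hm]
        exact hx.symm
  · intro x hx
    simp only [Finset.mem_coe, Equiv.Perm.mem_support, Set.mem_toFinset] at hx ⊢
    exact (submatching_mem_edgeSet hσ hbad hm h x).2 hx

/-- The submatching of `σ` formed by the pairs whose edges belong to `E`. -/
lemma exists_submatching {σ : Equiv.Perm (V × Fin d)} (hσ : σ ∈ perfectMatchings V d)
    (hbad : badSet σ = ∅) {E : Set (Sym2 V)} (hE : E ⊆ (matchingGraph σ).edgeSet) :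
    ∃ m : Equiv.Perm (V × Fin d), (∀ x, m (m x) = x) ∧ IsSubmatching m σ ∧
      (matchingGraph m).edgeSet = E := by
  classical
  obtain ⟨hinv, hfix⟩ := mem_perfectMatchings.1 hσ
  have hf : Function.Involutive
      (fun x : V × Fin d => if s(x.1, (σ x).1) ∈ E then σ x else x) := by
    intro x
    by_cases hx : s(x.1, (σ x).1) ∈ E
    · have hx' : s((σ x).1, x.1) ∈ E := by rwa [Sym2.eq_swap]
      simp only [hx, if_true, hx', hinv]
    · simp only [hx, if_false]
  set m : Equiv.Perm (V × Fin d) := Function.Involutive.toPerm _ hf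
  have hm : ∀ x : V × Fin d, m x = if s(x.1, (σ x).1) ∈ E then σ x else x := fun x => rfl
  have hm2 : ∀ x, m (m x) = x := fun x => hf x
  have hsub : IsSubmatching m σ := fun x => by
    rw [hm]; split_ifs
    · exact Or.inr rfl
    · exact Or.inl rfl
  have hmov : ∀ x, m x ≠ x ↔ s(x.1, (σ x).1) ∈ E := fun x => by
    rw [hm]; split_ifs with h <;> simp [h, hfix x]
  refine ⟨m, hm2, hsub, ?_⟩
  ext e
  constructor
  · intro he
    obtain ⟨x, rfl⟩ := exists_of_mem_edgeSet hm2 hsub he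
    exact (hmov x).1 ((submatching_mem_edgeSet hσ hbad hm2 hsub x).1 he)
  · intro he
    obtain ⟨x, rfl⟩ := exists_of_mem_edgeSet hinv (fun x => Or.inr rfl) (hE he)
    exact (submatching_mem_edgeSet hσ hbad hm2 hsub x).2 ((hmov x).2 he)

end Edges

/-! ### Percolation on a random regular graph -/

section Percolation

open scoped Classical in
lemma bondPercolation_real {V : Type*} [Fintype V] (G : SimpleGraph V) (p : unitInterval)
    (S : Set (SimpleGraph V)) :
    (bondPercolation G p).real S = ∑ E ∈ (Finset.univ : Finset (Set (Sym2 V))).filter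
      (fun E => E ⊆ G.edgeSet ∧ SimpleGraph.fromEdgeSet E ∈ S),
      (p : ℝ) ^ E.ncard * (1 - p : ℝ) ^ (G.edgeSet \ E).ncard := by
  rw [bondPercolation, measureReal_def, Measure.map_apply SimpleGraph.measurable_fromEdgeSet
    (Set.toFinite S).measurableSet, setBernoulli_apply_eq_apply_subsets, ← measureReal_def]
  have h : {E | E ∈ SimpleGraph.fromEdgeSet ⁻¹' S ∧ E ⊆ G.edgeSet}
      = (((Finset.univ : Finset (Set (Sym2 V))).filter
        (fun E => E ⊆ G.edgeSet ∧ SimpleGraph.fromEdgeSet E ∈ S) : Finset _) : Set _) := by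
    ext E; simp [and_comm]
  rw [h, ← sum_measureReal_singleton]
  refine Finset.sum_congr rfl fun E hE => ?_
  exact setBernoulli_real_singleton p (Finset.mem_filter.1 hE).2.1 (Set.toFinite _)

open scoped Classical in
/-- Percolation on the graph of a simple perfect matching keeps a random submatching. -/
lemma bondPercolation_matchingGraph {V : Type*} [Fintype V] [DecidableEq V] {d N : ℕ}
    (hN : 2 * N = Fintype.card V * d) {σ : Equiv.Perm (V × Fin d)}
    (hσ : σ ∈ perfectMatchings V d) (hbad : badSet σ = ∅) (p : unitInterval)
    (S : Set (SimpleGraph V)) :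
    (bondPercolation (matchingGraph σ) p).real S = ∑ k ∈ Finset.range (N + 1),
      ∑ _m ∈ (matchings Finset.univ k).filter (fun m => IsSubmatching m σ ∧ matchingGraph m ∈ S),
        (p : ℝ) ^ k * (1 - p : ℝ) ^ (N - k) := by
  obtain ⟨hinv, hfix⟩ := mem_perfectMatchings.1 hσ
  have hself : IsSubmatching σ σ := fun x => Or.inr rfl
  have hNσ : (matchingGraph σ).edgeSet.ncard = N := by
    have h1 := two_mul_ncard_edgeSet hσ hbad hinv hself
    have h2 : σ.support = Finset.univ := by ext x; simpa using hfix x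
    rw [h2, Finset.card_univ, Fintype.card_prod, Fintype.card_fin, ← hN] at h1
    omega
  have hsubset : ∀ m : Equiv.Perm (V × Fin d), (∀ x, m (m x) = x) → IsSubmatching m σ →
      (matchingGraph m).edgeSet ⊆ (matchingGraph σ).edgeSet := by
    intro m hm hmσ e he
    obtain ⟨x, rfl⟩ := exists_of_mem_edgeSet hm hmσ he
    exact (submatching_mem_edgeSet hσ hbad hinv hself x).2 (hfix x)
  set Q : Finset (Equiv.Perm (V × Fin d)) := Finset.univ.filter fun m =>
    (∀ x, m (m x) = x) ∧ IsSubmatching m σ ∧ matchingGraph m ∈ S with hQ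
  have hcard : ∀ m ∈ Q, m.support.card = 2 * (matchingGraph m).edgeSet.ncard ∧
      (matchingGraph m).edgeSet.ncard ≤ N := by
    intro m hm
    obtain ⟨-, h1, h2, -⟩ := Finset.mem_filter.1 hm
    exact ⟨two_mul_ncard_edgeSet hσ hbad h1 h2, hNσ ▸ Set.ncard_le_ncard (hsubset m h1 h2)⟩
  have h1 : (bondPercolation (matchingGraph σ) p).real S
      = ∑ m ∈ Q, (p : ℝ) ^ (matchingGraph m).edgeSet.ncard
        * (1 - p : ℝ) ^ (N - (matchingGraph m).edgeSet.ncard) := by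
    rw [bondPercolation_real]
    symm
    refine Finset.sum_nbij (fun m => (matchingGraph m).edgeSet) ?_ ?_ ?_ ?_
    · intro m hm
      obtain ⟨-, h1, h2, h3⟩ := Finset.mem_filter.1 hm
      exact Finset.mem_filter.2 ⟨Finset.mem_univ _, hsubset m h1 h2, by simpa using h3⟩
    · intro m hm m' hm' h
      obtain ⟨-, h1, h2, -⟩ := Finset.mem_filter.1 (Finset.mem_coe.1 hm)
      obtain ⟨-, h1', h2', -⟩ := Finset.mem_filter.1 (Finset.mem_coe.1 hm')
      ext1 x
      have h3 := submatching_mem_edgeSet hσ hbad h1 h2 x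
      have h4 := submatching_mem_edgeSet hσ hbad h1' h2' x
      simp only at h
      rw [h, h4] at h3
      by_cases hx : m x = x
      · have : m' x = x := by by_contra h'; exact (h3.1 h') hx
        rw [hx, this]
      · rw [(h2 x).resolve_left hx, (h2' x).resolve_left (h3.2 hx)]
    · intro E hE
      obtain ⟨-, h1, h2⟩ := Finset.mem_filter.1 (Finset.mem_coe.1 hE)
      obtain ⟨m, h3, h4, h5⟩ := exists_submatching hσ hbad h1
      refine ⟨m, Finset.mem_coe.2 (Finset.mem_filter.2 ⟨Finset.mem_univ _, h3, h4, ?_⟩), h5⟩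
      rwa [← SimpleGraph.fromEdgeSet_edgeSet (matchingGraph m), h5]
    · intro m hm
      obtain ⟨-, h1, h2, -⟩ := Finset.mem_filter.1 hm
      rw [Set.ncard_sdiff (hsubset m h1 h2), hNσ]
  rw [h1, ← Finset.sum_fiberwise_of_maps_to (t := Finset.range (N + 1))
    (g := fun m => (matchingGraph m).edgeSet.ncard)]
  · refine Finset.sum_congr rfl fun k _ => ?_
    have h2 : (matchings Finset.univ k).filter (fun m => IsSubmatching m σ ∧ matchingGraph m ∈ S)
        = Q.filter fun m => (matchingGraph m).edgeSet.ncard = k := by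
      ext m
      simp only [Finset.mem_filter, mem_matchings, hQ, Finset.mem_univ, true_and,
        Finset.subset_univ]
      constructor
      · rintro ⟨⟨h1, h2⟩, h3, h4⟩
        refine ⟨⟨h1, h3, h4⟩, ?_⟩
        have := two_mul_ncard_edgeSet hσ hbad h1 h3
        omega
      · rintro ⟨⟨h1, h3, h4⟩, h5⟩
        refine ⟨⟨h1, ?_⟩, h3, h4⟩
        rw [two_mul_ncard_edgeSet hσ hbad h1 h3, h5]
    rw [h2]
    refine Finset.sum_congr rfl fun m hm => ?_
    rw [(Finset.mem_filter.1 hm).2]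
  · intro m hm
    have := (hcard m hm).2
    simp only [Finset.mem_range]
    omega

open scoped Classical in
lemma randomRegularPercolation_real (n d : ℕ) (p : unitInterval)
    (S : Set (SimpleGraph (Fin n))) :
    (randomRegularPercolation n d p).real S
      = ∑ G ∈ Finset.univ.filter (fun G => G ∈ regularGraphs n d),
        (bondPercolation G p).real S
          / (Finset.univ.filter (fun G => G ∈ regularGraphs n d)).card := by
  have hS : MeasurableSet S := (Set.toFinite S).measurableSet
  have hprob : ∀ G : SimpleGraph (Fin n), IsProbabilityMeasure (bondPercolation G p) := fun G => by
    unfold bondPercolation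
    exact Measure.isProbabilityMeasure_map SimpleGraph.measurable_fromEdgeSet.aemeasurable
  set R := Finset.univ.filter (fun G => G ∈ regularGraphs n d) with hR
  have hRset : regularGraphs n d = (R : Set (SimpleGraph (Fin n))) := by ext G; simp [hR]
  have hsing : ∀ G, uniformOn (regularGraphs n d) {G}
      = if G ∈ R then (R.card : ENNReal)⁻¹ else 0 := by
    intro G
    rw [uniformOn, cond_apply (Set.toFinite _).measurableSet, hRset, Measure.count_apply_finset]
    split_ifs with h
    · rw [Set.inter_singleton_of_mem (by simpa using h)]
      simp
    · rw [Set.inter_singleton_eq_empty.2 (by simpa using h)]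
      simp
  rw [randomRegularPercolation, measureReal_def, Measure.bind_apply hS
    (percolationKernel n p).measurable.aemeasurable, lintegral_fintype,
    ENNReal.toReal_sum]
  · rw [← Finset.sum_filter_add_sum_filter_not Finset.univ (fun G => G ∈ regularGraphs n d)]
    rw [Finset.sum_eq_zero (s := Finset.univ.filter fun G => ¬ G ∈ regularGraphs n d), add_zero]
    · refine Finset.sum_congr rfl fun G hG => ?_
      rw [hsing, if_pos hG, ENNReal.toReal_mul, div_eq_mul_inv, ENNReal.toReal_inv]
      rfl
    · intro G hG
      rw [hsing, if_neg]
      · simp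
      · simpa [hR] using hG
  · intro G _
    refine ENNReal.mul_ne_top ?_ ?_
    · exact measure_ne_top (bondPercolation G p) S
    · rw [hsing]
      split_ifs with h
      · simp only [ne_eq, ENNReal.inv_eq_top, Nat.cast_eq_zero]
        exact Finset.card_ne_zero_of_mem h
      · simp

/-- A constant that bounds the inverse of the probability that a uniform perfect matching of the
half-edges is simple. -/
def simpleConst (d : ℕ) : ℝ := 2 * (1 + 2 * (d * (1 + d))) ^ (12 * d ^ 2)

open scoped Classical in
/-- The transfer from uniform matchings to the percolated random regular graph. The number of edges
that percolation keeps is binomial, and given that number the percolated configuration model is a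
uniform matching of the half-edges; restricting to simple perfect matchings costs a constant
factor. -/
theorem randomRegularPercolation_le {n d N : ℕ} (hN : 2 * N = n * d) (hN3 : 3 ≤ N)
    (hbig : 2 * (2 * (d * (2 + 2 * d)) + 12 * d ^ 2) ≤ n * d) (p : unitInterval)
    (S : Set (SimpleGraph (Fin n))) (q : ℕ → ℝ)
    (hq : ∀ k ≤ N, (((matchings (Finset.univ : Finset (Fin n × Fin d)) k).filter
      fun m => matchingGraph m ∈ S).card : ℝ)
        ≤ (matchings (Finset.univ : Finset (Fin n × Fin d)) k).card * q k) :
    (randomRegularPercolation n d p).real S ≤ simpleConst d *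
      ∑ k ∈ Finset.range (N + 1), (N.choose k * (p : ℝ) ^ k * (1 - p : ℝ) ^ (N - k)) * q k := by
  have hN' : 2 * N = Fintype.card (Fin n) * d := by rw [Fintype.card_fin, hN]
  have hp0 : (0 : ℝ) ≤ p := p.2.1
  have hp1 : (0 : ℝ) ≤ 1 - p := by linarith [p.2.2]
  set Sim := (perfectMatchings (Fin n) d).filter fun σ => badSet σ = ∅ with hSim
  set R := Finset.univ.filter (fun G => G ∈ regularGraphs n d) with hR
  set F := d.factorial ^ n with hF
  have hFpos : (0 : ℝ) < F := by rw [hF]; positivity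
  have hH : (Finset.univ : Finset (Fin n × Fin d)).card = 2 * N := by
    rw [Finset.card_univ, Fintype.card_prod, hN', Fintype.card_fin, Fintype.card_fin]
  have hmaps : ∀ σ ∈ Sim, matchingGraph σ ∈ R := fun σ hσ => by
    obtain ⟨h1, h2⟩ := Finset.mem_filter.1 hσ
    exact Finset.mem_filter.2 ⟨Finset.mem_univ _, matchingGraph_regular h1 h2⟩
  have hfib : ∀ G ∈ R, ((Sim.filter fun σ => matchingGraph σ = G).card : ℝ) = F := fun G hG => by
    rw [hSim, Finset.filter_filter, hF, ← card_fiber (Finset.mem_filter.1 hG).2]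
  -- the sum over regular graphs as a sum over simple perfect matchings
  have hsum : ∀ f : SimpleGraph (Fin n) → ℝ,
      ∑ σ ∈ Sim, f (matchingGraph σ) = F * ∑ G ∈ R, f G := by
    intro f
    rw [← Finset.sum_fiberwise_of_maps_to hmaps, Finset.mul_sum]
    refine Finset.sum_congr rfl fun G hG => ?_
    rw [Finset.sum_congr rfl (g := fun _ => f G) fun σ hσ => by rw [(Finset.mem_filter.1 hσ).2],
      Finset.sum_const, nsmul_eq_mul, hfib G hG]
  have hSimcard : (Sim.card : ℝ) = F * R.card := by
    have := hsum fun _ => 1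
    simpa using this
  have hall : (perfectMatchings (Fin n) d).card = numMatchings (2 * N) N := by
    rw [perfectMatchings_eq hN', card_matchings, hH]
  have hge : ((perfectMatchings (Fin n) d).card : ℝ) ≤ simpleConst d * Sim.card := by
    have := card_simple_ge (V := Fin n) (d := d) hN' hN3 (by rwa [Fintype.card_fin])
    rw [simpleConst]
    exact_mod_cast this
  have hallpos : (0 : ℝ) < (perfectMatchings (Fin n) d).card := by
    rw [hall]; exact_mod_cast numMatchings_pos le_rfl
  have hcpos : 0 < simpleConst d := by rw [simpleConst]; positivity
  have hSimpos : (0 : ℝ) < Sim.card := by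
    by_contra h
    have h0 : (Sim.card : ℝ) ≤ 0 := not_lt.1 h
    nlinarith
  have hRpos : (0 : ℝ) < R.card := by
    rw [hSimcard] at hSimpos
    exact pos_of_mul_pos_right hSimpos hFpos.le
  -- the contribution of all perfect matchings
  have hbound : ∑ σ ∈ Sim, (bondPercolation (matchingGraph σ) p).real S
      ≤ (perfectMatchings (Fin n) d).card * ∑ k ∈ Finset.range (N + 1),
        (N.choose k * (p : ℝ) ^ k * (1 - p : ℝ) ^ (N - k)) * q k := by
    calc ∑ σ ∈ Sim, (bondPercolation (matchingGraph σ) p).real S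
        = ∑ σ ∈ Sim, ∑ k ∈ Finset.range (N + 1), ∑ m ∈ (matchings Finset.univ k).filter
            (fun m => matchingGraph m ∈ S), if IsSubmatching m σ then
              (p : ℝ) ^ k * (1 - p : ℝ) ^ (N - k) else 0 := by
          refine Finset.sum_congr rfl fun σ hσ => ?_
          obtain ⟨h1, h2⟩ := Finset.mem_filter.1 hσ
          rw [bondPercolation_matchingGraph hN' h1 h2]
          refine Finset.sum_congr rfl fun k _ => ?_
          rw [← Finset.sum_filter, Finset.filter_filter]
          refine Finset.sum_congr ?_ fun _ _ => rfl
          ext m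
          simp only [Finset.mem_filter, mem_matchings]
          tauto
      _ ≤ ∑ σ ∈ perfectMatchings (Fin n) d, ∑ k ∈ Finset.range (N + 1),
            ∑ m ∈ (matchings Finset.univ k).filter
            (fun m => matchingGraph m ∈ S), if IsSubmatching m σ then
              (p : ℝ) ^ k * (1 - p : ℝ) ^ (N - k) else 0 := by
          refine Finset.sum_le_sum_of_subset_of_nonneg (Finset.filter_subset _ _) fun σ _ _ => ?_
          refine Finset.sum_nonneg fun k _ => Finset.sum_nonneg fun m _ => ?_
          split_ifs <;> positivity
      _ = ∑ k ∈ Finset.range (N + 1), ∑ m ∈ (matchings Finset.univ k).filter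
            (fun m => matchingGraph m ∈ S), (numMatchings (2 * (N - k)) (N - k) : ℝ)
              * ((p : ℝ) ^ k * (1 - p : ℝ) ^ (N - k)) := by
          rw [Finset.sum_comm]
          refine Finset.sum_congr rfl fun k _ => ?_
          rw [Finset.sum_comm]
          refine Finset.sum_congr rfl fun m hm => ?_
          rw [← Finset.sum_filter, Finset.sum_const, nsmul_eq_mul,
            card_extensions hN' (Finset.mem_filter.1 hm).1]
      _ ≤ ∑ k ∈ Finset.range (N + 1), (perfectMatchings (Fin n) d).card *
            ((N.choose k * (p : ℝ) ^ k * (1 - p : ℝ) ^ (N - k)) * q k) := by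
          refine Finset.sum_le_sum fun k hk => ?_
          have hkN : k ≤ N := by simpa [Nat.lt_succ_iff] using hk
          rw [Finset.sum_const, nsmul_eq_mul]
          refine le_trans (mul_le_mul_of_nonneg_right (hq k hkN) (by positivity)) (le_of_eq ?_)
          obtain ⟨j, rfl⟩ : ∃ j, N = k + j := ⟨N - k, by omega⟩
          have h1 := numMatchings_mul k j
          rw [card_matchings, hH, hall, Nat.add_sub_cancel_left]
          have h2 : (numMatchings (2 * (k + j)) k : ℝ) * numMatchings (2 * j) j
              = (k + j).choose k * numMatchings (2 * (k + j)) (k + j) := by exact_mod_cast h1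
          calc _ = ((numMatchings (2 * (k + j)) k : ℝ) * numMatchings (2 * j) j)
                * (q k * ((p : ℝ) ^ k * (1 - p : ℝ) ^ j)) := by ring
            _ = _ := by rw [h2]; ring
      _ = _ := by rw [← Finset.mul_sum]
  rw [randomRegularPercolation_real, ← Finset.sum_div, div_le_iff₀ hRpos]
  have h1 := hsum fun G => (bondPercolation G p).real S
  rw [h1] at hbound
  set T := ∑ k ∈ Finset.range (N + 1), (N.choose k * (p : ℝ) ^ k * (1 - p : ℝ) ^ (N - k)) * q k
  have hT : 0 ≤ T := by
    refine Finset.sum_nonneg fun k hk => mul_nonneg (by positivity) ?_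
    have hkN : k ≤ N := by simpa [Nat.lt_succ_iff] using hk
    have h2 := hq k hkN
    have h3 : (0 : ℝ) < (matchings (Finset.univ : Finset (Fin n × Fin d)) k).card := by
      rw [card_matchings, hH]; exact_mod_cast numMatchings_pos (by omega)
    by_contra h4
    have := mul_neg_of_pos_of_neg h3 (not_le.1 h4)
    linarith [Nat.cast_nonneg (α := ℝ) ((matchings (Finset.univ : Finset (Fin n × Fin d)) k).filter
      fun m => matchingGraph m ∈ S).card]
  have h2 : F * ∑ G ∈ R, (bondPercolation G p).real S ≤ F * (simpleConst d * T * R.card) :=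
    calc _ ≤ _ := hbound
      _ ≤ simpleConst d * Sim.card * T := mul_le_mul_of_nonneg_right hge hT
      _ = _ := by rw [hSimcard]; ring
  exact le_of_mul_le_mul_left h2 hFpos

end Percolation

/-! ### Supermartingales for the upper tail -/

section Walk

lemma exp_le_one_add_add_sq {x : ℝ} (hx : |x| ≤ 1) : Real.exp x ≤ 1 + x + x ^ 2 := by
  have := (abs_le.1 (Real.abs_exp_sub_one_sub_id_le hx)).2
  linarith

/-- An upper bound for the exponential moment of a step that is `D - 2` with probability `p` and
`-1` otherwise. -/
lemma step_exp_le {D θ p β : ℝ} (hD : 3 ≤ D) (hθ : 0 ≤ θ) (hθD : θ * D ≤ 1) (hp0 : 0 ≤ p)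
    (hp1 : p ≤ 1) (hp : p * (D - 1) ≤ 1 + β) :
    (1 - p) * Real.exp (-θ) + p * Real.exp (θ * (D - 2)) ≤ Real.exp (θ * β + D ^ 2 * θ ^ 2) := by
  have h1 : Real.exp (-θ) ≤ 1 + -θ + (-θ) ^ 2 := exp_le_one_add_add_sq (by
    rw [abs_neg, abs_of_nonneg hθ]; nlinarith)
  have h2 : Real.exp (θ * (D - 2)) ≤ 1 + θ * (D - 2) + (θ * (D - 2)) ^ 2 :=
    exp_le_one_add_add_sq (by
      rw [abs_of_nonneg (mul_nonneg hθ (by linarith))]; nlinarith)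
  have h3 := mul_le_mul_of_nonneg_left h1 (sub_nonneg.2 hp1)
  have h4 := mul_le_mul_of_nonneg_left h2 hp0
  have h5 := Real.add_one_le_exp (θ * β + D ^ 2 * θ ^ 2)
  have h6 := mul_le_mul_of_nonneg_left hp hθ
  have h7 : 0 ≤ (1 - p) * (θ ^ 2 * (D ^ 2 - 1)) :=
    mul_nonneg (sub_nonneg.2 hp1) (mul_nonneg (sq_nonneg _) (by nlinarith))
  have h8 : 0 ≤ p * (θ ^ 2 * (D ^ 2 - (D - 2) ^ 2)) :=
    mul_nonneg hp0 (mul_nonneg (sq_nonneg _) (by nlinarith))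
  linarith

/-- For the same step, the negative exponential moment of order `θ` exceeds `1` by the order of
`θ ^ 2`, as long as the drift is small compared with `θ`. -/
lemma exp_le_step_exp {D θ p : ℝ} (hθ : 0 ≤ θ) (hθ1 : θ ≤ 4) (hp0 : 0 ≤ p)
    (hp1 : p ≤ 3 / 4) (hp : p * (D - 1) ≤ 1 + θ / 16) :
    Real.exp (θ ^ 2 / 32) ≤ (1 - p) * Real.exp θ + p * Real.exp (-θ * (D - 2)) := by
  have h1 : 1 + θ + θ ^ 2 / 2 ≤ Real.exp θ := Real.quadratic_le_exp_of_nonneg hθ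
  have h2 := Real.add_one_le_exp (-θ * (D - 2))
  have h3 := mul_le_mul_of_nonneg_left h1 (show 0 ≤ 1 - p by linarith)
  have h4 := mul_le_mul_of_nonneg_left h2 hp0
  have h5 : Real.exp (θ ^ 2 / 32) ≤ 1 + θ ^ 2 / 32 + (θ ^ 2 / 32) ^ 2 :=
    exp_le_one_add_add_sq (by rw [abs_of_nonneg (by positivity)]; nlinarith)
  have h6 : (θ ^ 2 / 32) ^ 2 ≤ θ ^ 2 / 32 := by
    have : θ ^ 2 / 32 ≤ 1 := by nlinarith
    nlinarith [sq_nonneg θ]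
  have h7 := mul_le_mul_of_nonneg_left hp hθ
  have h8 : θ ^ 2 / 8 ≤ (1 - p) * (θ ^ 2 / 2) := by
    have := mul_le_mul_of_nonneg_right (show (1 : ℝ) / 4 ≤ 1 - p by linarith)
      (show 0 ≤ θ ^ 2 / 2 by positivity)
    linarith
  linarith

/-- The supermartingale used up to time `t₀`. It combines `exp (θ s) - exp (-θ' s)` with
`1 - exp (-ρ t) exp (-θ' s)`, where `θ' = 16 d² θ` is so much larger than `θ` that
`exp (-θ' s)` grows on average faster than `exp (θ s)`. Both vanish, or are nonnegative, where the
walk is killed, and both are of order `θ` at the start; at time `t₀` they dominate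
`exp (θ s)`. -/
noncomputable def earlyPotential (D θ : ℝ) (t₀ : ℕ) (t s : ℕ) : ℝ :=
  Real.exp (8 * D ^ 4 * θ ^ 2 * (t₀ - t)) * (Real.exp (θ * s) - Real.exp (-(16 * D ^ 2 * θ) * s))
    + 2 * (1 - Real.exp (-(8 * D ^ 4 * θ ^ 2 * t)) * Real.exp (-(16 * D ^ 2 * θ) * s))

/-- The logarithm of the factor by which the late supermartingale decreases between the times `t`
and `T`, when the drift at time `u` is at most `β₀ - κ u`. -/
noncomputable def lateExponent (D θ β₀ κ : ℝ) (T t : ℕ) : ℝ :=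
  (T - t) * (θ * β₀ + D ^ 2 * θ ^ 2) - θ * κ / 2 * (T * (T - 1) - t * (t - 1))

/-- The supermartingale for the number of active half-edges over the times `0, …, T`. -/
noncomputable def potential (D θ β₀ κ : ℝ) (t₀ T : ℕ) (t s : ℕ) : ℝ :=
  if t < t₀ then Real.exp (lateExponent D θ β₀ κ T t₀) * earlyPotential D θ t₀ t s
  else Real.exp (θ * s + lateExponent D θ β₀ κ T t)

lemma earlyPotential_mono {D θ : ℝ} (hθ : 0 ≤ θ) (t₀ t : ℕ) :
    Monotone (earlyPotential D θ t₀ t) := by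
  intro s s' h
  have hs : (s : ℝ) ≤ s' := by exact_mod_cast h
  have h1 : Real.exp (θ * s) ≤ Real.exp (θ * s') :=
    Real.exp_le_exp.2 (mul_le_mul_of_nonneg_left hs hθ)
  have h2 : Real.exp (-(16 * D ^ 2 * θ) * s') ≤ Real.exp (-(16 * D ^ 2 * θ) * s) :=
    Real.exp_le_exp.2 (mul_le_mul_of_nonpos_left hs (by
      have : 0 ≤ 16 * D ^ 2 * θ := by positivity
      linarith))
  unfold earlyPotential
  gcongr

lemma earlyPotential_nonneg {D θ : ℝ} (hθ : 0 ≤ θ) (t₀ t s : ℕ) :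
    0 ≤ earlyPotential D θ t₀ t s := by
  refine le_trans ?_ (earlyPotential_mono hθ t₀ t (Nat.zero_le s))
  have : Real.exp (-(8 * D ^ 4 * θ ^ 2 * t)) ≤ 1 := Real.exp_le_one_iff.2 (by
    have : 0 ≤ 8 * D ^ 4 * θ ^ 2 * t := by positivity
    linarith)
  simp only [earlyPotential, Nat.cast_zero, mul_zero, Real.exp_zero, sub_self, zero_add, mul_one]
  linarith

lemma potential_mono {D θ β₀ κ : ℝ} (hθ : 0 ≤ θ) (t₀ T t : ℕ) :
    Monotone (potential D θ β₀ κ t₀ T t) := by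
  intro s s' h
  unfold potential
  split_ifs
  · exact mul_le_mul_of_nonneg_left (earlyPotential_mono hθ _ _ h) (Real.exp_pos _).le
  · have hs : (s : ℝ) ≤ s' := by exact_mod_cast h
    gcongr

lemma potential_nonneg {D θ β₀ κ : ℝ} (hθ : 0 ≤ θ) (t₀ T t s : ℕ) :
    0 ≤ potential D θ β₀ κ t₀ T t s := by
  unfold potential
  split_ifs
  · exact mul_nonneg (Real.exp_pos _).le (earlyPotential_nonneg hθ _ _ _)
  · exact (Real.exp_pos _).le

/-- The early supermartingale at time `t₀` dominates the late one. -/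
lemma exp_le_earlyPotential {D θ : ℝ} (hθ : 0 ≤ θ) {t₀ : ℕ} (ht₀ : 1 ≤ 8 * D ^ 4 * θ ^ 2 * t₀)
    (s : ℕ) : Real.exp (θ * s) ≤ earlyPotential D θ t₀ t₀ s := by
  set y := Real.exp (-(16 * D ^ 2 * θ) * s) with hy
  have hy1 : y ≤ 1 := Real.exp_le_one_iff.2 (by
    have : 0 ≤ (16 * D ^ 2 * θ) * s := by positivity
    linarith)
  have hy0 : 0 < y := Real.exp_pos _
  have h1 : Real.exp (-(8 * D ^ 4 * θ ^ 2 * t₀)) ≤ 1 / 2 := by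
    calc _ ≤ Real.exp (-1) := Real.exp_le_exp.2 (by linarith)
      _ ≤ 1 / 2 := by
        have := Real.exp_neg_one_lt_d9
        linarith
  unfold earlyPotential
  rw [sub_self, mul_zero, Real.exp_zero, one_mul, ← hy]
  nlinarith

lemma earlyPotential_step {D θ β p : ℝ} (hD : 3 ≤ D) (hθ : 0 ≤ θ) (hθD : D ^ 2 * θ ≤ 1 / 4)
    (hβ : β ≤ D ^ 2 * θ) (hp0 : 0 ≤ p) (hp1 : p ≤ 1) (hp : p * (D - 1) ≤ 1 + β)
    (t₀ t s s' : ℕ) (hs' : (s' : ℝ) = s + D - 1) :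
    (1 - p) * earlyPotential D θ t₀ (t + 1) s + p * earlyPotential D θ t₀ (t + 1) s'
      ≤ earlyPotential D θ t₀ t (s + 1) := by
  set ρ := 8 * D ^ 4 * θ ^ 2 with hρ
  have hθD' : θ * D ≤ 1 := by nlinarith
  have e1 := step_exp_le hD hθ hθD' hp0 hp1 hp
  have e2 := exp_le_step_exp (D := D) (θ := 16 * D ^ 2 * θ) (by positivity) (by linarith) hp0
    (by nlinarith) (by linarith)
  rw [show (16 * D ^ 2 * θ) ^ 2 / 32 = ρ by rw [hρ]; ring] at e2
  have hρ1 : θ * β + D ^ 2 * θ ^ 2 ≤ ρ := by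
    have h1 : θ * β ≤ D ^ 2 * θ ^ 2 := by nlinarith
    have h2 : D ^ 2 * θ ^ 2 ≤ D ^ 4 * θ ^ 2 := by
      have : D ^ 2 ≤ D ^ 4 := pow_le_pow_right₀ (by linarith) (by norm_num)
      exact mul_le_mul_of_nonneg_right this (sq_nonneg _)
    rw [hρ]; nlinarith
  have e1' := e1.trans (Real.exp_le_exp.2 hρ1)
  set a := Real.exp (θ * ((s + 1 : ℕ) : ℝ)) with ha
  set b := Real.exp (-(16 * D ^ 2 * θ) * ((s + 1 : ℕ) : ℝ)) with hb
  have ha0 : 0 < a := Real.exp_pos _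
  have hb0 : 0 < b := Real.exp_pos _
  have f1 : Real.exp (θ * s) = a * Real.exp (-θ) := by
    rw [ha, ← Real.exp_add]; congr 1; push_cast; ring
  have f2 : Real.exp (θ * s') = a * Real.exp (θ * (D - 2)) := by
    rw [ha, ← Real.exp_add, hs']; congr 1; push_cast; ring
  have f3 : Real.exp (-(16 * D ^ 2 * θ) * s) = b * Real.exp (16 * D ^ 2 * θ) := by
    rw [hb, ← Real.exp_add]; congr 1; push_cast; ring
  have f4 : Real.exp (-(16 * D ^ 2 * θ) * s')
      = b * Real.exp (-(16 * D ^ 2 * θ) * (D - 2)) := by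
    rw [hb, ← Real.exp_add, hs']; congr 1; push_cast; ring
  set x := Real.exp (ρ * (t₀ - ((t + 1 : ℕ) : ℝ))) with hx
  set y := Real.exp (-(ρ * ((t + 1 : ℕ) : ℝ))) with hy
  have hx0 : 0 < x := Real.exp_pos _
  have hy0 : 0 < y := Real.exp_pos _
  have f5 : Real.exp (ρ * (t₀ - (t : ℝ))) = x * Real.exp ρ := by
    rw [hx, ← Real.exp_add]; congr 1; push_cast; ring
  have f6 : Real.exp (-(ρ * (t : ℝ))) = y * Real.exp ρ := by
    rw [hy, ← Real.exp_add]; congr 1; push_cast; ring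
  unfold earlyPotential
  rw [← hρ, ← ha, ← hb, ← hx, ← hy, f1, f2, f3, f4, f5, f6]
  have g1 := mul_le_mul_of_nonneg_left e1' (mul_pos hx0 ha0).le
  have g2 := mul_le_mul_of_nonneg_left e2 (mul_pos hx0 hb0).le
  have g3 := mul_le_mul_of_nonneg_left e2 (mul_pos hy0 hb0).le
  linarith

lemma lateExponent_step (D θ β₀ κ : ℝ) (T t : ℕ) :
    lateExponent D θ β₀ κ T (t + 1) + (θ * (β₀ - κ * t) + D ^ 2 * θ ^ 2)
      = lateExponent D θ β₀ κ T t := by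
  unfold lateExponent
  push_cast
  ring

lemma potential_step {D θ β₀ κ p : ℝ} (hD : 3 ≤ D) (hθ : 0 ≤ θ) (hθD : D ^ 2 * θ ≤ 1 / 4)
    (hβ : β₀ ≤ D ^ 2 * θ) (hκ : 0 ≤ κ) {t₀ T : ℕ} (ht₀ : 1 ≤ 8 * D ^ 4 * θ ^ 2 * t₀) (t : ℕ)
    (hp0 : 0 ≤ p) (hp1 : p ≤ 1) (hp : p * (D - 1) ≤ 1 + (β₀ - κ * t))
    (s s' : ℕ) (hs' : (s' : ℝ) = s + D - 1) :
    (1 - p) * potential D θ β₀ κ t₀ T (t + 1) s + p * potential D θ β₀ κ t₀ T (t + 1) s'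
      ≤ potential D θ β₀ κ t₀ T t (s + 1) := by
  have hθD' : θ * D ≤ 1 := by nlinarith
  rcases lt_or_ge t t₀ with ht | ht
  · have hκt : 0 ≤ κ * t := by positivity
    have h1 := earlyPotential_step hD hθ hθD hβ hp0 hp1 (by linarith) t₀ t s s' hs'
    have hle : ∀ r, potential D θ β₀ κ t₀ T (t + 1) r
        ≤ Real.exp (lateExponent D θ β₀ κ T t₀) * earlyPotential D θ t₀ (t + 1) r := by
      intro r
      unfold potential
      split_ifs with h
      · exact le_rfl
      · have h2 : t + 1 = t₀ := by omega
        rw [h2, add_comm, Real.exp_add]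
        exact mul_le_mul_of_nonneg_left (exp_le_earlyPotential hθ ht₀ r) (Real.exp_pos _).le
    have h2 : potential D θ β₀ κ t₀ T t (s + 1)
        = Real.exp (lateExponent D θ β₀ κ T t₀) * earlyPotential D θ t₀ t (s + 1) := by
      rw [potential, if_pos ht]
    rw [h2]
    calc _ ≤ (1 - p) * (Real.exp (lateExponent D θ β₀ κ T t₀) * earlyPotential D θ t₀ (t + 1) s)
          + p * (Real.exp (lateExponent D θ β₀ κ T t₀) * earlyPotential D θ t₀ (t + 1) s') :=
          add_le_add (mul_le_mul_of_nonneg_left (hle s) (sub_nonneg.2 hp1))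
            (mul_le_mul_of_nonneg_left (hle s') hp0)
      _ = Real.exp (lateExponent D θ β₀ κ T t₀) * ((1 - p) * earlyPotential D θ t₀ (t + 1) s
          + p * earlyPotential D θ t₀ (t + 1) s') := by ring
      _ ≤ _ := mul_le_mul_of_nonneg_left h1 (Real.exp_pos _).le
  · have e1 := step_exp_le hD hθ hθD' hp0 hp1 hp
    unfold potential
    rw [if_neg (by omega), if_neg (by omega), if_neg (by omega)]
    set c := Real.exp (θ * ((s + 1 : ℕ) : ℝ) + lateExponent D θ β₀ κ T (t + 1)) with hc
    have f1 : Real.exp (θ * s + lateExponent D θ β₀ κ T (t + 1)) = c * Real.exp (-θ) := by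
      rw [hc, ← Real.exp_add]; congr 1; push_cast; ring
    have f2 : Real.exp (θ * s' + lateExponent D θ β₀ κ T (t + 1))
        = c * Real.exp (θ * (D - 2)) := by
      rw [hc, ← Real.exp_add, hs']; congr 1; push_cast; ring
    have f3 : Real.exp (θ * ((s + 1 : ℕ) : ℝ) + lateExponent D θ β₀ κ T t)
        = c * Real.exp (θ * (β₀ - κ * t) + D ^ 2 * θ ^ 2) := by
      rw [hc, ← Real.exp_add, ← lateExponent_step]; congr 1; ring
    rw [f1, f2, f3]
    have := mul_le_mul_of_nonneg_left e1 (Real.exp_pos (θ * ((s + 1 : ℕ) : ℝ)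
      + lateExponent D θ β₀ κ T (t + 1))).le
    rw [← hc] at this
    linarith

lemma one_le_potential {D θ β₀ κ : ℝ} (hθ : 0 ≤ θ) {t₀ T : ℕ} (h : t₀ ≤ T) (s : ℕ) :
    1 ≤ potential D θ β₀ κ t₀ T T s := by
  unfold potential
  rw [if_neg (by omega), lateExponent]
  refine Real.one_le_exp ?_
  have : 0 ≤ θ * s := by positivity
  simpa using this

/-- The initial value of the supermartingale is of order `θ`. -/
lemma potential_start_le {θ β₀ κ : ℝ} {d : ℕ} (hd : 3 ≤ d) (hθ : 0 ≤ θ)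
    (hθD : (d : ℝ) ^ 2 * θ ≤ 1 / 4) {t₀ T : ℕ} (ht₀ : 1 ≤ t₀)
    (ht₀' : 8 * (d : ℝ) ^ 4 * θ ^ 2 * t₀ ≤ 2) :
    potential d θ β₀ κ t₀ T 0 d
      ≤ Real.exp (lateExponent d θ β₀ κ T t₀) * (200 * (d : ℝ) ^ 3 * θ) := by
  have hD : (3 : ℝ) ≤ d := by exact_mod_cast hd
  unfold potential
  rw [if_pos (by omega)]
  refine mul_le_mul_of_nonneg_left ?_ (Real.exp_pos _).le
  unfold earlyPotential
  simp only [Nat.cast_zero, sub_zero, mul_zero, neg_zero, Real.exp_zero, one_mul]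
  set D : ℝ := (d : ℝ)
  have hθD' : θ * D ≤ 1 := by nlinarith
  have hθD0 : 0 ≤ θ * D := by positivity
  have h1 : Real.exp (8 * D ^ 4 * θ ^ 2 * t₀) ≤ 8 := by
    calc _ ≤ Real.exp 2 := Real.exp_le_exp.2 ht₀'
      _ = Real.exp 1 ^ 2 := by rw [← Real.exp_nat_mul]; norm_num
      _ ≤ 2.7182818286 ^ 2 := pow_le_pow_left₀ (Real.exp_pos _).le Real.exp_one_lt_d9.le 2
      _ ≤ 8 := by norm_num
  have h2 : Real.exp (θ * D) ≤ 1 + 2 * (θ * D) := by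
    have := exp_le_one_add_add_sq (x := θ * D) (by rw [abs_of_nonneg hθD0]; exact hθD')
    nlinarith
  have h3 := Real.add_one_le_exp (-(16 * D ^ 2 * θ) * D)
  have h4 : θ * D ≤ θ * D ^ 3 := by
    have : D ≤ D ^ 3 := by nlinarith [sq_nonneg D]
    exact mul_le_mul_of_nonneg_left this hθ
  have h5 : 0 ≤ Real.exp (θ * D) - Real.exp (-(16 * D ^ 2 * θ) * D) := by
    have : Real.exp (-(16 * D ^ 2 * θ) * D) ≤ Real.exp (θ * D) := Real.exp_le_exp.2 (by
      have : 0 ≤ 16 * D ^ 2 * θ * D := by positivity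
      linarith)
    linarith
  have h6 := mul_le_mul_of_nonneg_right h1 h5
  linarith

end Walk

/-! ### The survival probability of the exploration -/

section Upper

variable {V : Type*} [Fintype V] [DecidableEq V] {d : ℕ}

/-- The depletion estimate: after `t` steps of a surviving exploration about `t / (d - 1)` vertices
are explored, and an active half-edge is matched with probability at most
`(1 + β₀ - κ t) / (d - 1)`. -/
lemma match_prob_le {n K T : ℕ} (hd : 3 ≤ d) (hn : 1 ≤ n) (hT : T ≤ n) {ε : ℝ} (hε : 0 ≤ ε)
    (hε1 : 2 * ε + 4 / n ≤ 1) (hK : 2 * (K : ℝ) * (d - 1) ≤ d * n * (1 + ε)) :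
    ∀ t < T, ∀ h k s : ℕ, 1 ≤ s → k ≤ K → h + t + K = d * n + k →
      s + t + (d - 1) * k ≤ d + (d - 1) * K → 2 * (k : ℝ) * (d - 1)
        ≤ (1 + (2 * ε + 4 / n - ((d : ℝ) - 2) / (d * (d - 1)) / n * t)) * h := by
  intro t ht h k s hs hk hh hst
  have hD : (3 : ℝ) ≤ d := by exact_mod_cast hd
  have hnR : (1 : ℝ) ≤ n := by exact_mod_cast hn
  have htn : (t : ℝ) ≤ n := by exact_mod_cast (by omega : t ≤ n)
  have ht0 : (0 : ℝ) ≤ t := Nat.cast_nonneg _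
  obtain ⟨m, rfl⟩ : ∃ m, K = k + m := ⟨K - k, by omega⟩
  have hhR : (h : ℝ) = d * n - t - m := by
    have : (h : ℝ) + t + (k + m) = d * n + k := by exact_mod_cast hh
    linarith
  obtain ⟨e, rfl⟩ : ∃ e, d = e + 1 := ⟨d - 1, by omega⟩
  have hm : (t : ℝ) ≤ e * (m + 1) := by
    have h1 : s + t + (e + 1 - 1) * k ≤ e + 1 + (e + 1 - 1) * (k + m) := hst
    simp only [Nat.add_sub_cancel] at h1
    have h2 : t ≤ e * (m + 1) := by nlinarith
    exact_mod_cast h2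
  set D : ℝ := ((e + 1 : ℕ) : ℝ) with hDdef
  have he : (e : ℝ) = D - 1 := by rw [hDdef]; push_cast; ring
  rw [he] at hm
  set c : ℝ := (D - 2) / (D * (D - 1)) with hc
  have hc0 : 0 ≤ c := div_nonneg (by linarith) (mul_nonneg (by linarith) (by linarith))
  have hc1 : c ≤ 1 := (div_le_one (mul_pos (by linarith) (by linarith))).2 (by nlinarith)
  have hcD : c * D = (D - 2) / (D - 1) := by
    rw [hc]; field_simp
  set β : ℝ := 2 * ε + 4 / n - c / n * t with hβ
  have hβ1 : β ≤ 1 := by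
    have : 0 ≤ c / n * t := by positivity
    linarith
  rw [hhR]
  push_cast at hK
  -- the right side minus the left side is increasing in `m`, so that the smallest `m` is critical
  set m₀ : ℝ := t / (D - 1) - 1 with hm₀
  have hm₀m : m₀ ≤ m := by
    rw [hm₀, sub_le_iff_le_add, div_le_iff₀ (by linarith)]; linarith
  have hcrit : D * n * ε - 2 * m₀ * (D - 1) ≤ β * (D * n) - (1 + β) * (t + m₀) := by
    have hm₀' : m₀ * (D - 1) = t - (D - 1) := by
      have : D - 1 ≠ 0 := by linarith
      rw [hm₀]; field_simp
    have ht2 : t / (D - 1) ≤ t / 2 := by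
      apply div_le_div_of_nonneg_left ht0 (by norm_num) (by linarith)
    have ht3 : 0 ≤ t / (D - 1) := div_nonneg ht0 (by linarith)
    set H := D * n - t - m₀ with hH
    have hH1 : D * n / 2 ≤ H := by
      have : 3 * n ≤ D * n := mul_le_mul_of_nonneg_right hD (by linarith)
      rw [hH, hm₀]; linarith
    have hH2 : H ≤ D * n + 1 := by rw [hH, hm₀]; linarith
    have h1 : (2 * ε + 4 / n) * (D * n / 2) ≤ (2 * ε + 4 / n) * H :=
      mul_le_mul_of_nonneg_left hH1 (by positivity)
    have h2 : c / n * t * H ≤ c / n * t * (D * n + 1) :=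
      mul_le_mul_of_nonneg_left hH2 (by positivity)
    have h3 : (2 * ε + 4 / n) * (D * n / 2) = D * n * ε + 2 * D := by field_simp; ring
    have h4 : c / n * t * (D * n + 1) = c * D * t + c * (t / n) := by field_simp
    have h5 : c * (t / n) ≤ 1 := by
      have : t / (n : ℝ) ≤ 1 := (div_le_one (by linarith)).2 htn
      have h6 : (0 : ℝ) ≤ t / n := by positivity
      nlinarith
    have h7 : c * D * t = t - t / (D - 1) := by
      rw [hcD]
      have : D - 1 ≠ 0 := by linarith
      field_simp
      ring
    have h8 : β * H = (2 * ε + 4 / n) * H - c / n * t * H := by rw [hβ]; ring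
    have h9 : β * (D * n) - (1 + β) * (t + m₀) = β * H - (t + m₀) := by rw [hH]; ring
    rw [h9, h8]
    have h10 : m₀ = t / (D - 1) - 1 := hm₀
    linarith
  have hmono : 0 ≤ (m - m₀) * (2 * (D - 1) - (1 + β)) :=
    mul_nonneg (by linarith) (by linarith)
  linarith

open scoped Classical in
/-- The probability that the exploration from a vertex survives `T` steps. -/
lemma card_survives_le {n K T t₀ : ℕ} (hV : Fintype.card V = n) (hd : 3 ≤ d) (hn : 1 ≤ n)
    (hT : T ≤ n) {ε θ : ℝ} (hε : 0 ≤ ε) (hθ : 0 ≤ θ) (hθD : (d : ℝ) ^ 2 * θ ≤ 1 / 4)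
    (hε1 : 2 * ε + 4 / n ≤ (d : ℝ) ^ 2 * θ)
    (hK : 2 * (K : ℝ) * (d - 1) ≤ d * n * (1 + ε)) (ht₀ : 1 ≤ 8 * (d : ℝ) ^ 4 * θ ^ 2 * t₀)
    (ht₀' : 8 * (d : ℝ) ^ 4 * θ ^ 2 * t₀ ≤ 2) (ht₀T : t₀ ≤ T) (v : V) :
    (((matchings (Finset.univ : Finset (V × Fin d)) K).filter
      fun m => Survives m T (halfEdges d {v}) {v}ᶜ).card : ℝ)
      ≤ (matchings (Finset.univ : Finset (V × Fin d)) K).card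
        * (Real.exp (lateExponent d θ (2 * ε + 4 / n) (((d : ℝ) - 2) / (d * (d - 1)) / n) T t₀)
          * (200 * (d : ℝ) ^ 3 * θ)) := by
  have hD : (3 : ℝ) ≤ d := by exact_mod_cast hd
  set κ := ((d : ℝ) - 2) / (d * (d - 1)) / n with hκ
  have hκ0 : 0 ≤ κ :=
    div_nonneg (div_nonneg (by linarith) (mul_nonneg (by linarith) (by linarith)))
      (Nat.cast_nonneg _)
  have ht₀1 : 1 ≤ t₀ := by
    rcases Nat.eq_zero_or_pos t₀ with rfl | h
    · norm_num at ht₀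
    · exact h
  have hA : (halfEdges d ({v} : Finset V)).card = d := by rw [card_halfEdges]; simp
  have huniv : halfEdges d {v} ∪ halfEdges d ({v}ᶜ : Finset V) = Finset.univ := by
    ext x; simp [em]
  have hU : ({v}ᶜ : Finset V).card + 1 = n := by
    rw [Finset.card_compl, Finset.card_singleton, hV]; omega
  have h := survives_le (V := V) (M := d * n) (K := K) (T := T) (by omega : 2 ≤ d)
    (potential d θ (2 * ε + 4 / n) κ t₀ T) (fun t => 2 * ε + 4 / n - κ * t)
    (one_le_potential hθ ht₀T) (potential_nonneg hθ t₀ T) (potential_mono hθ t₀ T)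
    (fun t _ s p hp0 hp1 hp => potential_step hD hθ hθD hε1 hκ0 ht₀ t hp0 hp1 hp s (s + d - 1)
      (by rw [Nat.cast_sub (by omega)]; push_cast; ring))
    (match_prob_le hd hn hT hε (by linarith) hK) T 0 (by omega) (halfEdges d {v}) {v}ᶜ K
    (by simp) le_rfl (by rw [hA, ← hU]; ring) (by rw [hA]; omega)
  rw [huniv, Finset.sum_boole, hA] at h
  exact h.trans (mul_le_mul_of_nonneg_left (potential_start_le hd hθ hθD ht₀1 ht₀')
    (Nat.cast_nonneg _))

end Upper

/-! ### Binomial tails -/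

section Binomial

/-- The binomial weights. -/
noncomputable def binWeight (N : ℕ) (p : ℝ) (k : ℕ) : ℝ := N.choose k * p ^ k * (1 - p) ^ (N - k)

lemma binWeight_nonneg {N : ℕ} {p : ℝ} (hp0 : 0 ≤ p) (hp1 : p ≤ 1) (k : ℕ) :
    0 ≤ binWeight N p k := by
  have : 0 ≤ 1 - p := by linarith
  unfold binWeight
  positivity

lemma sum_binWeight_mul_pow (N : ℕ) (p y : ℝ) :
    ∑ k ∈ Finset.range (N + 1), binWeight N p k * y ^ k = (p * y + (1 - p)) ^ N := by
  rw [add_pow]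
  refine Finset.sum_congr rfl fun k _ => ?_
  rw [binWeight, mul_pow]
  ring

lemma sum_binWeight (N : ℕ) (p : ℝ) : ∑ k ∈ Finset.range (N + 1), binWeight N p k = 1 := by
  have := sum_binWeight_mul_pow N p 1
  simpa using this

open scoped Classical in
/-- A two-sided Chernoff bound for the binomial distribution: `σ = 1` gives the upper tail and
`σ = -1` the lower tail. -/
lemma binomial_tail_le {N : ℕ} (hN : 1 ≤ N) {p : ℝ} (hp0 : 0 ≤ p) (hp1 : p ≤ 1) {x σ : ℝ}
    (hx0 : 0 ≤ x) (hx : x ≤ 2 * N) (hσ : |σ| = 1) :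
    ∑ k ∈ Finset.range (N + 1), binWeight N p k * (if x ≤ σ * (k - N * p) then 1 else 0)
      ≤ Real.exp (-(x ^ 2 / (4 * N))) := by
  have hNR : (0 : ℝ) < N := by exact_mod_cast hN
  set τ := x / (2 * N) with hτ
  have hτ0 : 0 ≤ τ := by positivity
  have hτ1 : τ ≤ 1 := (div_le_one (by positivity)).2 hx
  set θ := σ * τ with hθ
  have hθ1 : |θ| ≤ 1 := by rw [hθ, abs_mul, hσ, one_mul, abs_of_nonneg hτ0]; exact hτ1
  have hθ2 : θ ^ 2 = τ ^ 2 := by rw [← sq_abs, hθ, abs_mul, hσ, one_mul, sq_abs]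
  have h1 : ∀ k : ℕ, (if x ≤ σ * ((k : ℝ) - N * p) then (1 : ℝ) else 0)
      ≤ Real.exp (-(τ * x) - θ * (N * p)) * Real.exp θ ^ k := by
    intro k
    split_ifs with h
    · rw [← Real.exp_nat_mul, ← Real.exp_add]
      refine Real.one_le_exp ?_
      have := mul_le_mul_of_nonneg_left h hτ0
      rw [hθ]
      linarith
    · positivity
  have hbase : p * Real.exp θ + (1 - p) ≤ Real.exp (p * θ + θ ^ 2) := by
    have h2 := mul_le_mul_of_nonneg_left (exp_le_one_add_add_sq hθ1) hp0
    have h3 := Real.add_one_le_exp (p * θ + θ ^ 2)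
    have h4 := mul_le_mul_of_nonneg_right hp1 (sq_nonneg θ)
    linarith
  calc _ ≤ ∑ k ∈ Finset.range (N + 1), Real.exp (-(τ * x) - θ * (N * p))
        * (binWeight N p k * Real.exp θ ^ k) := by
        refine Finset.sum_le_sum fun k _ => ?_
        have := mul_le_mul_of_nonneg_left (h1 k) (binWeight_nonneg hp0 hp1 k (N := N))
        linarith
    _ = Real.exp (-(τ * x) - θ * (N * p)) * (p * Real.exp θ + (1 - p)) ^ N := by
        rw [← Finset.mul_sum, sum_binWeight_mul_pow]
    _ ≤ Real.exp (-(τ * x) - θ * (N * p)) * Real.exp (p * θ + θ ^ 2) ^ N := by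
        refine mul_le_mul_of_nonneg_left (pow_le_pow_left₀ ?_ hbase N) (Real.exp_pos _).le
        have := mul_nonneg hp0 (Real.exp_pos θ).le
        linarith
    _ = Real.exp (-(τ * x) + N * τ ^ 2) := by
        rw [← Real.exp_nat_mul, ← Real.exp_add, hθ2]; congr 1; ring
    _ = _ := by
        congr 1; rw [hτ]; field_simp; ring

open scoped Classical in
lemma sum_binWeight_mul_le {N : ℕ} (hN : 1 ≤ N) {p : ℝ} (hp0 : 0 ≤ p) (hp1 : p ≤ 1) {x σ Q : ℝ}
    (hx0 : 0 ≤ x) (hx : x ≤ 2 * N) (hσ : |σ| = 1) :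
    ∑ k ∈ Finset.range (N + 1), binWeight N p k * (Q + if x ≤ σ * (k - N * p) then 1 else 0)
      ≤ Q + Real.exp (-(x ^ 2 / (4 * N))) := by
  simp only [mul_add]
  rw [Finset.sum_add_distrib, ← Finset.sum_mul, sum_binWeight, one_mul]
  exact add_le_add_right (binomial_tail_le hN hp0 hp1 hx0 hx hσ) Q

end Binomial

/-! ### The largest component -/

section LargestComponent

lemma randomRegularPercolation_real_le_one (n d : ℕ) (p : unitInterval)
    (S : Set (SimpleGraph (Fin n))) : (randomRegularPercolation n d p).real S ≤ 1 := by
  classical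
  have hprob : ∀ G : SimpleGraph (Fin n), IsProbabilityMeasure (bondPercolation G p) := fun G => by
    unfold bondPercolation
    exact Measure.isProbabilityMeasure_map SimpleGraph.measurable_fromEdgeSet.aemeasurable
  rw [randomRegularPercolation_real, ← Finset.sum_div]
  refine div_le_one_of_le₀ ?_ (Nat.cast_nonneg _)
  refine le_trans (Finset.sum_le_card_nsmul _ _ 1 fun G _ => measureReal_le_one) ?_
  simp

lemma exists_largestComponent {n : ℕ} (hn : 1 ≤ n) (G : SimpleGraph (Fin n)) :
    ∃ c : G.ConnectedComponent, c.supp.ncard = largestComponent G := by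
  have : Nonempty G.ConnectedComponent := ⟨G.connectedComponentMk ⟨0, hn⟩⟩
  exact exists_eq_ciSup_of_finite

lemma le_largestComponent {n : ℕ} {G : SimpleGraph (Fin n)} (c : G.ConnectedComponent) :
    c.supp.ncard ≤ largestComponent G :=
  le_ciSup (f := fun c : G.ConnectedComponent => c.supp.ncard) (Set.finite_range _).bddAbove c

lemma largestComponent_le {n : ℕ} (hn : 1 ≤ n) (G : SimpleGraph (Fin n)) :
    largestComponent G ≤ n := by
  obtain ⟨c, hc⟩ := exists_largestComponent hn G
  rw [← hc]
  exact (Set.ncard_le_card _).trans (by simp)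

lemma one_le_largestComponent {n : ℕ} (hn : 1 ≤ n) (G : SimpleGraph (Fin n)) :
    1 ≤ largestComponent G := by
  refine le_trans ?_ (le_largestComponent (G.connectedComponentMk ⟨0, hn⟩))
  exact (Set.ncard_pos (Set.toFinite _)).2 ⟨⟨0, hn⟩, rfl⟩

open scoped Classical in
/-- The first moment estimate: a component with at least `X` vertices contains at least `X` vertices
whose exploration survives. -/
lemma mul_card_large_le {n d K T : ℕ} (hn : 1 ≤ n) {X : ℝ} (hT : (T : ℝ) + 1 < X) :
    X * ((matchings (Finset.univ : Finset (Fin n × Fin d)) K).filter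
      fun m => X ≤ (largestComponent (matchingGraph m) : ℝ)).card
      ≤ ∑ v : Fin n, (((matchings (Finset.univ : Finset (Fin n × Fin d)) K).filter
        fun m => Survives m T (halfEdges d {v}) {v}ᶜ).card : ℝ) := by
  set Q := matchings (Finset.univ : Finset (Fin n × Fin d)) K
  have h1 : ∀ m ∈ Q, (if X ≤ (largestComponent (matchingGraph m) : ℝ) then X else 0)
      ≤ ∑ v : Fin n, if Survives m T (halfEdges d {v}) {v}ᶜ then (1 : ℝ) else 0 := by
    intro m hm
    split_ifs with h
    · obtain ⟨c, hc⟩ := exists_largestComponent hn (matchingGraph m)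
      rw [← hc] at h
      rw [Finset.sum_boole]
      refine h.trans ?_
      have hsub : c.supp ⊆ ((Finset.univ.filter
          fun v => Survives m T (halfEdges d {v}) {v}ᶜ : Finset (Fin n)) : Set (Fin n)) := by
        intro v hv
        simp only [Finset.coe_filter, Finset.mem_univ, true_and, Set.mem_ofPred_eq]
        rw [SimpleGraph.ConnectedComponent.mem_supp_iff] at hv
        refine survives_of_lt_component (mem_matchings.1 hm).1 ?_
        rw [hv]
        have : (T : ℝ) + 1 < c.supp.ncard := hT.trans_le h
        exact_mod_cast this
      have := Set.ncard_le_ncard hsub (Finset.finite_toSet _)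
      rw [Set.ncard_coe_finset] at this
      exact_mod_cast this
    · exact Finset.sum_nonneg fun v _ => by split_ifs <;> norm_num
  have h2 := Finset.sum_le_sum h1
  rw [Finset.sum_comm, ← Finset.sum_filter, Finset.sum_const, nsmul_eq_mul, mul_comm] at h2
  simpa only [Finset.sum_boole] using h2

end LargestComponent

/-! ### The upper tail for uniform matchings -/

section UpperTail

/-- The coefficient of the downward drift that the depletion of the unexplored vertices causes. -/
noncomputable def depletion (d : ℕ) : ℝ := ((d : ℝ) - 2) / (d * (d - 1))

lemma depletion_pos {d : ℕ} (hd : 3 ≤ d) : 0 < depletion d := by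
  have : (3 : ℝ) ≤ d := by exact_mod_cast hd
  exact div_pos (by linarith) (mul_pos (by linarith) (by linarith))

lemma depletion_le_one {d : ℕ} (hd : 3 ≤ d) : depletion d ≤ 1 := by
  have : (3 : ℝ) ≤ d := by exact_mod_cast hd
  exact (div_le_one (mul_pos (by linarith) (by linarith))).2 (by nlinarith)

/-- The exponent `θ` of the supermartingale is `tilt d * A / n ^ (1 / 3)`. -/
noncomputable def tilt (d : ℕ) : ℝ := depletion d / (128 * d ^ 2)

lemma tilt_pos {d : ℕ} (hd : 3 ≤ d) : 0 < tilt d := by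
  have : (3 : ℝ) ≤ d := by exact_mod_cast hd
  exact div_pos (depletion_pos hd) (by positivity)

lemma sq_mul_tilt {d : ℕ} (hd : 3 ≤ d) : (d : ℝ) ^ 2 * tilt d = depletion d / 128 := by
  have : (3 : ℝ) ≤ d := by exact_mod_cast hd
  unfold tilt
  field_simp

/-- With the drift parameter at most `|lam| + d² tilt(d) A / 4`, the exponent of the late
supermartingale is at most `-c A³`. -/
lemma lateExponent_le {d : ℕ} (hd : 3 ≤ d) {A ν β₀ : ℝ} (hA : 32 ≤ A) (hν : 1 ≤ ν) {T t₀ : ℕ}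
    (hT : A * ν ^ 2 / 8 ≤ T) (ht₀T : (t₀ : ℝ) ≤ T / 2)
    (hβ : β₀ ≤ (d : ℝ) ^ 2 * (tilt d * A / ν)) :
    lateExponent d (tilt d * A / ν) β₀ (depletion d / ν ^ 3) T t₀
      ≤ -(tilt d * depletion d / 512 * A ^ 3) := by
  have ha := tilt_pos hd
  have hc := depletion_pos hd
  have hν0 : 0 < ν := by linarith
  set θ := tilt d * A / ν with hθ
  set c := depletion d with hcdef
  have hθ0 : 0 ≤ θ := by positivity
  have hdθ : (d : ℝ) ^ 2 * θ = c * A / (128 * ν) := by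
    rw [hθ, mul_div_assoc', ← mul_assoc, sq_mul_tilt hd, ← hcdef]; field_simp
  have hT4 : (4 : ℝ) ≤ T := by nlinarith [one_le_pow₀ hν (n := 2)]
  have ht₀0 : (0 : ℝ) ≤ t₀ := Nat.cast_nonneg _
  -- the contribution of the variance and of the drift
  have h1 : (T - t₀ : ℝ) * (θ * β₀ + (d : ℝ) ^ 2 * θ ^ 2) ≤ T * (θ * (c * A / (64 * ν))) := by
    have h2 : θ * β₀ + (d : ℝ) ^ 2 * θ ^ 2 ≤ θ * (c * A / (64 * ν)) := by
      have h3 := mul_le_mul_of_nonneg_left hβ hθ0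
      calc _ ≤ θ * ((d : ℝ) ^ 2 * θ) + θ * ((d : ℝ) ^ 2 * θ) := by nlinarith
        _ = _ := by rw [hdθ]; field_simp; ring
    have h4 : 0 ≤ θ * (c * A / (64 * ν)) := by positivity
    calc _ ≤ (T - t₀ : ℝ) * (θ * (c * A / (64 * ν))) :=
          mul_le_mul_of_nonneg_left h2 (by linarith)
      _ ≤ _ := mul_le_mul_of_nonneg_right (by linarith) h4
  -- the contribution of the depletion
  have h5 : T * (θ * (c * A / (32 * ν)))
      ≤ θ * (c / ν ^ 3) / 2 * (T * (T - 1) - t₀ * (t₀ - 1)) := by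
    have h6 : (T : ℝ) ^ 2 / 2 ≤ T * (T - 1) - t₀ * (t₀ - 1) := by nlinarith
    have h7 : A * ν ^ 2 / 8 * T ≤ (T : ℝ) ^ 2 := by
      rw [sq (T : ℝ)]; exact mul_le_mul_of_nonneg_right hT (Nat.cast_nonneg _)
    calc T * (θ * (c * A / (32 * ν))) = θ * (c / ν ^ 3) / 2 * ((A * ν ^ 2 / 8 * T) / 2) := by
          field_simp; ring
      _ ≤ θ * (c / ν ^ 3) / 2 * ((T : ℝ) ^ 2 / 2) := by gcongr
      _ ≤ _ := by gcongr
  have h8 : tilt d * c / 512 * A ^ 3 ≤ T * (θ * (c * A / (64 * ν))) := by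
    calc tilt d * c / 512 * A ^ 3 = (A * ν ^ 2 / 8) * (θ * (c * A / (64 * ν))) := by
          rw [hθ]; field_simp; ring
      _ ≤ _ := by gcongr
  have h9 : T * (θ * (c * A / (32 * ν))) = 2 * (T * (θ * (c * A / (64 * ν)))) := by
    field_simp; ring
  unfold lateExponent
  linarith

open scoped Classical in
/-- The upper tail for a uniform matching of the half-edges, when the number `K` of pairs is not
much larger than its average. -/
lemma card_large_component_le {n d K : ℕ} (hd : 3 ≤ d) {lam A ν : ℝ} (hν : 2 ≤ ν)
    (hνn : ν ^ 3 = n) (hA : 32 ≤ A) (hA1 : 4 * |lam| + 8 ≤ (d : ℝ) ^ 2 * tilt d * A)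
    (hA2 : 4 ≤ (d : ℝ) ^ 4 * tilt d ^ 2 * A) (hAν : A ≤ ν)
    (hK : 2 * (K : ℝ) * (d - 1)
      ≤ d * n * (1 + (|lam| + (d : ℝ) ^ 2 * tilt d / 4 * A) / ν)) :
    (((matchings (Finset.univ : Finset (Fin n × Fin d)) K).filter
      fun m => A * ν ^ 2 ≤ (largestComponent (matchingGraph m) : ℝ)).card : ℝ)
      ≤ (matchings (Finset.univ : Finset (Fin n × Fin d)) K).card
        * (200 * (d : ℝ) ^ 3 * tilt d * Real.exp (-(tilt d * depletion d / 512 * A ^ 3))) := by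
  have hD : (3 : ℝ) ≤ d := by exact_mod_cast hd
  have ha := tilt_pos hd
  have hc := depletion_pos hd
  have hc1 := depletion_le_one hd
  have hda := sq_mul_tilt hd
  have hν0 : 0 < ν := by linarith
  have hn : 1 ≤ n := by
    have : (0 : ℝ) < n := by rw [← hνn]; positivity
    exact_mod_cast this
  set θ := tilt d * A / ν with hθ
  have hθ0 : 0 < θ := by positivity
  have hAν' : A / ν ≤ 1 := (div_le_one hν0).2 hAν
  have hAν0 : 0 ≤ A / ν := by positivity
  have hdθ : (d : ℝ) ^ 2 * θ = depletion d / 128 * (A / ν) := by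
    rw [hθ, ← hda]; ring
  have hdθ1 : (d : ℝ) ^ 2 * θ ≤ 1 / 4 := by
    rw [hdθ]; nlinarith
  set ε := (|lam| + (d : ℝ) ^ 2 * tilt d / 4 * A) / ν with hε
  have hε0 : 0 ≤ ε := by positivity
  have hε1 : 2 * ε + 4 / n ≤ (d : ℝ) ^ 2 * θ := by
    have h1 : (4 : ℝ) / n ≤ 4 / ν := by
      rw [← hνn]
      exact div_le_div_of_nonneg_left (by norm_num) hν0 (le_self_pow₀ (by linarith) (by norm_num))
    have h2 : 2 * ε + 4 / ν = (2 * |lam| + 4 + (d : ℝ) ^ 2 * tilt d * A / 2) / ν := by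
      rw [hε]; field_simp; ring
    have h3 : (d : ℝ) ^ 2 * θ = ((d : ℝ) ^ 2 * tilt d * A) / ν := by rw [hθ]; ring
    rw [h3]
    calc _ ≤ 2 * ε + 4 / ν := by linarith
      _ = _ := h2
      _ ≤ _ := by gcongr; linarith
  set ρ := 8 * (d : ℝ) ^ 4 * θ ^ 2 with hρ
  have hρ0 : 0 < ρ := by positivity
  have hρ1 : ρ ≤ 1 := by
    have : ρ = 8 * ((d : ℝ) ^ 2 * θ) ^ 2 := by rw [hρ]; ring
    have h0 : 0 ≤ (d : ℝ) ^ 2 * θ := by positivity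
    rw [this]; nlinarith
  set t₀ := ⌈1 / ρ⌉₊ with ht₀
  have ht₀1 : 1 ≤ ρ * t₀ := by
    have := Nat.le_ceil (1 / ρ)
    rw [div_le_iff₀ hρ0] at this
    linarith
  have ht₀2' : (t₀ : ℝ) ≤ 1 / ρ + 1 := (Nat.ceil_lt_add_one (by positivity)).le
  have ht₀2 : ρ * t₀ ≤ 2 := by
    calc ρ * t₀ ≤ ρ * (1 / ρ + 1) := by gcongr
      _ = 1 + ρ := by field_simp
      _ ≤ 2 := by linarith
  set T := ⌈A * ν ^ 2 / 8⌉₊ with hT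
  have hT1 : A * ν ^ 2 / 8 ≤ T := Nat.le_ceil _
  have hT2 : (T : ℝ) ≤ A * ν ^ 2 / 8 + 1 := (Nat.ceil_lt_add_one (by positivity)).le
  have hν2 : 4 ≤ ν ^ 2 := by nlinarith
  have hAν2 : 32 * 4 ≤ A * ν ^ 2 := mul_le_mul hA hν2 (by norm_num) (by linarith)
  have ht₀T : (t₀ : ℝ) ≤ T / 2 := by
    have h1 : (t₀ : ℝ) ≤ 2 / ρ := by rw [le_div_iff₀ hρ0]; linarith
    have h2 : 2 / ρ ≤ A * ν ^ 2 / 16 := by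
      rw [div_le_iff₀ hρ0]
      have h3 : A * ν ^ 2 / 16 * ρ = ((d : ℝ) ^ 4 * tilt d ^ 2 * A) * A ^ 2 / 2 := by
        rw [hρ, hθ]; field_simp; ring
      have h4 : (32 : ℝ) ^ 2 ≤ A ^ 2 := pow_le_pow_left₀ (by norm_num) hA 2
      have h5 := mul_le_mul hA2 h4 (by norm_num) (by linarith)
      linarith
    linarith
  have hTn : T ≤ n := by
    have : (T : ℝ) ≤ n := by
      rw [← hνn]
      have h1 : A * ν ^ 2 ≤ ν * ν ^ 2 := mul_le_mul_of_nonneg_right hAν (sq_nonneg ν)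
      have h2 : ν * ν ^ 2 = ν ^ 3 := by ring
      linarith
    exact_mod_cast this
  have ht₀T' : t₀ ≤ T := by
    have h0 : (0 : ℝ) ≤ T := Nat.cast_nonneg _
    exact_mod_cast (by linarith : (t₀ : ℝ) ≤ T)
  set W := (matchings (Finset.univ : Finset (Fin n × Fin d)) K).card
  have hsurv := fun v : Fin n => card_survives_le (Fintype.card_fin n) hd hn hTn hε0 hθ0.le hdθ1 hε1
    hK ht₀1 ht₀2 ht₀T' v
  have hlate := lateExponent_le hd hA (by linarith) hT1 ht₀T hε1
  have hdep : ((d : ℝ) - 2) / (d * (d - 1)) / n = depletion d / ν ^ 3 := by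
    rw [hνn]; rfl
  rw [hdep] at hsurv
  have hmul := mul_card_large_le (d := d) (K := K) hn (X := A * ν ^ 2) (T := T) (by linarith)
  have hX : 0 < A * ν ^ 2 := by linarith
  refine le_of_mul_le_mul_left (hmul.trans ?_) hX
  refine le_trans (Finset.sum_le_sum fun v _ => hsurv v) ?_
  rw [Finset.sum_const, Finset.card_univ, Fintype.card_fin, nsmul_eq_mul, ← hνn]
  have h1 := Real.exp_le_exp.2 hlate
  rw [← hνn] at h1
  have hW0 : (0 : ℝ) ≤ W := Nat.cast_nonneg _
  refine le_trans (mul_le_mul_of_nonneg_left (mul_le_mul_of_nonneg_left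
    (mul_le_mul_of_nonneg_right h1 (by positivity)) hW0) (by positivity)) (le_of_eq ?_)
  generalize Real.exp (-(tilt d * depletion d / 512 * A ^ 3)) = E
  have h2 : ν ^ 3 * θ = A * ν ^ 2 * tilt d := by rw [hθ]; field_simp
  linear_combination (W * (E * (200 * (d : ℝ) ^ 3))) * h2

end UpperTail

/-! ### The lower tail for uniform matchings -/

section LowerTail

/-- The drift bound for a uniform matching with not much fewer pairs than on average. -/
lemma driftBound {n d K J : ℕ} (hd : 3 ≤ d) {L ν : ℝ} (hν : 0 < ν) (hνn : ν ^ 3 = n)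
    (hνd : 12 * d ≤ ν) (hJ : (J : ℝ) ≤ 3 * d * ν ^ 2)
    (hK : (d : ℝ) * n * (1 - L / ν) ≤ 2 * (K : ℝ) * (d - 1)) :
    DriftBound d (d * n) K J ((L + 12 * (d : ℝ) ^ 2) / ν) := by
  intro j h k s hj hhM hMh hKk hs hsh hsd h2k p q hp hq hp0 hp1 hq0 hq1
  have hD : (3 : ℝ) ≤ d := by exact_mod_cast hd
  have hjJ : (j : ℝ) + 1 ≤ J := by exact_mod_cast hj
  have hj0 : (0 : ℝ) ≤ j := Nat.cast_nonneg _
  have hhMR : (h : ℝ) ≤ d * n := by exact_mod_cast hhM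
  have hMhR : (d : ℝ) * n ≤ h + 2 * j := by exact_mod_cast hMh
  have hKkR : (K : ℝ) ≤ k + j := by exact_mod_cast hKk
  have hsR : (s : ℝ) ≤ d * (j + 1) := by exact_mod_cast hsd
  have hs1 : (1 : ℝ) ≤ s := by exact_mod_cast hs
  have hshR : (s : ℝ) ≤ h := by exact_mod_cast hsh
  have hn0 : (0 : ℝ) < n := by rw [← hνn]; positivity
  have hJn : 4 * (J : ℝ) ≤ d * n := by
    have : 12 * (d : ℝ) * ν ^ 2 ≤ d * n := by
      rw [← hνn]
      calc 12 * (d : ℝ) * ν ^ 2 ≤ ν * ν ^ 2 := by gcongr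
        _ = 1 * ν ^ 3 := by ring
        _ ≤ d * ν ^ 3 := by gcongr; linarith
    linarith
  have hh : (d : ℝ) * n / 2 ≤ h := by linarith
  have hh0 : (0 : ℝ) < h := by linarith [mul_pos (by linarith : (0 : ℝ) < d) hn0]
  -- the probability that the half-edge is matched
  have h1 : 1 - L / ν - 6 * d ^ 2 / ν ≤ p * (d - 1) := by
    have h2 : 1 - L / ν - 2 * J * (d - 1) / (d * n) ≤ p * (d - 1) := by
      have h3 : 2 * (k : ℝ) * (d - 1) / (d * n) ≤ p * (d - 1) := by
        rw [hp, div_mul_eq_mul_div]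
        exact div_le_div_of_nonneg_left (mul_nonneg (by positivity) (by linarith)) hh0 hhMR
      refine le_trans ?_ h3
      rw [le_div_iff₀ (by positivity), sub_mul, div_mul_cancel₀ _ (by positivity)]
      have h4 : 2 * (K : ℝ) * (d - 1) ≤ 2 * (k + j) * (d - 1) := by
        have := mul_le_mul_of_nonneg_right hKkR (by linarith : (0 : ℝ) ≤ d - 1)
        linarith
      have h5 : 2 * (j : ℝ) * (d - 1) ≤ 2 * J * (d - 1) := by
        have := mul_le_mul_of_nonneg_right (by linarith : (j : ℝ) ≤ J)
          (by linarith : (0 : ℝ) ≤ d - 1)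
        linarith
      linarith
    have h6 : 2 * (J : ℝ) * (d - 1) / (d * n) ≤ 6 * d ^ 2 / ν := by
      rw [div_le_div_iff₀ (by positivity) hν, ← hνn]
      have h7 : (J : ℝ) * (d - 1) ≤ 3 * d * ν ^ 2 * d :=
        mul_le_mul hJ (by linarith) (by linarith) (by positivity)
      have h8 : (J : ℝ) * (d - 1) * ν ≤ 3 * d * ν ^ 2 * d * ν := by gcongr
      have h9 : 6 * (d : ℝ) ^ 2 * (1 * ν ^ 3) ≤ 6 * d ^ 2 * (d * ν ^ 3) := by
        gcongr; linarith
      linarith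
    linarith
  -- the probability that the partner is active
  have h10 : q ≤ 6 * d / ν := by
    have h11 : q ≤ s / h := by
      rw [le_div_iff₀ hh0]
      have : q * h = s - 1 + q := by linarith
      linarith
    refine h11.trans ?_
    rw [div_le_div_iff₀ hh0 hν]
    have h12 : (s : ℝ) ≤ d * (3 * d * ν ^ 2) :=
      hsR.trans (mul_le_mul_of_nonneg_left (hjJ.trans hJ) (by linarith))
    have h13 : (s : ℝ) * ν ≤ d * (3 * d * ν ^ 2) * ν := by gcongr
    have h14 : 6 * (d : ℝ) * (d * n / 2) ≤ 6 * d * h := by gcongr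
    rw [← hνn] at h14
    linarith
  have h15 : p * q * d ≤ 6 * d ^ 2 / ν := by
    have : p * q ≤ 1 * (6 * d / ν) := mul_le_mul hp1 h10 hq0 zero_le_one
    calc p * q * d ≤ 1 * (6 * d / ν) * d := by gcongr
      _ = _ := by ring
  have h16 : (L + 12 * (d : ℝ) ^ 2) / ν = L / ν + 6 * d ^ 2 / ν + 6 * d ^ 2 / ν := by ring
  rw [h16]
  linarith

open scoped Classical in
/-- The lower tail for a uniform matching of the half-edges: with `x = δ ^ (1 / 4)`, a height of
order `x n ^ (1 / 3)` is reached within `n ^ (2 / 3)` steps, and from there the exploration survives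
for a number of steps of order `δ n ^ (2 / 3)`. -/
lemma card_small_component_le {n d K k₀ : ℕ} (hd : 3 ≤ d) {L ν x : ℝ} (hν : 0 < ν)
    (hνn : ν ^ 3 = n) (hνd : 12 * d ≤ ν) (hL : 0 ≤ L) (hx : 0 < x) (hx1 : x ≤ 1)
    (hxL : x * (8 * (L + 12 * (d : ℝ) ^ 2)) ≤ 1) (hxν : 1 ≤ x * ν)
    (hk₀ : (k₀ : ℝ) ≤ 2 * x ^ 4 * ν ^ 2)
    (hK : (d : ℝ) * n * (1 - L / ν) ≤ 2 * (K : ℝ) * (d - 1)) :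
    (((matchings (Finset.univ : Finset (Fin n × Fin d)) K).filter
      fun m => largestComponent (matchingGraph m) < k₀).card : ℝ)
      ≤ (matchings (Finset.univ : Finset (Fin n × Fin d)) K).card * (50 * (d : ℝ) ^ 3 * x ^ 2) := by
  have hD : (3 : ℝ) ≤ d := by exact_mod_cast hd
  have hν36 : 36 ≤ ν := by linarith
  have hν2 : 1 ≤ ν ^ 2 := one_le_pow₀ (by linarith)
  set T₁ := ⌈ν ^ 2⌉₊ with hT₁
  have hT₁1 : ν ^ 2 ≤ T₁ := Nat.le_ceil _
  have hT₁2 : (T₁ : ℝ) ≤ ν ^ 2 + 1 := (Nat.ceil_lt_add_one (by positivity)).le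
  set h₀ := ⌈x * ν⌉₊ with hh₀
  have hh₀1 : x * ν ≤ h₀ := Nat.le_ceil _
  have hh₀2 : (h₀ : ℝ) ≤ 2 * (x * ν) := by
    have := (Nat.ceil_lt_add_one (by positivity : 0 ≤ x * ν)).le
    linarith
  have hh₀3 : (1 : ℝ) ≤ h₀ := hxν.trans hh₀1
  set T₂ := d * k₀ with hT₂
  have hx2 : 0 ≤ x ^ 2 := sq_nonneg _
  have hx21 : x ^ 2 ≤ 1 := pow_le_one₀ hx.le hx1
  have hx41 : x ^ 4 ≤ x ^ 2 := pow_le_pow_of_le_one hx.le hx1 (by norm_num)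
  have hT₂R : (T₂ : ℝ) ≤ 2 * d * x ^ 4 * ν ^ 2 := by
    rw [hT₂]; push_cast
    calc (d : ℝ) * k₀ ≤ d * (2 * x ^ 4 * ν ^ 2) := by gcongr
      _ = _ := by ring
  have hJ : ((T₁ + T₂ : ℕ) : ℝ) ≤ 3 * d * ν ^ 2 := by
    push_cast
    have h1 : 2 * d * x ^ 4 * ν ^ 2 ≤ 2 * d * 1 * ν ^ 2 := by
      gcongr
      linarith
    have h2 := mul_le_mul_of_nonneg_right hD (sq_nonneg ν)
    linarith
  set Γ := L + 12 * (d : ℝ) ^ 2 with hΓ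
  have hΓ0 : 0 ≤ Γ := by positivity
  have hγh : 2 * (h₀ : ℝ) * (Γ / ν) ≤ 1 / 2 := by
    calc 2 * (h₀ : ℝ) * (Γ / ν) ≤ 2 * (2 * (x * ν)) * (Γ / ν) := by gcongr
      _ = x * (8 * Γ) / 2 := by field_simp; ring
      _ ≤ 1 / 2 := by linarith
  have hM : 2 * T₁ < d * n := by
    have : 2 * (T₁ : ℝ) < d * n := by
      rw [← hνn]
      have h1 : 36 * ν ^ 2 ≤ ν * ν ^ 2 := by gcongr
      have h2 : 3 * ν ^ 3 ≤ d * ν ^ 3 := by gcongr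
      have h3 : ν * ν ^ 2 = ν ^ 3 := by ring
      linarith
    exact_mod_cast this
  have hh₀N : 1 ≤ h₀ := by exact_mod_cast hh₀3
  have hT₁N : 1 ≤ T₁ := by exact_mod_cast hν2.trans hT₁1
  have huniv : (∅ : Finset (Fin n × Fin d)) ∪ halfEdges d Finset.univ = Finset.univ := by
    ext; simp
  have hfail := fails_le (V := Fin n) (d := d) (T₁ := T₁) (T₂ := T₂) (h₀ := h₀) hd
    (by positivity : 0 ≤ Γ / ν) hh₀N hT₁N (driftBound hd hν hνn hνd hJ hK) hγh hM T₁ 0 (by omega)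
    ∅ Finset.univ K (by simp) (by simp) (by simp) (by omega) (by simp) (by simp)
  rw [huniv, Finset.sum_boole] at hfail
  have hn : 1 ≤ n := by
    have : (0 : ℝ) < n := by rw [← hνn]; positivity
    exact_mod_cast this
  refine le_trans ?_ (hfail.trans (mul_le_mul_of_nonneg_left ?_ (Nat.cast_nonneg _)))
  · refine Nat.cast_le.2 (Finset.card_le_card fun m hm => ?_)
    obtain ⟨hm1, hm2⟩ := Finset.mem_filter.1 hm
    refine Finset.mem_filter.2 ⟨hm1, ?_⟩
    refine fails_of_small (mem_matchings.1 hm1).1 (fun c => ?_) ∅ _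
      ((matchingGraph m).connectedComponentMk ⟨0, hn⟩) (by simp) (by simp)
    have h1 := le_largestComponent c
    exact Nat.mul_lt_mul_of_pos_left (by omega) (by omega)
  · have h1 : (2 * (h₀ : ℝ) * (Γ / ν) + (d : ℝ) ^ 2) * T₂ / h₀ ^ 2 ≤ 4 * d ^ 3 * x ^ 2 := by
      rw [div_le_iff₀ (by positivity)]
      have h2 : (x * ν) ^ 2 ≤ (h₀ : ℝ) ^ 2 := by gcongr
      calc (2 * (h₀ : ℝ) * (Γ / ν) + (d : ℝ) ^ 2) * T₂
          ≤ (2 * (d : ℝ) ^ 2) * (2 * d * x ^ 4 * ν ^ 2) := by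
            have h3 : 2 * (h₀ : ℝ) * (Γ / ν) + (d : ℝ) ^ 2 ≤ 2 * (d : ℝ) ^ 2 := by
              nlinarith only [hγh, hD]
            exact mul_le_mul h3 hT₂R (Nat.cast_nonneg _) (by positivity)
        _ = 4 * d ^ 3 * x ^ 2 * (x * ν) ^ 2 := by ring
        _ ≤ _ := by gcongr
    have h3 : 2 * (((h₀ : ℝ) + d) ^ 2 - ((∅ : Finset (Fin n × Fin d)).card : ℝ) ^ 2
        + ((0 : ℕ) : ℝ) / 2) / T₁ ≤ 32 * d ^ 2 * x ^ 2 := by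
      rw [div_le_iff₀ (by linarith)]
      simp only [Finset.card_empty, Nat.cast_zero]
      have h4 : (h₀ : ℝ) + d ≤ 2 * d * (x * ν) := by
        have h5 := mul_le_mul_of_nonneg_left hxν (by linarith : (0 : ℝ) ≤ d)
        have h6 := mul_le_mul_of_nonneg_right (by linarith : (2 : ℝ) ≤ d)
          (by linarith : 0 ≤ x * ν)
        linarith
      calc 2 * (((h₀ : ℝ) + d) ^ 2 - 0 ^ 2 + 0 / 2) = 2 * ((h₀ : ℝ) + d) ^ 2 := by ring
        _ ≤ 2 * (2 * d * (x * ν)) ^ 2 := by gcongr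
        _ = 8 * d ^ 2 * x ^ 2 * ν ^ 2 := by ring
        _ ≤ 32 * d ^ 2 * x ^ 2 * ν ^ 2 := by
            have : 0 ≤ (d : ℝ) ^ 2 * x ^ 2 * ν ^ 2 := by positivity
            linarith
        _ ≤ _ := by gcongr
    have h5 : 32 * (d : ℝ) ^ 2 * x ^ 2 ≤ 46 * d ^ 3 * x ^ 2 := by
      have h6 := mul_le_mul_of_nonneg_right hD (by positivity : 0 ≤ (d : ℝ) ^ 2 * x ^ 2)
      have h7 : 0 ≤ (d : ℝ) ^ 2 * x ^ 2 := by positivity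
      linarith
    push_cast at h3 ⊢
    linarith

end LowerTail

/-! ### The critical window -/

section CriticalWindow

lemma simpleConst_nonneg (d : ℕ) : 0 ≤ simpleConst d := by
  unfold simpleConst
  positivity

open scoped Classical in
/-- It is enough to bound the probability of `S` for uniform matchings with `k` pairs where `k` is
in a one-sided window about its mean. -/
lemma real_le_add_binomial_tail {n d N : ℕ} (hN : 2 * N = n * d) (hN3 : 3 ≤ N)
    (hbig : 2 * (2 * (d * (2 + 2 * d)) + 12 * d ^ 2) ≤ n * d) (p : unitInterval)
    (S : Set (SimpleGraph (Fin n))) {x σ Q : ℝ} (hx0 : 0 ≤ x) (hx : x ≤ 2 * N) (hσ : |σ| = 1)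
    (hQ : 0 ≤ Q)
    (h : ∀ k : ℕ, σ * (k - N * p) < x →
      (((matchings (Finset.univ : Finset (Fin n × Fin d)) k).filter
        fun m => matchingGraph m ∈ S).card : ℝ)
        ≤ (matchings (Finset.univ : Finset (Fin n × Fin d)) k).card * Q) :
    (randomRegularPercolation n d p).real S
      ≤ simpleConst d * (Q + Real.exp (-(x ^ 2 / (4 * N)))) := by
  refine (randomRegularPercolation_le hN hN3 hbig p S
    (fun k => Q + if x ≤ σ * ((k : ℝ) - N * p) then 1 else 0) fun k _ => ?_).trans
    (mul_le_mul_of_nonneg_left (sum_binWeight_mul_le (by omega) p.2.1 p.2.2 hx0 hx hσ)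
      (simpleConst_nonneg d))
  split_ifs with hk
  · refine le_trans (Nat.cast_le.2 (Finset.card_filter_le _ _)) ?_
    exact le_mul_of_one_le_right (Nat.cast_nonneg _) (by linarith)
  · rw [add_zero]
    exact h k (not_le.1 hk)

lemma two_mul_mul_mean {n d N : ℕ} (hN : 2 * N = n * d) {p lam ν : ℝ}
    (hp : p * ((d : ℝ) - 1) = 1 + lam / ν) :
    2 * ((N : ℝ) * p) * (d - 1) = d * n * (1 + lam / ν) := by
  have h : 2 * (N : ℝ) = n * d := by exact_mod_cast hN
  rw [← hp]
  linear_combination p * ((d : ℝ) - 1) * h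

/-- The upper tail for `G(n, d, p)`, for large `n` and in the range `A ≤ n ^ (1 / 3)` in which the
event is possible. -/
lemma real_large_component_le {n d N : ℕ} (hd : 3 ≤ d) (hN : 2 * N = n * d) (hN3 : 3 ≤ N)
    (hbig : 2 * (2 * (d * (2 + 2 * d)) + 12 * d ^ 2) ≤ n * d) (p : unitInterval) {lam A ν : ℝ}
    (hν : 2 ≤ ν) (hνn : ν ^ 3 = n) (hp : (p : ℝ) * ((d : ℝ) - 1) = 1 + lam / ν)
    (hA : 32 ≤ A) (hA1 : 4 * |lam| + 8 ≤ (d : ℝ) ^ 2 * tilt d * A)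
    (hA2 : 4 ≤ (d : ℝ) ^ 4 * tilt d ^ 2 * A) (hAν : A ≤ ν) :
    (randomRegularPercolation n d p).real {G | A * ν ^ 2 ≤ (largestComponent G : ℝ)}
      ≤ simpleConst d * (200 * (d : ℝ) ^ 3 * tilt d
          * Real.exp (-(tilt d * depletion d / 512 * A ^ 3))
        + Real.exp (-(d * ((d : ℝ) ^ 2 * tilt d / 4) ^ 2 / (8 * (d - 1) ^ 2) * A ^ 3))) := by
  have hD : (3 : ℝ) ≤ d := by exact_mod_cast hd
  have hD1 : (0 : ℝ) < d - 1 := by linarith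
  have ha := tilt_pos hd
  have hν0 : 0 < ν := by linarith
  have hA0 : 0 < A := by linarith
  have hNR : 2 * (N : ℝ) = n * d := by exact_mod_cast hN
  have hmean := two_mul_mul_mean hN hp
  set η := (d : ℝ) ^ 2 * tilt d / 4 with hη
  have hη0 : 0 < η := by positivity
  have hη1 : η ≤ 1 := by
    rw [hη, sq_mul_tilt hd]
    linarith [depletion_le_one hd]
  set x := d * η * A * ν ^ 2 / (2 * (d - 1)) with hx
  have hx0 : 0 ≤ x := by positivity
  have hxd : 2 * x * (d - 1) = d * η * A * ν ^ 2 := by rw [hx]; field_simp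
  have hxN : x ≤ 2 * N := by
    rw [hNR, ← hνn, hx, div_le_iff₀ (by positivity)]
    calc d * η * A * ν ^ 2 ≤ d * 1 * ν * ν ^ 2 := by gcongr
      _ = ν ^ 3 * d * 1 := by ring
      _ ≤ ν ^ 3 * d * (2 * (d - 1)) := by gcongr; linarith
  set Q := 200 * (d : ℝ) ^ 3 * tilt d * Real.exp (-(tilt d * depletion d / 512 * A ^ 3)) with hQ
  have hQ0 : 0 ≤ Q := by positivity
  refine (real_le_add_binomial_tail hN hN3 hbig p _ hx0 hxN (abs_one (α := ℝ)) hQ0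
    fun k hk => ?_).trans ?_
  · have hlarge := card_large_component_le (K := k) hd hν hνn hA hA1 hA2 hAν
    convert hlarge ?_
    · exact Iff.rfl
    · have h1 : (k : ℝ) ≤ N * p + x := by linarith
      have h2 := mul_le_mul_of_nonneg_right h1 hD1.le
      have h3 : (d : ℝ) * n * (1 + (|lam| + η * A) / ν)
          = d * n * (1 + lam / ν) + d * n * ((|lam| - lam) / ν) + d * η * A * ν ^ 2 := by
        rw [← hνn]; field_simp; ring
      have h4 : 0 ≤ (d : ℝ) * n * ((|lam| - lam) / ν) :=
        mul_nonneg (by positivity) (div_nonneg (by linarith [le_abs_self lam]) hν0.le)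
      rw [h3]
      linarith
  · refine mul_le_mul_of_nonneg_left ?_ (simpleConst_nonneg d)
    refine add_le_add_right (Real.exp_le_exp.2 (neg_le_neg ?_)) Q
    have h1 : 4 * (N : ℝ) = 2 * d * ν ^ 3 := by rw [hνn]; linarith
    rw [h1]
    calc d * η ^ 2 / (8 * ((d : ℝ) - 1) ^ 2) * A ^ 3
        = d * η ^ 2 / (8 * ((d : ℝ) - 1) ^ 2) * A ^ 2 * A := by ring
      _ ≤ d * η ^ 2 / (8 * ((d : ℝ) - 1) ^ 2) * A ^ 2 * ν := by gcongr
      _ = x ^ 2 / (2 * d * ν ^ 3) := by rw [hx]; field_simp; ring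

/-- The lower tail for `G(n, d, p)`, for large `n` and with `x = δ ^ (1 / 4)`. -/
lemma real_small_component_le {n d N k₀ : ℕ} (hd : 3 ≤ d) (hN : 2 * N = n * d) (hN3 : 3 ≤ N)
    (hbig : 2 * (2 * (d * (2 + 2 * d)) + 12 * d ^ 2) ≤ n * d) (p : unitInterval) {lam ν x : ℝ}
    (hν : 12 * d ≤ ν) (hνn : ν ^ 3 = n) (hp : (p : ℝ) * ((d : ℝ) - 1) = 1 + lam / ν)
    (hx : 0 < x) (hx1 : x ≤ 1) (hxL : x * (8 * (|lam| + 2 + 12 * (d : ℝ) ^ 2)) ≤ 1)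
    (hxν : 1 ≤ x ^ 2 * ν) (hk₀ : (k₀ : ℝ) ≤ 2 * x ^ 4 * ν ^ 2) :
    (randomRegularPercolation n d p).real {G | largestComponent G < k₀}
      ≤ simpleConst d * (50 * (d : ℝ) ^ 3 * x ^ 2 + 2 * d * x ^ 2) := by
  have hD : (3 : ℝ) ≤ d := by exact_mod_cast hd
  have hD1 : (0 : ℝ) < d - 1 := by linarith
  have hν0 : 0 < ν := by linarith
  have hNR : 2 * (N : ℝ) = n * d := by exact_mod_cast hN
  have hmean := two_mul_mul_mean hN hp
  have hxN : ν ^ 2 ≤ 2 * N := by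
    rw [hNR, ← hνn]
    calc ν ^ 2 ≤ ν ^ 2 * (ν * d) :=
          le_mul_of_one_le_right (sq_nonneg ν) (by nlinarith only [hν, hD])
      _ = _ := by ring
  have hxν' : 1 ≤ x * ν := by
    refine hxν.trans (mul_le_mul_of_nonneg_right ?_ hν0.le)
    rw [sq]
    exact mul_le_of_le_one_left hx.le hx1
  set Q := 50 * (d : ℝ) ^ 3 * x ^ 2 with hQ
  have hQ0 : 0 ≤ Q := by positivity
  refine (real_le_add_binomial_tail hN hN3 hbig p _ (sq_nonneg ν) hxN (σ := -1) (by simp) hQ0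
    fun k hk => ?_).trans ?_
  · have hsmall := card_small_component_le (K := k) hd hν0 hνn hν (by positivity : 0 ≤ |lam| + 2)
      hx hx1 hxL hxν' hk₀
    convert hsmall ?_
    · exact Iff.rfl
    · have h1 : N * (p : ℝ) - ν ^ 2 ≤ k := by linarith
      have h2 := mul_le_mul_of_nonneg_right h1 hD1.le
      have h3 : (d : ℝ) * n * (1 - (|lam| + 2) / ν)
          = d * n * (1 + lam / ν) - d * n * ((|lam| + lam) / ν) - 2 * d * ν ^ 2 := by
        rw [← hνn]; field_simp; ring
      have h4 : 0 ≤ (d : ℝ) * n * ((|lam| + lam) / ν) :=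
        mul_nonneg (by positivity) (div_nonneg (by linarith [neg_abs_le lam]) hν0.le)
      have h5 := sq_nonneg ν
      rw [h3]
      linarith
  · refine mul_le_mul_of_nonneg_left ?_ (simpleConst_nonneg d)
    refine add_le_add_right ?_ Q
    have h1 : 4 * (N : ℝ) = 2 * d * ν ^ 3 := by rw [hνn]; linarith
    have h2 : (ν ^ 2) ^ 2 / (4 * N) = ν / (2 * d) := by rw [h1]; field_simp
    rw [h2, Real.exp_neg]
    have h3 : ν / (2 * d) ≤ Real.exp (ν / (2 * d)) := by
      linarith [Real.add_one_le_exp (ν / (2 * d))]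
    calc (Real.exp (ν / (2 * d)))⁻¹ ≤ (ν / (2 * d))⁻¹ := inv_anti₀ (by positivity) h3
      _ = 2 * d * (1 / ν) := by rw [inv_div]; ring
      _ ≤ 2 * d * x ^ 2 := by
        gcongr
        rwa [div_le_iff₀ hν0]

lemma exp_neg_mul_cube_le {c A : ℝ} (hc : 0 < c) (hA : 1 ≤ A) :
    Real.exp (-(c * A ^ 3)) ≤ 2 / c * (Real.exp (-(c / 2) * A ^ 3) / A) := by
  have hA0 : 0 < A := by linarith
  have h1 : Real.exp (-(c / 2) * A ^ 3) ≤ 2 / c / A := by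
    have h2 : c / 2 * A ≤ Real.exp (c / 2 * A ^ 3) := by
      have h3 : c / 2 * A ≤ c / 2 * A ^ 3 := by
        gcongr
        exact le_self_pow₀ hA (by norm_num)
      linarith [Real.add_one_le_exp (c / 2 * A ^ 3)]
    rw [neg_mul, Real.exp_neg]
    calc (Real.exp (c / 2 * A ^ 3))⁻¹ ≤ (c / 2 * A)⁻¹ := inv_anti₀ (by positivity) h2
      _ = _ := by field_simp
  calc Real.exp (-(c * A ^ 3))
      = Real.exp (-(c / 2) * A ^ 3) * Real.exp (-(c / 2) * A ^ 3) := by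
        rw [← Real.exp_add]; congr 1; ring
    _ ≤ 2 / c / A * Real.exp (-(c / 2) * A ^ 3) := by gcongr
    _ = _ := by ring

lemma cube_root_facts {n : ℕ} (hn : 1 ≤ n) :
    1 ≤ (n : ℝ) ^ (1 / 3 : ℝ) ∧ ((n : ℝ) ^ (1 / 3 : ℝ)) ^ 3 = n ∧
      (n : ℝ) ^ (2 / 3 : ℝ) = ((n : ℝ) ^ (1 / 3 : ℝ)) ^ 2 ∧
      (n : ℝ) ^ (-(1 / 3) : ℝ) = 1 / (n : ℝ) ^ (1 / 3 : ℝ) := by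
  have hn0 : (0 : ℝ) ≤ n := Nat.cast_nonneg _
  refine ⟨Real.one_le_rpow (by exact_mod_cast hn) (by norm_num), ?_, ?_, ?_⟩
  · rw [← Real.rpow_natCast, ← Real.rpow_mul hn0]
    norm_num
  · rw [← Real.rpow_natCast, ← Real.rpow_mul hn0]
    norm_num
  · rw [Real.rpow_neg hn0, one_div]
    norm_num

lemma upper_tail {d : ℕ} (hd : 3 ≤ d) (lam : ℝ) :
    ∃ c C : ℝ, 0 < c ∧
      ∀ A : ℝ, 0 < A → ∀ n : ℕ, d < n → Even (d * n) → ∀ p : unitInterval,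
        (p : ℝ) = (1 + lam * (n : ℝ) ^ (-(1 / 3) : ℝ)) / ((d : ℝ) - 1) →
        (randomRegularPercolation n d p).real
            {G | A * (n : ℝ) ^ (2 / 3 : ℝ) ≤ (largestComponent G : ℝ)}
          ≤ C * Real.exp (-c * A ^ 3) / A := by
  have hD : (3 : ℝ) ≤ d := by exact_mod_cast hd
  have hD1 : (0 : ℝ) < d - 1 := by linarith
  have ha := tilt_pos hd
  have hdep := depletion_pos hd
  obtain ⟨c₁, hc₁⟩ : ∃ c₁, c₁ = tilt d * depletion d / 512 := ⟨_, rfl⟩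
  obtain ⟨c₂, hc₂⟩ : ∃ c₂, c₂ = d * ((d : ℝ) ^ 2 * tilt d / 4) ^ 2 / (8 * (d - 1) ^ 2) := ⟨_, rfl⟩
  have hc₁0 : 0 < c₁ := by rw [hc₁]; positivity
  have hc₂0 : 0 < c₂ := by rw [hc₂]; positivity
  set c := min c₁ c₂ with hc
  have hc0 : 0 < c := lt_min hc₁0 hc₂0
  set B := simpleConst d * (200 * (d : ℝ) ^ 3 * tilt d + 1) with hB
  have hB0 : 0 ≤ B := mul_nonneg (simpleConst_nonneg d) (by positivity)
  set A₁ := 32 + (4 * |lam| + 8) / ((d : ℝ) ^ 2 * tilt d) + 4 / ((d : ℝ) ^ 4 * tilt d ^ 2)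
    + (8 + 32 * d) with hA₁
  have hA₁0 : 0 < A₁ := by positivity
  refine ⟨c / 2, B * (2 / c) + A₁ * Real.exp (c / 2 * A₁ ^ 3), by positivity, ?_⟩
  intro A hA n hdn heven p hp
  obtain ⟨hν1, hνn, hn2, hn3⟩ := cube_root_facts (by omega : 1 ≤ n)
  rw [hn2]
  rw [hn3] at hp
  set ν := (n : ℝ) ^ (1 / 3 : ℝ)
  clear_value ν
  have hp' : (p : ℝ) * ((d : ℝ) - 1) = 1 + lam / ν := by
    rw [hp, div_mul_cancel₀ _ hD1.ne']; ring
  rw [add_mul, add_div]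
  have hE1 : 0 ≤ B * (2 / c) * Real.exp (-(c / 2) * A ^ 3) / A := by positivity
  have hE2 : 0 ≤ A₁ * Real.exp (c / 2 * A₁ ^ 3) * Real.exp (-(c / 2) * A ^ 3) / A := by positivity
  rcases le_or_gt A A₁ with hAA | hAA
  · -- for bounded `A` the bound exceeds `1`
    refine (randomRegularPercolation_real_le_one n d p _).trans (le_add_of_nonneg_of_le hE1 ?_)
    rw [mul_assoc, ← Real.exp_add, le_div_iff₀ hA, one_mul]
    refine hAA.trans (le_mul_of_one_le_right hA₁0.le (Real.one_le_exp ?_))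
    have : c / 2 * A ^ 3 ≤ c / 2 * A₁ ^ 3 := by gcongr
    linarith
  rcases lt_or_ge ν A with hAν | hAν
  · -- a component cannot have more than `n` vertices
    have hempty : {G : SimpleGraph (Fin n) | A * ν ^ 2 ≤ (largestComponent G : ℝ)} = ∅ := by
      refine Set.eq_empty_of_forall_notMem fun G hG => ?_
      have h1 : A * ν ^ 2 ≤ (largestComponent G : ℝ) := hG
      have h2 : (largestComponent G : ℝ) ≤ n :=
        Nat.cast_le.2 (largestComponent_le (by omega) G)
      have h3 : ν * ν ^ 2 < A * ν ^ 2 := by gcongr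
      have h4 : ν * ν ^ 2 = ν ^ 3 := by ring
      linarith
    rw [hempty, measureReal_empty]
    exact add_nonneg hE1 hE2
  have hr1 : 0 ≤ (4 * |lam| + 8) / ((d : ℝ) ^ 2 * tilt d) := by positivity
  have hr2 : 0 ≤ 4 / ((d : ℝ) ^ 4 * tilt d ^ 2) := by positivity
  have hA32 : 32 ≤ A := by linarith
  have hA1 : 4 * |lam| + 8 ≤ (d : ℝ) ^ 2 * tilt d * A := by
    rw [← div_le_iff₀' (by positivity)]; linarith
  have hA2 : 4 ≤ (d : ℝ) ^ 4 * tilt d ^ 2 * A := by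
    rw [← div_le_iff₀' (by positivity)]; linarith
  have hnbig : 8 + 32 * d ≤ n := by
    have h1 : ν ≤ n := hνn ▸ le_self_pow₀ hν1 (by norm_num)
    have h2 : (8 + 32 * d : ℝ) ≤ n := by linarith
    exact_mod_cast h2
  obtain ⟨N, hN⟩ : ∃ N, 2 * N = n * d := by
    obtain ⟨N, hN⟩ := heven
    exact ⟨N, by rw [mul_comm n d]; omega⟩
  have hbig : 2 * (2 * (d * (2 + 2 * d)) + 12 * d ^ 2) ≤ n * d := by
    have := Nat.mul_le_mul_right d hnbig
    linarith
  have hN3 : 3 ≤ N := by nlinarith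
  refine (real_large_component_le hd hN hN3 hbig p (by linarith) hνn hp' hA32 hA1 hA2 hAν).trans
    (le_add_of_le_of_nonneg ?_ hE2)
  rw [← hc₁, ← hc₂]
  have h1 : Real.exp (-(c₁ * A ^ 3)) ≤ Real.exp (-(c * A ^ 3)) := by
    have : c ≤ c₁ := min_le_left _ _
    gcongr
  have h2 : Real.exp (-(c₂ * A ^ 3)) ≤ Real.exp (-(c * A ^ 3)) := by
    have : c ≤ c₂ := min_le_right _ _
    gcongr
  calc _ ≤ simpleConst d * (200 * (d : ℝ) ^ 3 * tilt d * Real.exp (-(c * A ^ 3))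
        + Real.exp (-(c * A ^ 3))) :=
        mul_le_mul_of_nonneg_left (add_le_add (mul_le_mul_of_nonneg_left h1 (by positivity)) h2)
          (simpleConst_nonneg d)
    _ = B * Real.exp (-(c * A ^ 3)) := by rw [hB]; ring
    _ ≤ B * (2 / c * (Real.exp (-(c / 2) * A ^ 3) / A)) :=
        mul_le_mul_of_nonneg_left (exp_neg_mul_cube_le hc0 (by linarith)) hB0
    _ = _ := by ring

lemma lower_tail {d : ℕ} (hd : 3 ≤ d) (lam : ℝ) :
    ∃ D δ₀ : ℝ, 0 < δ₀ ∧
      ∀ δ : ℝ, 0 < δ → δ < δ₀ → ∀ n : ℕ, d < n → Even (d * n) → ∀ p : unitInterval,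
        (p : ℝ) = (1 + lam * (n : ℝ) ^ (-(1 / 3) : ℝ)) / ((d : ℝ) - 1) →
        (randomRegularPercolation n d p).real
            {G | largestComponent G < ⌈δ * (n : ℝ) ^ (2 / 3 : ℝ)⌉₊}
          ≤ D * δ ^ (1 / 2 : ℝ) := by
  have hD : (3 : ℝ) ≤ d := by exact_mod_cast hd
  have hD1 : (0 : ℝ) < d - 1 := by linarith
  set M := 8 * (|lam| + 2 + 12 * (d : ℝ) ^ 2) with hM
  have hM0 : 0 < M := by positivity
  have hM1 : 1 ≤ M := by
    have := abs_nonneg lam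
    have := sq_nonneg (d : ℝ)
    linarith
  have hB0 : 0 ≤ simpleConst d * (50 * (d : ℝ) ^ 3 + 2 * d) :=
    mul_nonneg (simpleConst_nonneg d) (by positivity)
  refine ⟨simpleConst d * (50 * (d : ℝ) ^ 3 + 2 * d) + (8 + 32 * d), (1 / M) ^ 4,
    by positivity, ?_⟩
  intro δ hδ hδ0 n hdn heven p hp
  obtain ⟨hν1, hνn, hn2, hn3⟩ := cube_root_facts (by omega : 1 ≤ n)
  rw [hn2]
  rw [hn3] at hp
  set ν := (n : ℝ) ^ (1 / 3 : ℝ)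
  clear_value ν
  have hp' : (p : ℝ) * ((d : ℝ) - 1) = 1 + lam / ν := by
    rw [hp, div_mul_cancel₀ _ hD1.ne']; ring
  obtain ⟨x, hx, hx4, hx2⟩ : ∃ x : ℝ, 0 < x ∧ x ^ 4 = δ ∧ δ ^ (1 / 2 : ℝ) = x ^ 2 := by
    refine ⟨δ ^ (1 / 4 : ℝ), by positivity, ?_, ?_⟩ <;>
    · rw [← Real.rpow_natCast, ← Real.rpow_mul hδ.le]
      norm_num
  have hxM : x < 1 / M := by
    rw [← hx4] at hδ0
    exact lt_of_pow_lt_pow_left₀ 4 (by positivity) hδ0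
  have hxL : x * M ≤ 1 := by
    rw [lt_div_iff₀ hM0] at hxM
    exact hxM.le
  have hx1 : x ≤ 1 := by nlinarith only [hxL, hM1, hx]
  rw [hx2, add_mul]
  have hE1 : 0 ≤ simpleConst d * (50 * (d : ℝ) ^ 3 + 2 * d) * x ^ 2 := by positivity
  have hE2 : 0 ≤ (8 + 32 * d : ℝ) * x ^ 2 := by positivity
  rcases le_or_gt (δ * ν ^ 2) 1 with hδν | hδν
  · -- a component has at least one vertex
    have hempty : {G : SimpleGraph (Fin n) | largestComponent G < ⌈δ * ν ^ 2⌉₊} = ∅ := by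
      refine Set.eq_empty_of_forall_notMem fun G hG => ?_
      have h1 : largestComponent G < ⌈δ * ν ^ 2⌉₊ := hG
      have h2 : ⌈δ * ν ^ 2⌉₊ ≤ 1 := Nat.ceil_le.2 (by exact_mod_cast hδν)
      have h3 := one_le_largestComponent (by omega) G
      omega
    rw [hempty, measureReal_empty]
    exact add_nonneg hE1 hE2
  have hxν : 1 ≤ x ^ 2 * ν := by
    have h1 : 1 ^ 2 < (x ^ 2 * ν) ^ 2 := by
      rw [← hx4] at hδν
      calc (1 : ℝ) ^ 2 = 1 := one_pow 2
        _ < _ := hδν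
        _ = _ := by ring
    exact (lt_of_pow_lt_pow_left₀ 2 (by positivity) h1).le
  rcases le_or_gt ν (8 + 32 * d) with hνd | hνd
  · -- for bounded `n` the bound exceeds `1`
    refine (randomRegularPercolation_real_le_one n d p _).trans (le_add_of_nonneg_of_le hE1 ?_)
    have := mul_le_mul_of_nonneg_left hνd (sq_nonneg x)
    linarith
  have hnbig : 8 + 32 * d ≤ n := by
    have h1 : ν ≤ n := hνn ▸ le_self_pow₀ hν1 (by norm_num)
    have h2 : (8 + 32 * d : ℝ) ≤ n := by linarith
    exact_mod_cast h2
  obtain ⟨N, hN⟩ : ∃ N, 2 * N = n * d := by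
    obtain ⟨N, hN⟩ := heven
    exact ⟨N, by rw [mul_comm n d]; omega⟩
  have hbig : 2 * (2 * (d * (2 + 2 * d)) + 12 * d ^ 2) ≤ n * d := by
    have := Nat.mul_le_mul_right d hnbig
    linarith
  have hN3 : 3 ≤ N := by nlinarith
  have hk₀ : (⌈δ * ν ^ 2⌉₊ : ℝ) ≤ 2 * x ^ 4 * ν ^ 2 := by
    have := (Nat.ceil_lt_add_one (by linarith : 0 ≤ δ * ν ^ 2)).le
    rw [hx4]
    linarith
  refine (real_small_component_le hd hN hN3 hbig p (by linarith) hνn hp' hx hx1 hxL hxν hk₀).trans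
    (le_add_of_le_of_nonneg (le_of_eq ?_) hE2)
  ring

end CriticalWindow

end RegularPercolation

theorem theorem2 (d : ℕ) (hd : 3 ≤ d) (lam : ℝ) :
    (∃ c C : ℝ, 0 < c ∧
      ∀ A : ℝ, 0 < A → ∀ n : ℕ, d < n → Even (d * n) → ∀ p : unitInterval,
        (p : ℝ) = (1 + lam * (n : ℝ) ^ (-(1 / 3) : ℝ)) / ((d : ℝ) - 1) →
        (randomRegularPercolation n d p).real
            {G | A * (n : ℝ) ^ (2 / 3 : ℝ) ≤ (largestComponent G : ℝ)}
          ≤ C * Real.exp (-c * A ^ 3) / A) ∧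
    (∃ D δ₀ : ℝ, 0 < δ₀ ∧
      ∀ δ : ℝ, 0 < δ → δ < δ₀ → ∀ n : ℕ, d < n → Even (d * n) → ∀ p : unitInterval,
        (p : ℝ) = (1 + lam * (n : ℝ) ^ (-(1 / 3) : ℝ)) / ((d : ℝ) - 1) →
        (randomRegularPercolation n d p).real
            {G | largestComponent G < ⌈δ * (n : ℝ) ^ (2 / 3 : ℝ)⌉₊}
          ≤ D * δ ^ (1 / 2 : ℝ)) :=
  ⟨RegularPercolation.upper_tail hd lam, RegularPercolation.lower_tail hd lam⟩
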